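/- Let $\mathcal H_P=\mathbb C^3$ with basis $|0\rangle,|1\rangle,|2\rangle$. A qutrit probe evolves by $\dot\rho=-i[\omega H,\rho]+L\rho L^\dagger-\tfrac12\{L^\dagger L,\rho\}$, where $$H=\begin{pmatrix}1&0&0\\0&-1&-1\\0&-1&-1\end{pmatrix},\qquad L=\begin{pmatrix}0&1&1\\0&0&1\\0&0&0\end{pmatrix}.$$ Let $\mathcal S$ be the real span of $\mathbb 1$, $L+L^\dagger$, $i(L-L^\dagger)$, $L^\dagger L$, let $\|\cdot\|$ be the operator norm, and $\|H-\mathcal S\|=\inf_{X\in\mathcal S}\|H-X\|$. Let $A^{(\ell)}$ denote $A$ acting on the $\ell$-th of several probes; ancillas are noiseless and carry no signal. 1. $H\notin\mathcal S$. With $S=\tfrac12\mathbb 1-L^\dagger L\in\mathcal S$ one has $H-S=\mathrm{diag}(\tfrac12,-\tfrac12,\tfrac12)$, and $\|H-\mathcal S\|=\min_{X\in\mathcal S}\|H-X\|=\|H-S\|=\tfrac12$. 2. The density matrices $\rho_0=\tfrac12(|0\rangle\langle0|+|2\rangle\langle2|)$ and $\rho_1=|1\rangle\langle1|$ satisfy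 $\mathrm{Tr}(\rho_0\rho_1)=0$. They are the unique pair of density matrices with $\mathrm{Tr}((\rho_0-\rho_1)H)=2\|H-\mathcal S\|$ and $\mathrm{Tr}((\rho_0-\rho_1)X)=0$ for all $X\in\mathcal S$. 3. In $\mathcal H_P^{\otimes4}\otimes\mathbb C^3$ let $$|0_L\rangle=\tfrac1{\sqrt6}\big((|0022\rangle+|2200\rangle)|0\rangle_A+(|0202\rangle+|2020\rangle)|1\rangle_A+(|0220\rangle+|2002\rangle)|2\rangle_A\big),\qquad |1_L\rangle=|1111\rangle|0\rangle_A .$$ These vectors are orthonormal. With $Q_0=\tfrac1{\sqrt{12}}(|0\rangle\langle0|-|2\rangle\langle2|)$ and $Q_1=0$ they satisfy the multi-probe condition: each $Q_k$ is Hermitian with $\mathrm{Tr}\,Q_k=\mathrm{Tr}(Q_kL)=0$, and for all $k,k'\in\{0,1\}$ and $\ell\ne\ell'$, tracing out everything except probes $\ell,\ell'$ gives $$\mathrm{Tr}_{\backslash\{\ell,\ell'\}}(|k_L\rangle\langle k'_L|)=\delta_{kk'}(\rho_k\otimes\rho_k-Q_k\otimes Q_k).$$ 4. Let $P=|0_L\rangle\langle0_L|+|1_L\rangle\langle1_L|$,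 $Z_L=|0_L\rangle\langle0_L|-|1_L\rangle\langle1_L|$, $m=4$. There is a quantum channel $\mathcal R$ with $P\mathcal R(\cdot)P=\mathcal R(\cdot)$, independent of $\omega$, $t$ and $n$, such that the operation $\mathcal C(X)=PXP+\mathcal R((\mathbb 1-P)X(\mathbb 1-P))$ has the following properties. (a) For every $\omega\in\mathbb R$ and every $\rho=P\rho P$, $K$ rounds of free evolution for time $t/K$ followed by $\mathcal C$, applied to $\rho$, converge as $K\to\infty$, for every $t\ge0$, to $\rho_L(t)$, where $\rho_L(0)=\rho$ and $\dot\rho_L=-i[\tfrac{\omega m}{2}Z_L,\rho_L]$. (b) Let $n\ge1$ and $N=4n$. Start $n$ such blocks in $\tfrac1{\sqrt2}(|0_L\rangle^{\otimes n}+|1_L\rangle^{\otimes n})$ and apply $K$ rounds of free evolution of all probes for time $t/K$ followed by $\mathcal C^{\otimes n}$. For every $t\ge0$ and $\omega$, the resulting states converge as $K\to\infty$ to a state $\rho_\omega(t)$ whose quantum Fisher information about $\omega$ is exactly $N^2t^2=4\|H-\mathcal S\|^2N^2t^2$. The quantum Fisher information of the $K$-round state also exists for each $K$ and converges to $N^2t^2$.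 Here the quantum Fisher information is $F(\rho_\omega)=\mathrm{Tr}(\rho_\omega\Lambda^2)$ with $\Lambda$ Hermitian and $\partial_\omega\rho_\omega=\tfrac12(\Lambda\rho_\omega+\rho_\omega\Lambda)$. 5. Let $W_0$ be the set of the six permutations of $0022$. Consider the codes $|0_L\rangle=\tfrac1{\sqrt6}\sum_{w\in W_0}|w\rangle|c(w)\rangle_A$, $|1_L\rangle=|1111\rangle|c(1111)\rangle_A$, where $c$ assigns to each string an element of a fixed orthonormal basis of a $D$-dimensional ancilla. The least $D$ for which some such code satisfies the multi-probe condition, with $\rho_0,\rho_1$ as above and some admissible $Q_0,Q_1$, is $3$. Moreover, form the graph on $W_0\cup\{1111\}$ in which distinct $w,w'$ are joined iff $B$ acting on some two distinct probes $\ell,\ell'$ has a nonzero matrix element between them, for some $B\in\mathrm{span}\{X\otimes\mathbb 1,\mathbb 1\otimes X,L^\dagger\otimes L:X\in\mathcal S\}$. Two strings are joined iff one arises from the other by swapping two sites with different entries, and the chromatic number of the graph is $3$. -/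

import Mathlib

open Filter Topology
open scoped Matrix Kronecker Matrix.Norms.L2Operator ComplexOrder

noncomputable section

namespace QutritSensing

/-- Operators (and density operators) on the Hilbert space with orthonormal basis `I`. The norm is
the operator norm of `ℂ^I`. -/
abbrev Op (I : Type) := Matrix I I ℂ

/-- Superoperators. -/
abbrev SuperOp (I : Type) := Op I →ₗ[ℂ] Op I

/-- The operator `|ψ⟩⟨φ|`. -/
def ketbra {I : Type} (ψ φ : I → ℂ) : Op I := Matrix.vecMulVec ψ (star φ)

/-! ### The Lindblad span and the distance of the Hamiltonian to it -/

/-- The Lindblad span of a single Lindblad operator: the real linear space of Hermitian operators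
spanned by `1`, `L + L†`, `i (L - L†)` and `L† L`. -/
def lindbladSpan {I : Type} [Fintype I] [DecidableEq I] (L : Op I) : Submodule ℝ (Op I) :=
  Submodule.span ℝ {1, L + Lᴴ, Complex.I • (L - Lᴴ), Lᴴ * L}

/-- `‖H - 𝒮‖ = inf_{S ∈ 𝒮} ‖H - S‖` in operator norm. -/
def lindbladDist {I : Type} [Fintype I] [DecidableEq I] (H L : Op I) : ℝ :=
  sInf ((fun S : Op I => ‖H - S‖) '' (lindbladSpan L : Set (Op I)))

/-- Density operators. -/
def IsDensity {I : Type} [Fintype I] (ρ : Op I) : Prop := ρ.PosSemidef ∧ ρ.trace = 1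

/-! ### Master equations -/

/-- The generator `ρ ↦ -i[ωH, ρ] + ∑ᵢ (Lᵢ ρ Lᵢ† - ½ {Lᵢ† Lᵢ, ρ})`. -/
def lindbladian {I κ : Type} [Fintype I] [Fintype κ] (H : Op I) (J : κ → Op I) (ω : ℝ) :
    SuperOp I where
  toFun ρ := (-Complex.I * ω) • (H * ρ - ρ * H) +
    ∑ i, (J i * ρ * (J i)ᴴ - (1 / 2 : ℂ) • ((J i)ᴴ * J i * ρ + ρ * ((J i)ᴴ * J i)))
  map_add' ρ σ := by
    simp only [mul_add, add_mul, add_sub_add_comm]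
    simp only [smul_add, smul_sub, Finset.sum_add_distrib, Finset.sum_sub_distrib]
    abel
  map_smul' c ρ := by
    simp only [Matrix.mul_smul, Matrix.smul_mul, RingHom.id_apply, smul_add, smul_sub,
      Finset.smul_sum, smul_comm c]

/-- The evolution for time `s` under `dρ/ds = 𝓛 ρ`, i.e. `exp (s 𝓛)`; the exponential is taken of
the matrix of `𝓛` in the basis of matrix units. -/
def evolution {I : Type} [Fintype I] [DecidableEq I] (𝓛 : SuperOp I) (s : ℝ) : SuperOp I :=
  Matrix.toLin (Matrix.stdBasis ℂ I I) (Matrix.stdBasis ℂ I I) (NormedSpace.exp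
    ((s : ℂ) • LinearMap.toMatrix (Matrix.stdBasis ℂ I I) (Matrix.stdBasis ℂ I I) 𝓛))

/-- The evolution starts at the identity. -/
theorem evolution_zero {I : Type} [Fintype I] [DecidableEq I] (𝓛 : SuperOp I) (ρ : Op I) :
    evolution 𝓛 0 ρ = ρ := by
  simp [evolution]

/-- The evolution solves the master equation. -/
theorem evolution_hasDerivAt {I : Type} [Fintype I] [DecidableEq I] (𝓛 : SuperOp I) (ρ : Op I)
    (s : ℝ) (a b : I) :
    HasDerivAt (fun u : ℝ => evolution 𝓛 u ρ a b) (𝓛 (evolution 𝓛 s ρ) a b) s := by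
  have h := hasDerivAt_exp_smul_const' (𝕂 := ℂ)
    (LinearMap.toMatrix (Matrix.stdBasis ℂ I I) (Matrix.stdBasis ℂ I I) 𝓛) (s : ℂ)
  have h2 := ((LinearMap.toContinuousLinearMap
    ((Matrix.entryLinearMap ℂ ℂ a b : Op I →ₗ[ℂ] ℂ) ∘ₗ LinearMap.applyₗ ρ ∘ₗ
      (Matrix.toLin (Matrix.stdBasis ℂ I I) (Matrix.stdBasis ℂ I I)).toLinearMap)).hasFDerivAt.comp_hasDerivAt
        (s : ℂ) h).comp_ofReal
  refine h2.congr_deriv ?_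
  simp [evolution, Matrix.toLin_mul (Matrix.stdBasis ℂ I I) (Matrix.stdBasis ℂ I I)
    (Matrix.stdBasis ℂ I I)]

/-! ### Channels and error correction -/

/-- Quantum channels (completely positive and trace preserving), in Kraus form. -/
def IsChannel {I : Type} [Fintype I] [DecidableEq I] (Φ : SuperOp I) : Prop :=
  ∃ (r : ℕ) (K : Fin r → Op I),
    (∀ X, Φ X = ∑ i, K i * X * (K i)ᴴ) ∧ ∑ i, (K i)ᴴ * K i = 1

/-- `X ↦ A X A`. -/
def sandwich {I : Type} [Fintype I] (A : Op I) : SuperOp I :=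
  LinearMap.mulLeft ℂ A ∘ₗ LinearMap.mulRight ℂ A

/-- The error-correcting operation `𝒫 + ℛ ∘ 𝒫_⊥` of a code projection `P` and a recovery `ℛ`. -/
def qecOp {I : Type} [Fintype I] [DecidableEq I] (P : Op I) (R : SuperOp I) : SuperOp I :=
  sandwich P + R ∘ₗ sandwich (1 - P)

/-- `K` equally spaced rounds in total time `t`: free evolution for time `t / K` followed by the
operation `C`. -/
def rounds {I : Type} [Fintype I] [DecidableEq I] (C 𝓛 : SuperOp I) (t : ℝ) (K : ℕ) : SuperOp I :=
  (C ∘ₗ evolution 𝓛 (t / K)) ^ K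

/-- `Φ^{⊗ n}`, acting on `n` copies of the space with basis `I`. -/
def tensorPower {I : Type} [Fintype I] [DecidableEq I] (n : ℕ) (Φ : SuperOp I) :
    SuperOp (Fin n → I) where
  toFun X := Matrix.of fun w w' =>
    ∑ a : Fin n → I, ∑ b : Fin n → I,
      (∏ j, Φ (Matrix.single (a j) (b j) 1) (w j) (w' j)) * X a b
  map_add' X Y := by
    ext w w'
    simp [mul_add, Finset.sum_add_distrib]
  map_smul' c X := by
    ext w w'
    simp [Finset.mul_sum, mul_left_comm]

/-! ### Quantum Fisher information -/

/-- `F` is the quantum Fisher information `Tr(ρ_ω Λ²)` of the family `ρ` at `ω`, where `Λ` is a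
symmetric logarithmic derivative: a Hermitian operator with `∂_ω ρ_ω = ½ (Λ ρ_ω + ρ_ω Λ)`. -/
def IsQFI {I : Type} [Fintype I] [DecidableEq I] (ρ : ℝ → Op I) (ω F : ℝ) : Prop :=
  ∃ Λ : Op I, Λ.IsHermitian ∧
    (∀ a b, HasDerivAt (fun x => ρ x a b) (((1 / 2 : ℂ) • (Λ * ρ ω + ρ ω * Λ)) a b) ω) ∧
    (ρ ω * Λ ^ 2).trace = (F : ℂ)

/-! ### Probes and ancillas

The basis of `m` `d`-level probes together with an ancilla with basis `α` is `(Fin m → Fin d) × α`. -/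

/-- `A^{(ℓ)}`: the operator `A` acting on the `ℓ`-th probe. -/
def onProbe {m d : ℕ} {α : Type} [DecidableEq α] (ℓ : Fin m) (A : Op (Fin d)) :
    Op ((Fin m → Fin d) × α) :=
  Matrix.of fun p q =>
    if (∀ k, k ≠ ℓ → p.1 k = q.1 k) ∧ p.2 = q.2 then A (p.1 ℓ) (q.1 ℓ) else 0

/-- The operator `B` on two probes acting on the `ℓ`-th and `ℓ'`-th ones of `m` probes. -/
def onTwoProbes {m d : ℕ} (ℓ ℓ' : Fin m) (B : Op (Fin d × Fin d)) : Op (Fin m → Fin d) :=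
  Matrix.of fun w w' =>
    if ∀ k, k ≠ ℓ → k ≠ ℓ' → w k = w' k then B (w ℓ, w ℓ') (w' ℓ, w' ℓ') else 0

/-- The partial trace over everything except the `ℓ`-th and `ℓ'`-th probes. -/
def twoProbeMarginal {m d : ℕ} {α : Type} [Fintype α] (ℓ ℓ' : Fin m)
    (X : Op ((Fin m → Fin d) × α)) : Op (Fin d × Fin d) :=
  Matrix.of fun p q =>
    ∑ w : Fin m → Fin d, ∑ w' : Fin m → Fin d, ∑ x : α,
      if w ℓ = p.1 ∧ w ℓ' = p.2 ∧ w' ℓ = q.1 ∧ w' ℓ' = q.2 ∧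
          (∀ k, k ≠ ℓ → k ≠ ℓ' → w k = w' k)
      then X (w, x) (w', x) else 0

/-- `B` acting on the `j`-th of `n` blocks. -/
def onBlock {I : Type} [DecidableEq I] {n : ℕ} (j : Fin n) (B : Op I) : Op (Fin n → I) :=
  Matrix.of fun w w' => if ∀ k, k ≠ j → w k = w' k then B (w j) (w' j) else 0

/-- The multi-probe condition for code words `ψ 0, ψ 1`, with operators `ρ k` and `Q k`. -/
def MultiProbeCondition {m d : ℕ} {α : Type} [Fintype α] (L : Op (Fin d))
    (ρ Q : Fin 2 → Op (Fin d)) (ψ : Fin 2 → (Fin m → Fin d) × α → ℂ) : Prop :=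
  (∀ k, (Q k).IsHermitian ∧ (Q k).trace = 0 ∧ (Q k * L).trace = 0) ∧
  ∀ (k k' : Fin 2) (ℓ ℓ' : Fin m), ℓ ≠ ℓ' →
    twoProbeMarginal ℓ ℓ' (ketbra (ψ k) (ψ k')) =
      if k = k' then ρ k ⊗ₖ ρ k - Q k ⊗ₖ Q k else 0

/-- The generator for one block of `m` probes with a noiseless ancilla. -/
def blockGenerator (m : ℕ) {d : ℕ} (α : Type) [Fintype α] [DecidableEq α] (H L : Op (Fin d))
    (ω : ℝ) : SuperOp ((Fin m → Fin d) × α) :=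
  lindbladian (∑ ℓ : Fin m, onProbe ℓ H) (fun ℓ : Fin m => onProbe ℓ L) ω

/-- The generator for `n` blocks, each consisting of `m` probes and a noiseless ancilla: all `m n`
probes evolve independently under the same single-probe master equation. -/
def arrayGenerator (n m : ℕ) {d : ℕ} (α : Type) [Fintype α] [DecidableEq α] (H L : Op (Fin d))
    (ω : ℝ) : SuperOp (Fin n → (Fin m → Fin d) × α) :=
  lindbladian (∑ j : Fin n, ∑ ℓ : Fin m, onBlock j (onProbe ℓ H))
    (fun p : Fin n × Fin m => onBlock p.1 (onProbe p.2 L)) ω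

/-- The projection onto the code space spanned by (orthonormal) code words. -/
def codeProj {I : Type} (ψ : Fin 2 → I → ℂ) : Op I := ketbra (ψ 0) (ψ 0) + ketbra (ψ 1) (ψ 1)

/-- The logical Pauli-Z operator. -/
def logicalZ {I : Type} (ψ : Fin 2 → I → ℂ) : Op I := ketbra (ψ 0) (ψ 0) - ketbra (ψ 1) (ψ 1)

/-- The logical GHZ state `(|0_L⟩^{⊗ n} + |1_L⟩^{⊗ n}) / √2`. -/
def ghz {I : Type} (ψ : Fin 2 → I → ℂ) (n : ℕ) : (Fin n → I) → ℂ :=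
  fun w => (1 / (Real.sqrt 2 : ℂ)) * (∏ j, ψ 0 (w j) + ∏ j, ψ 1 (w j))

/-! ### The qutrit model -/

def qutritH : Op (Fin 3) := !![1, 0, 0; 0, -1, -1; 0, -1, -1]

def qutritL : Op (Fin 3) := !![0, 1, 1; 0, 0, 1; 0, 0, 0]

def qutritS : Op (Fin 3) := (1 / 2 : ℂ) • 1 - qutritLᴴ * qutritL

/-- `ρ_0 = (|0⟩⟨0| + |2⟩⟨2|) / 2` and `ρ_1 = |1⟩⟨1|`. -/
def qutritRho : Fin 2 → Op (Fin 3) :=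
  ![Matrix.diagonal ![1 / 2, 0, 1 / 2], Matrix.diagonal ![0, 1, 0]]

/-- `Q_0 = (|0⟩⟨0| - |2⟩⟨2|) / √12` and `Q_1 = 0`. -/
def qutritQ : Fin 2 → Op (Fin 3) :=
  ![(1 / (Real.sqrt 12 : ℂ)) • Matrix.diagonal ![1, 0, -1], 0]

/-- The basis state `|w⟩_P |a⟩_A`. -/
def ket (w : Fin 4 → Fin 3) (a : Fin 3) : (Fin 4 → Fin 3) × Fin 3 → ℂ := Pi.single (w, a) 1

/-- The code words of the (4,1)-qutrit code. -/
def code41 : Fin 2 → (Fin 4 → Fin 3) × Fin 3 → ℂ :=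
  ![(1 / (Real.sqrt 6 : ℂ)) •
      ((ket ![0, 0, 2, 2] 0 + ket ![2, 2, 0, 0] 0) +
       (ket ![0, 2, 0, 2] 1 + ket ![2, 0, 2, 0] 1) +
       (ket ![0, 2, 2, 0] 2 + ket ![2, 0, 0, 2] 2)),
    ket ![1, 1, 1, 1] 0]

/-- The six strings with two `0`s and two `2`s. -/
def W₀ : Finset (Fin 4 → Fin 3) :=
  {w | (Finset.univ.filter fun ℓ => w ℓ = 0).card = 2 ∧
       (Finset.univ.filter fun ℓ => w ℓ = 2).card = 2}

/-- The construction with a general ancilla of dimension `D`: each string `w` is tagged by an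
ancilla basis state `|c w⟩`, so that `|0_L⟩ = 6^{-1/2} ∑_{w ∈ W₀} |w⟩|c w⟩` and
`|1_L⟩ = |1111⟩|c 1111⟩`. -/
def taggedCode {D : ℕ} (c : (Fin 4 → Fin 3) → Fin D) :
    Fin 2 → (Fin 4 → Fin 3) × Fin D → ℂ :=
  ![(1 / (Real.sqrt 6 : ℂ)) • ∑ w ∈ W₀, Pi.single (w, c w) 1,
    Pi.single (![1, 1, 1, 1], c ![1, 1, 1, 1]) 1]

/-- The two-probe space `𝒮₂ = span {S ⊗ 1, 1 ⊗ S, L† ⊗ L : S ∈ 𝒮}`. -/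
def twoProbeSpan {d : ℕ} (L : Op (Fin d)) : Submodule ℂ (Op (Fin d × Fin d)) :=
  Submodule.span ℂ
    ({X | ∃ S ∈ lindbladSpan L, X = S ⊗ₖ (1 : Op (Fin d)) ∨ X = (1 : Op (Fin d)) ⊗ₖ S} ∪ {Lᴴ ⊗ₖ L})

/-- The strings used by the code: `W₀` and `1111`. -/
abbrev CodeString := {w : Fin 4 → Fin 3 // w ∈ W₀ ∨ w = ![1, 1, 1, 1]}

/-- Two different strings are adjacent iff some `S₂ ∈ 𝒮₂`, placed on two different probes, has a
nonzero matrix element between them. -/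
def conflictGraph : SimpleGraph CodeString :=
  SimpleGraph.fromRel fun w w' =>
    ∃ B ∈ twoProbeSpan qutritL, ∃ ℓ ℓ' : Fin 4, ℓ ≠ ℓ' ∧ onTwoProbes ℓ ℓ' B w.1 w'.1 ≠ 0

end QutritSensing

end

open QutritSensing

/-! The distance to the span is found by duality. The traceless operator `ρ₀ - ρ₁` annihilates the
Lindblad span, pairs to `1` with `H` and has trace norm `2`, so every `X` in the span satisfies `‖H
- X‖ ≥ 1/2`, and `S` attains this bound. A pair of states attaining the optimum must have `σ₁` in
the eigenspace of `H - S` for `-1/2` and `σ₀` in the one for `1/2`. The first is a line, and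
orthogonality to the span fixes what remains of `σ₀`.

The two-probe marginals of the code words count pairs of strings that agree off two sites and carry
the same ancilla tag. The multi-probe condition turns matrix elements of two-probe operators into
products of single-probe traces. Since `Tr ρ_k L = Tr Q_k L = 0` and `Tr ρ_k L†L = 1`, this yields
`P L_i P = 0` and `P L_i† L_j P = δ_ij P`: single jumps carry the code space isometrically onto
mutually orthogonal spaces, all orthogonal to the code, and a channel can undo them
(`isChannel_recovery`). To first order in time, correction cancels the dissipation and leaves the
commutator with `P H P = -2P + 2Z_L` (`qecOp_lindbladian`). A product formula with error `O(1/K)`,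
uniform for bounded complex `ω`, gives the logical unitary evolution
(`norm_rounds_sub_superExp_le`), and blockwise tensor powers give the array.

The Fisher information is not a continuous function of the state, so its convergence needs a
separate argument. The `K`-round state is holomorphic in `ω` and positive for real `ω`. In the frame
rotating with the limiting generator `G` it lies within `O(1/K)` of a constant. A function that is
nonnegative on the real axis and `ε`-close to a constant on the disc satisfies `|f'(0)|² ≤ 12 ε
f(0)` (`norm_deriv_sq_le_of_nonneg`). Applied to all quadratic forms, this yields a symmetric
logarithmic derivative `X` in the rotating frame with `Tr ρX² = O(1/K)`, even if `ρ` has tiny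
eigenvalues. Back in the original frame `X - 2iG` represents the derivative and bounds the Fisher
information from above; the variational formula, tested on the limiting logarithmic derivative,
bounds it from below (`exists_isQFI_tendsto`).

For the ancilla, two strings differing by a swap and sharing a tag would contribute a positive count
to a marginal entry that the condition makes equal to `-|Q|²`. Three strings that are pairwise swaps
of each other therefore need three tags, and these also form a clique in the conflict graph. -/

namespace QutritSensing

/-! ### Entries and the operator norm -/

section Entries

variable {I : Type}

theorem hasDerivAt_op_iff {𝕜 : Type} [RCLike 𝕜] [NormedSpace 𝕜 ℂ] [Fintype I]
    {f : 𝕜 → Op I} {g : Op I} {t : 𝕜} :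
    HasDerivAt f g t ↔ ∀ a b, HasDerivAt (fun s => f s a b) (g a b) t :=
  hasDerivAt_pi.trans (forall_congr' fun _ => hasDerivAt_pi)

variable [Fintype I]

theorem norm_toLp_sq (v : I → ℂ) : ((‖WithLp.toLp 2 v‖ ^ 2 : ℝ) : ℂ) = star v ⬝ᵥ v := by
  rw [EuclideanSpace.norm_sq_eq]
  simp only [dotProduct, Pi.star_apply, RCLike.star_def, Complex.conj_mul']
  push_cast
  rfl

variable [DecidableEq I]

/-- Matrix elements are bounded by the operator norm. -/
theorem norm_dotProduct_mulVec_le (A : Op I) (v w : I → ℂ) :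
    ‖star v ⬝ᵥ A *ᵥ w‖ ≤ ‖A‖ * ‖WithLp.toLp 2 v‖ * ‖WithLp.toLp 2 w‖ := by
  have h1 : star v ⬝ᵥ A *ᵥ w = inner ℂ (WithLp.toLp 2 v) (WithLp.toLp 2 (A *ᵥ w)) := by
    rw [EuclideanSpace.inner_eq_star_dotProduct, dotProduct_comm]
  rw [h1]
  have h2 := Matrix.l2_opNorm_mulVec A (WithLp.toLp 2 w)
  calc _ ≤ ‖WithLp.toLp 2 v‖ * ‖WithLp.toLp 2 (A *ᵥ w)‖ := norm_inner_le_norm _ _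
    _ ≤ ‖WithLp.toLp 2 v‖ * (‖A‖ * ‖WithLp.toLp 2 w‖) := by gcongr; exact h2
    _ = _ := by ring

theorem norm_entry_le (A : Op I) (a b : I) : ‖A a b‖ ≤ ‖A‖ := by
  have h := norm_dotProduct_mulVec_le A (Pi.single a 1) (Pi.single b 1)
  have e1 : ∀ a : I, ‖WithLp.toLp 2 (Pi.single a (1 : ℂ) : I → ℂ)‖ = 1 := fun a => by
    rw [← Real.sqrt_sq (norm_nonneg _), EuclideanSpace.norm_sq_eq]
    simp [Pi.single_apply, apply_ite]
  rw [e1, e1] at h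
  simpa [← Pi.single_star] using h

/-- Lets entrywise estimates, which are natural for tensor products, be read as norm estimates with
a constant depending only on the dimension. -/
theorem exists_norm_le_entries (I : Type) [Fintype I] [DecidableEq I] :
    ∃ c : ℝ, 0 ≤ c ∧ ∀ (A : Op I) (δ : ℝ), (∀ a b, ‖A a b‖ ≤ δ) → ‖A‖ ≤ c * δ := by
  refine ⟨∑ a : I, ∑ b : I, ‖Matrix.single a b (1 : ℂ)‖, by positivity, fun A δ h => ?_⟩
  conv_lhs => rw [Matrix.matrix_eq_sum_single A]
  refine (norm_sum_le _ _).trans ?_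
  rw [Finset.sum_mul]
  refine Finset.sum_le_sum fun a _ => (norm_sum_le _ _).trans ?_
  rw [Finset.sum_mul]
  refine Finset.sum_le_sum fun b _ => ?_
  have : Matrix.single a b (A a b) = A a b • Matrix.single a b (1 : ℂ) := by simp
  rw [this, norm_smul, mul_comm]
  gcongr
  exact h a b

end Entries

/-! ### Products of near-identity elements in a Banach algebra -/

section BanachAlgebra

/-- Telescoping. With `M = exp (C / K)` the factor `M ^ K` stays bounded, so an `O(1/K²)` difference
of factors costs only `O(1/K)` after `K` steps. -/
theorem norm_pow_sub_pow_le {𝔸 : Type} [NormedRing 𝔸] [NormOneClass 𝔸] {a b : 𝔸} {M : ℝ} (hM : 1 ≤ M) (ha : ‖a‖ ≤ M) (hb : ‖b‖ ≤ M)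
    (K : ℕ) : ‖a ^ K - b ^ K‖ ≤ K * M ^ K * ‖a - b‖ := by
  induction K with
  | zero => simp
  | succ K ih =>
    have hbK : ‖b ^ K‖ ≤ M ^ K := (norm_pow_le _ _).trans (by gcongr)
    have e : a ^ (K + 1) - b ^ (K + 1) = (a ^ K - b ^ K) * a + b ^ K * (a - b) := by
      rw [pow_succ, pow_succ]; noncomm_ring
    calc _ ≤ ‖a ^ K - b ^ K‖ * ‖a‖ + ‖b ^ K‖ * ‖a - b‖ := by
          rw [e]
          exact (norm_add_le _ _).trans (add_le_add (norm_mul_le _ _) (norm_mul_le _ _))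
      _ ≤ (K * M ^ K * ‖a - b‖) * M + M ^ K * ‖a - b‖ := by gcongr
      _ ≤ (K * M ^ K * ‖a - b‖) * M + M ^ K * M * ‖a - b‖ := by
          gcongr
          exact le_mul_of_one_le_right (by positivity) hM
      _ = _ := by push_cast; ring

variable {𝔸 : Type} [NormedRing 𝔸] [NormedAlgebra ℂ 𝔸] [CompleteSpace 𝔸] [NormOneClass 𝔸]

/-- Taylor's bound for the exponential in a Banach algebra. -/
theorem norm_exp_sub_sum_le (x : 𝔸) (n : ℕ) :
    ‖NormedSpace.exp x - ∑ i ∈ Finset.range n, ((i.factorial : ℂ)⁻¹) • x ^ i‖ ≤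
      ‖x‖ ^ n * Real.exp ‖x‖ := by
  have h := NormedSpace.exp_series_hasSum_exp' (𝕂 := ℂ) x
  have hr := NormedSpace.exp_series_hasSum_exp' (𝕂 := ℝ) (‖x‖ : ℝ)
  rw [← Real.exp_eq_exp_ℝ] at hr
  have hs : ∀ i, ‖(((i + n).factorial : ℂ)⁻¹) • x ^ (i + n)‖ ≤
      ‖x‖ ^ n * ((i.factorial : ℝ)⁻¹ • ‖x‖ ^ i) := fun i => by
    rw [norm_smul, norm_inv, Complex.norm_natCast, smul_eq_mul]
    have h1 : ((i + n).factorial : ℝ)⁻¹ ≤ (i.factorial : ℝ)⁻¹ := by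
      gcongr
      exact Nat.le_add_right i n
    calc _ ≤ (i.factorial : ℝ)⁻¹ * ‖x‖ ^ (i + n) :=
          mul_le_mul h1 (norm_pow_le _ _) (norm_nonneg _) (by positivity)
      _ = _ := by ring
  rw [← h.tsum_eq, ← h.summable.sum_add_tsum_nat_add n, add_sub_cancel_left]
  exact tsum_of_norm_bounded (hr.mul_left _) hs

theorem norm_exp_le (x : 𝔸) : ‖NormedSpace.exp x‖ ≤ Real.exp ‖x‖ := by
  simpa using norm_exp_sub_sum_le x 0

theorem norm_exp_sub_one_sub_le (x : 𝔸) :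
    ‖NormedSpace.exp x - 1 - x‖ ≤ ‖x‖ ^ 2 * Real.exp ‖x‖ := by
  simpa [Finset.sum_range_succ, sub_sub] using norm_exp_sub_sum_le x 2

/-- A product formula with an explicit rate: a factor that agrees with `1 + x` to second order
yields the exponential. -/
theorem norm_pow_sub_exp_le {σ x : 𝔸} {c D : ℝ} {K : ℕ} (hK : 1 ≤ K)
    (hx : ‖x‖ ≤ c / K) (hσ : ‖σ - 1 - x‖ ≤ D / (K : ℝ) ^ 2) :
    ‖σ ^ K - NormedSpace.exp (K • x)‖ ≤
      (D + c ^ 2 * Real.exp c) * Real.exp (c + D) / K := by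
  let _ : NormedAlgebra ℚ 𝔸 := NormedAlgebra.restrictScalars ℚ ℂ 𝔸
  have hK' : (1 : ℝ) ≤ K := by exact_mod_cast hK
  have hc : 0 ≤ c := by
    have := (norm_nonneg _).trans hx
    by_contra hc
    exact absurd this (not_le.2 (div_neg_of_neg_of_pos (not_le.1 hc) (by positivity)))
  have hD : 0 ≤ D := by
    have := (norm_nonneg _).trans hσ
    by_contra hc
    exact absurd this (not_le.2 (div_neg_of_neg_of_pos (not_le.1 hc) (by positivity)))
  have hxc : ‖x‖ ≤ c := hx.trans (div_le_self hc hK')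
  have hM : ‖σ‖ ≤ Real.exp ((c + D) / K) := by
    have : σ = 1 + x + (σ - 1 - x) := by abel
    calc ‖σ‖ ≤ 1 + c / K + D / (K : ℝ) ^ 2 := by
          rw [this]
          refine (norm_add₃_le).trans ?_
          rw [norm_one]
          gcongr
      _ ≤ 1 + c / K + D / K := by
          gcongr
          exact le_self_pow₀ hK' two_ne_zero
      _ = (c + D) / K + 1 := by ring
      _ ≤ _ := Real.add_one_le_exp _
  have hM' : ‖NormedSpace.exp x‖ ≤ Real.exp ((c + D) / K) :=
    (norm_exp_le x).trans (Real.exp_le_exp.2 (hx.trans (by gcongr; linarith)))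
  have hd : ‖σ - NormedSpace.exp x‖ ≤ (D + c ^ 2 * Real.exp c) / (K : ℝ) ^ 2 := by
    have : σ - NormedSpace.exp x = (σ - 1 - x) - (NormedSpace.exp x - 1 - x) := by abel
    rw [this]
    refine (norm_sub_le _ _).trans ?_
    rw [add_div]
    refine add_le_add hσ ((norm_exp_sub_one_sub_le x).trans ?_)
    calc _ ≤ (c / K) ^ 2 * Real.exp c := by gcongr
      _ = _ := by ring
  have h := norm_pow_sub_pow_le (Real.one_le_exp (by positivity)) hM hM' K
  rw [NormedSpace.exp_nsmul]
  refine h.trans ?_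
  rw [← Real.exp_nat_mul, mul_div_cancel₀ _ (by positivity)]
  calc _ ≤ K * Real.exp (c + D) * ((D + c ^ 2 * Real.exp c) / (K : ℝ) ^ 2) := by gcongr
    _ = _ := by field_simp

end BanachAlgebra

/-- The exponential acts on an eigenvector through the exponential of the eigenvalue. -/
theorem exp_apply_of_eigenvector {𝔸 : Type} [NormedRing 𝔸] [NormedAlgebra ℂ 𝔸]
    [CompleteSpace 𝔸] {E : Type} [NormedAddCommGroup E] [NormedSpace ℂ E]
    (f : 𝔸 →L[ℂ] E) {A : 𝔸} {μ : ℂ} (h : ∀ k : ℕ, f (A ^ k) = μ ^ k • f 1) :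
    f (NormedSpace.exp A) = Complex.exp μ • f 1 := by
  have h1 := f.hasSum (NormedSpace.exp_series_hasSum_exp' (𝕂 := ℂ) A)
  have h2 := (NormedSpace.exp_series_hasSum_exp' (𝕂 := ℂ) μ).smul_const (f 1)
  rw [← Complex.exp_eq_exp_ℂ] at h2
  refine h1.unique ?_
  convert h2 using 2 with k
  rw [map_smul, h, smul_assoc]

/-! ### Nonnegative holomorphic functions -/

/-- A holomorphic function which is nonnegative on the real axis and close to a constant has a
derivative at `0` controlled by the square root of its value there. -/
theorem norm_deriv_sq_le_of_nonneg {f : ℂ → ℂ} (hf : Differentiable ℂ f)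
    (hpos : ∀ x : ℝ, 0 ≤ f x) {c : ℂ} {ε : ℝ}
    (hε : ∀ z : ℂ, ‖z‖ ≤ 1 → ‖f z - c‖ ≤ ε) :
    ‖deriv f 0‖ ^ 2 ≤ 12 * ε * ‖f 0‖ := by
  have hε0 : 0 ≤ ε := (norm_nonneg _).trans (hε 0 (by simp))
  have hd : ‖deriv f 0‖ ≤ ε := by
    have h := Complex.norm_deriv_le_of_forall_mem_sphere_norm_le (f := fun z => f z - c) (c := 0)
      (R := 1) (C := ε) one_pos (hf.sub_const c).diffContOnCl
      (fun z hz => hε z (by simpa using (mem_sphere_zero_iff_norm.1 hz).le))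
    simpa using h
  -- `q` is the second-order Taylor quotient. It is entire, so by the maximum principle its bound on
  -- the disc follows from the unit circle, where three terms of size at most `ε` add up to `3 * ε`.
  set q : ℂ → ℂ := dslope (dslope f 0) 0 with hq
  have hq1 : Differentiable ℂ (dslope f 0) := by
    rw [← differentiableOn_univ, Complex.differentiableOn_dslope Filter.univ_mem]
    exact hf.differentiableOn
  have hqd : Differentiable ℂ q := by
    rw [← differentiableOn_univ, Complex.differentiableOn_dslope Filter.univ_mem]
    exact hq1.differentiableOn
  have hexp : ∀ z, f z = f 0 + deriv f 0 * z + q z * z ^ 2 := fun z => by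
    have e1 := sub_smul_dslope f 0 z
    have e2 := sub_smul_dslope (dslope f 0) 0 z
    rw [dslope_same] at e2
    simp only [sub_zero, smul_eq_mul] at e1 e2
    rw [← hq] at e2
    linear_combination -e1 - z * e2
  have hqb : ∀ z : ℂ, ‖z‖ ≤ 1 → ‖q z‖ ≤ 3 * ε := fun z hz => by
    refine Complex.norm_le_of_forall_mem_frontier_norm_le (U := Metric.ball 0 1)
      Metric.isBounded_ball hqd.diffContOnCl (fun w hw => ?_)
      (by rw [closure_ball _ one_ne_zero]; simpa using hz)
    rw [frontier_ball _ one_ne_zero, mem_sphere_zero_iff_norm] at hw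
    have e : q w * w ^ 2 = (f w - c) - (f 0 - c) - deriv f 0 * w := by rw [hexp w]; ring
    have e' : ‖q w‖ = ‖q w * w ^ 2‖ := by rw [norm_mul, norm_pow, hw]; simp
    rw [e', e]
    refine (norm_sub_le _ _).trans ?_
    have h1 := norm_sub_le (f w - c) (f 0 - c)
    have h2 := hε w hw.le
    have h3 := hε 0 (by simp)
    rw [norm_mul, hw, mul_one]
    linarith
  have him : (deriv f 0).im = 0 := by
    have h1 : HasDerivAt (fun x : ℝ => (f x).im) (deriv f 0).im 0 := by
      have h := (hf.differentiableAt (x := ((0 : ℝ) : ℂ))).hasDerivAt.comp_ofReal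
      have h2 := Complex.imCLM.hasFDerivAt.comp_hasDerivAt (0 : ℝ) h
      simpa [Function.comp_def] using h2
    have h2 : (fun x : ℝ => (f x).im) = fun _ => 0 := by
      funext x
      exact (Complex.le_def.1 (hpos x)).2.symm
    rw [h2] at h1
    exact h1.unique (hasDerivAt_const _ _)
  set a := (f 0).re with ha
  set b := (deriv f 0).re with hb
  have ha0 : 0 ≤ a := by simpa using (Complex.le_def.1 (hpos 0)).1
  have hnd : ‖deriv f 0‖ = |b| := by
    rw [← Complex.re_add_im (deriv f 0), him]; simp [hb]
  have hna : ‖f 0‖ = a := by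
    have : (f 0).im = 0 := by simpa using (Complex.le_def.1 (hpos 0)).2.symm
    rw [← Complex.re_add_im (f 0), this]
    simp only [Complex.ofReal_zero, zero_mul, add_zero, Complex.norm_real, Real.norm_eq_abs]
    exact abs_of_nonneg ha0
  have hreal : ∀ x : ℝ, |x| ≤ 1 → 0 ≤ a + b * x + 3 * ε * x ^ 2 := fun x hx => by
    have h0 := (Complex.le_def.1 (hpos x)).1
    have hx' : ‖(x : ℂ)‖ ≤ 1 := by simpa using hx
    have h1 : (q x * (x : ℂ) ^ 2).re ≤ 3 * ε * x ^ 2 := by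
      refine (Complex.re_le_norm _).trans ?_
      rw [norm_mul, norm_pow, Complex.norm_real, Real.norm_eq_abs, sq_abs]
      gcongr
      exact hqb x hx'
    rw [hexp x, Complex.add_re, Complex.add_re, Complex.mul_re, him, Complex.ofReal_re,
      Complex.ofReal_im, Complex.zero_re] at h0
    linarith
  rw [hnd, hna, sq_abs]
  rw [hnd] at hd
  rcases hε0.eq_or_lt with h0 | h0
  · rw [← h0] at hd ⊢
    have : b = 0 := abs_nonpos_iff.1 hd
    simp [this]
  -- The minimiser of the quadratic `a + b x + 3 ε x²`; it lies in `[-1, 1]` because `|b| ≤ ε`.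
  -- Nonnegativity there is the discriminant inequality, whence the `12`.
  · have h := hreal (-b / (6 * ε)) (by
      rw [abs_div, abs_neg, abs_of_pos (by positivity : 0 < 6 * ε), div_le_one (by positivity)]
      linarith)
    have e : a + b * (-b / (6 * ε)) + 3 * ε * (-b / (6 * ε)) ^ 2 = a - b ^ 2 / (12 * ε) := by
      field_simp
      ring
    rw [e, sub_nonneg, div_le_iff₀ (by positivity)] at h
    linarith


/-! ### Superoperators as matrices -/

section Superoperators

variable {I : Type} [Fintype I] [DecidableEq I]

/-- The matrix of a superoperator in the basis of matrix units. -/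
noncomputable def superRep (I : Type) [Fintype I] [DecidableEq I] : SuperOp I ≃ₐ[ℂ] Op (I × I) :=
  LinearMap.toMatrixAlgEquiv (Matrix.stdBasis ℂ I I)

/-- The exponential of a superoperator. -/
noncomputable def superExp (Φ : SuperOp I) : SuperOp I :=
  (superRep I).symm (NormedSpace.exp (superRep I Φ))

theorem superRep_superExp (Φ : SuperOp I) :
    superRep I (superExp Φ) = NormedSpace.exp (superRep I Φ) := by
  simp [superExp]

theorem evolution_eq_superExp (𝓛 : SuperOp I) (s : ℝ) :
    evolution 𝓛 s = superExp ((s : ℂ) • 𝓛) := by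
  simp only [superExp, map_smul]
  rfl

/-- Evaluation of (the matrix of) a superoperator at an operator. -/
noncomputable def evalRep (ρ : Op I) : Op (I × I) →L[ℂ] Op I :=
  LinearMap.toContinuousLinearMap
    (LinearMap.applyₗ ρ ∘ₗ (superRep I).symm.toLinearMap)

theorem evalRep_superRep (ρ : Op I) (Φ : SuperOp I) : evalRep ρ (superRep I Φ) = Φ ρ := by
  simp [evalRep]

theorem superExp_apply_of_eigenvector {Φ : SuperOp I} {ρ : Op I} {μ : ℂ} (h : Φ ρ = μ • ρ) :
    superExp Φ ρ = Complex.exp μ • ρ := by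
  have hk : ∀ k : ℕ, (Φ ^ k) ρ = μ ^ k • ρ := fun k => by
    induction k with
    | zero => simp
    | succ k ih => rw [pow_succ, Module.End.mul_apply, h, map_smul, ih, smul_smul, pow_succ']
  have h1 : evalRep ρ 1 = ρ := by
    rw [← map_one (superRep I), evalRep_superRep]; rfl
  have := exp_apply_of_eigenvector (evalRep ρ) (A := superRep I Φ) (μ := μ) fun k => by
    rw [← map_pow, evalRep_superRep, hk, h1]
  rwa [h1, ← superRep_superExp, evalRep_superRep] at this

/-- Frequent application of `C` projects the free evolution onto the range of a projection `π`
on which `C` acts trivially; the convergence is uniform for generators `A + z B` with bounded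
`z`. -/
theorem norm_rounds_sub_superExp_le [Nonempty I] {C π : SuperOp I} (hπC : π * C = C)
    (hCπ : C * π = π) (A B : SuperOp I) (t R : ℝ) {ρ : Op I} (hρ : π ρ = ρ) :
    ∃ E : ℝ, ∀ K : ℕ, 1 ≤ K → ∀ z : ℂ, ‖z‖ ≤ R →
      ‖((C * superExp (((t / K : ℝ) : ℂ) • (A + z • B))) ^ K) ρ -
        superExp ((t : ℂ) • (C * (A + z • B) * π)) ρ‖ ≤ E / K := by
  set q := ‖superRep I C‖ * ‖superRep I π‖ with hq
  set l := ‖superRep I A‖ + R * ‖superRep I B‖ with hl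
  set c := |t| * q * l with hc
  set D := q * (|t| * l) ^ 2 * Real.exp (|t| * l) with hD
  refine ⟨‖evalRep ρ‖ * ((D + c ^ 2 * Real.exp c) * Real.exp (c + D)), fun K hK z hz => ?_⟩
  have hK' : (1 : ℝ) ≤ K := by exact_mod_cast hK
  set h : ℂ := ((t / K : ℝ) : ℂ) with hh
  have hnh : ‖h‖ = |t| / K := by
    rw [hh, Complex.norm_real, Real.norm_eq_abs, abs_div, Nat.abs_cast]
  set 𝓛 := A + z • B with h𝓛
  have hlL : ‖superRep I 𝓛‖ ≤ l := by
    rw [h𝓛, map_add, map_smul]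
    refine (norm_add_le _ _).trans ?_
    rw [norm_smul, hl]
    gcongr
  have hl0 : 0 ≤ l := (norm_nonneg _).trans hlL
  have hhL : ‖h • superRep I 𝓛‖ ≤ |t| * l / K := by
    rw [norm_smul, hnh, div_mul_eq_mul_div]
    gcongr
  set T : SuperOp I := superExp (h • 𝓛) with hT
  -- `C * T` itself is not close to the identity. Since `C * π = π`, the modification `σ` equals `1
  -- + C (T - 1) π`, which is `1 + O(1/K)`, and it has the same powers as `C * T` on vectors fixed
  -- by `π`.
  set σ : SuperOp I := 1 - π + C * T * π with hσ
  have hpow : ∀ k : ℕ, (σ ^ k) ρ = ((C * T) ^ k) ρ ∧ π (((C * T) ^ k) ρ) = ((C * T) ^ k) ρ := by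
    intro k
    induction k with
    | zero => simpa using hρ
    | succ k ih =>
      have e : ((C * T) ^ (k + 1)) ρ = C (T (((C * T) ^ k) ρ)) := by
        rw [pow_succ']; rfl
      refine ⟨?_, ?_⟩
      · rw [pow_succ', Module.End.mul_apply, ih.1, e, hσ]
        simp [ih.2]
      · rw [e, ← Module.End.mul_apply, hπC]
  have hx : ‖superRep I (h • (C * 𝓛 * π))‖ ≤ c / K := by
    have e : superRep I (h • (C * 𝓛 * π)) =
        superRep I C * (h • superRep I 𝓛) * superRep I π := by
      simp only [map_smul, map_mul, mul_smul_comm, smul_mul_assoc]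
    rw [e]
    calc _ ≤ ‖superRep I C‖ * (|t| * l / K) * ‖superRep I π‖ := by
          refine (norm_mul_le _ _).trans ?_
          gcongr
          refine (norm_mul_le _ _).trans ?_
          gcongr
      _ = _ := by rw [hc, hq]; ring
  have hs : ‖superRep I σ - 1 - superRep I (h • (C * 𝓛 * π))‖ ≤ D / (K : ℝ) ^ 2 := by
    have e : superRep I σ - 1 - superRep I (h • (C * 𝓛 * π)) =
        superRep I C * (NormedSpace.exp (h • superRep I 𝓛) - 1 - h • superRep I 𝓛) *
          superRep I π := by
      have e0 : superRep I C * superRep I π = superRep I π := by rw [← map_mul, hCπ]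
      have e1 : superRep I T = NormedSpace.exp (h • superRep I 𝓛) := by
        rw [hT, superRep_superExp, map_smul]
      rw [hσ]
      simp only [map_add, map_sub, map_one, map_mul, map_smul, e1, mul_sub, sub_mul, mul_one, e0,
        mul_smul_comm, smul_mul_assoc]
      abel
    rw [e]
    calc _ ≤ ‖superRep I C‖ * ((|t| * l / K) ^ 2 * Real.exp (|t| * l)) * ‖superRep I π‖ := by
          refine (norm_mul_le _ _).trans ?_
          gcongr
          refine (norm_mul_le _ _).trans ?_
          gcongr
          refine (norm_exp_sub_one_sub_le _).trans ?_
          gcongr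
          exact hhL.trans (div_le_self (by positivity) hK')
      _ = _ := by rw [hD, hq]; ring
  have hmain := norm_pow_sub_exp_le hK hx hs
  have eK : K • superRep I (h • (C * 𝓛 * π)) = superRep I ((t : ℂ) • (C * 𝓛 * π)) := by
    rw [← map_nsmul, ← Nat.cast_smul_eq_nsmul ℂ, smul_smul, hh]
    congr 2
    push_cast
    rw [mul_div_cancel₀]
    exact_mod_cast (by positivity : (K : ℝ) ≠ 0)
  rw [eK, ← superRep_superExp, ← map_pow, ← map_sub] at hmain
  rw [← (hpow K).1, ← LinearMap.sub_apply, ← evalRep_superRep]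
  refine ((evalRep ρ).le_opNorm _).trans ?_
  rw [mul_div_assoc]
  gcongr

/-- Solutions of a linear master equation are unique. -/
theorem eq_evolution_of_hasDerivAt (𝓛 : SuperOp I) {y : ℝ → Op I}
    (hy : ∀ s a b, HasDerivAt (fun u => y u a b) (𝓛 (y s) a b) s) (s : ℝ) :
    y s = evolution 𝓛 s (y 0) := by
  set f : Op I →L[ℝ] Op I := (LinearMap.toContinuousLinearMap 𝓛).restrictScalars ℝ with hf
  refine congrFun (ODE_solution_unique_univ (v := fun _ => f) (s := fun _ => Set.univ)
    (K := ‖f‖₊) (t₀ := 0) (f := y) (g := fun u => evolution 𝓛 u (y 0))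
    (fun _ => f.lipschitz.lipschitzOnWith) (fun u => ⟨?_, trivial⟩) (fun u => ⟨?_, trivial⟩) ?_) s
  · exact hasDerivAt_op_iff.2 fun a b => hy u a b
  · exact hasDerivAt_op_iff.2 fun a b => evolution_hasDerivAt 𝓛 (y 0) u a b
  · simp [evolution_zero]

end Superoperators

/-! ### Positivity -/

section Positivity

variable {I : Type} [Fintype I]

theorem posSemidef_of_tendsto {f : ℕ → Op I} {A : Op I} (h : Tendsto f atTop (𝓝 A))
    (hf : ∀ᶠ n in atTop, (f n).PosSemidef) : A.PosSemidef := by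
  rw [Matrix.posSemidef_iff_dotProduct_mulVec]
  constructor
  · have h2 : Tendsto (fun n => (f n)ᴴ) atTop (𝓝 Aᴴ) :=
      ((continuous_id.matrix_conjTranspose).tendsto A).comp h
    exact tendsto_nhds_unique (h2.congr' (hf.mono fun n hn => hn.isHermitian)) h
  · intro v
    have hc : Continuous fun X : Op I => star v ⬝ᵥ X *ᵥ v := by fun_prop
    exact ge_of_tendsto ((hc.tendsto A).comp h)
      (hf.mono fun n hn => (Matrix.posSemidef_iff_dotProduct_mulVec.1 hn).2 v)

theorem posSemidef_ketbra (ψ : I → ℂ) : (ketbra ψ ψ).PosSemidef :=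
  Matrix.posSemidef_vecMulVec_self_star ψ

variable [DecidableEq I]

/-- A Lindblad evolution maps positive operators to positive operators. -/
theorem posSemidef_evolution [Nonempty I] {κ : Type} [Fintype κ] {H : Op I} (hH : H.IsHermitian)
    (J : κ → Op I) (ω : ℝ) {s : ℝ} (hs : 0 ≤ s) {ρ : Op I} (hρ : ρ.PosSemidef) :
    (evolution (lindbladian H J ω) s ρ).PosSemidef := by
  set 𝓛 := lindbladian H J ω with h𝓛
  -- The non-Hermitian effective generator: `𝓛 X = G X + X G† + ∑ J X J†`.
  set G : Op I := (-Complex.I * ω) • H - (1 / 2 : ℂ) • ∑ i, (J i)ᴴ * J i with hG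
  set Q : SuperOp I := LinearMap.mulLeft ℂ G ∘ₗ LinearMap.mulRight ℂ Gᴴ with hQ
  -- The Euler step plus the term `h² G X G†`, which completes `(1 + hG) X (1 + hG)†` and makes the
  -- step exactly completely positive for `h ≥ 0`. The change is of second order, so the powers
  -- still converge to the evolution.
  let step : ℝ → SuperOp I := fun h => 1 + (h : ℂ) • 𝓛 + ((h : ℂ) ^ 2) • Q
  have hGH : Gᴴ = (Complex.I * ω) • H - (1 / 2 : ℂ) • ∑ i, (J i)ᴴ * J i := by
    rw [hG, Matrix.conjTranspose_sub, Matrix.conjTranspose_smul, Matrix.conjTranspose_smul, hH.eq,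
      Matrix.conjTranspose_sum]
    simp
  have hstep : ∀ (h : ℝ) (X : Op I), step h X =
      (1 + (h : ℂ) • G) * X * (1 + (h : ℂ) • G)ᴴ + (h : ℂ) • ∑ i, J i * X * (J i)ᴴ := by
    intro h X
    have e1 : 𝓛 X = G * X + X * Gᴴ + ∑ i, J i * X * (J i)ᴴ := by
      rw [hGH, hG, h𝓛]
      simp only [lindbladian, LinearMap.coe_mk, AddHom.coe_mk, Finset.sum_sub_distrib,
        ← Finset.smul_sum, Finset.sum_add_distrib, sub_mul, mul_sub, Matrix.smul_mul,
        Matrix.mul_smul, Finset.sum_mul, Finset.mul_sum, smul_sub, smul_add, neg_mul, neg_smul]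
      abel
    have e2 : Q X = G * X * Gᴴ := by simp [hQ, mul_assoc]
    simp only [step, LinearMap.add_apply, LinearMap.smul_apply, Module.End.one_apply, e1, e2,
      Matrix.conjTranspose_add, Matrix.conjTranspose_smul, Matrix.conjTranspose_one,
      Complex.star_def, Complex.conj_ofReal, add_mul, mul_add, one_mul, mul_one, Matrix.smul_mul,
      Matrix.mul_smul, smul_add, smul_smul, pow_two]
    abel
  have hpos : ∀ (h : ℝ), 0 ≤ h → ∀ (k : ℕ), (((step h) ^ k) ρ).PosSemidef := by
    intro h hh k
    induction k with
    | zero => simpa using hρ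
    | succ k ih =>
      rw [pow_succ', Module.End.mul_apply, hstep]
      refine (ih.mul_mul_conjTranspose_same _).add (Matrix.PosSemidef.smul ?_ (by exact_mod_cast hh))
      exact Matrix.posSemidef_sum _ fun i _ => ih.mul_mul_conjTranspose_same _
  refine posSemidef_of_tendsto (f := fun K : ℕ => ((step (s / K)) ^ K) ρ) ?_
    (Eventually.of_forall fun K => hpos _ (by positivity) K)
  rw [tendsto_iff_norm_sub_tendsto_zero]
  set c := s * ‖superRep I 𝓛‖ with hc
  set D := s ^ 2 * ‖superRep I Q‖ with hD
  have hb : ∀ᶠ K : ℕ in atTop, ‖((step (s / K)) ^ K) ρ - evolution 𝓛 s ρ‖ ≤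
      ‖evalRep ρ‖ * ((D + c ^ 2 * Real.exp c) * Real.exp (c + D)) / K := by
    filter_upwards [eventually_ge_atTop 1] with K hK
    have hK' : (1 : ℝ) ≤ K := by exact_mod_cast hK
    have hn : ‖((s / K : ℝ) : ℂ)‖ = s / K := by
      rw [Complex.norm_real, Real.norm_eq_abs, abs_of_nonneg (by positivity)]
    have h1 : ‖superRep I (((s / K : ℝ) : ℂ) • 𝓛)‖ ≤ c / K := by
      rw [map_smul, norm_smul, hn, hc, div_mul_eq_mul_div]
    have h2 : ‖superRep I (step (s / K)) - 1 - superRep I (((s / K : ℝ) : ℂ) • 𝓛)‖ ≤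
        D / (K : ℝ) ^ 2 := by
      have e : superRep I (step (s / K)) - 1 - superRep I (((s / K : ℝ) : ℂ) • 𝓛) =
          (((s / K : ℝ) : ℂ) ^ 2) • superRep I Q := by
        simp only [step, map_add, map_one, map_smul]
        abel
      rw [e, norm_smul, norm_pow, hn, hD, div_pow, div_mul_eq_mul_div]
    have h3 := norm_pow_sub_exp_le hK h1 h2
    have eK : K • superRep I (((s / K : ℝ) : ℂ) • 𝓛) = superRep I ((s : ℂ) • 𝓛) := by
      rw [← map_nsmul, ← Nat.cast_smul_eq_nsmul ℂ, smul_smul]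
      congr 2
      push_cast
      rw [mul_div_cancel₀]
      exact_mod_cast (by positivity : (K : ℝ) ≠ 0)
    rw [eK, ← superRep_superExp, ← map_pow, ← map_sub] at h3
    rw [evolution_eq_superExp, ← LinearMap.sub_apply, ← evalRep_superRep]
    refine ((evalRep ρ).le_opNorm _).trans ?_
    rw [mul_div_assoc]
    gcongr
  refine squeeze_zero' (Eventually.of_forall fun _ => norm_nonneg _) hb ?_
  exact tendsto_const_div_atTop_nhds_zero_nat _

end Positivity


/-! ### Independent blocks -/

section Blocks

variable {I : Type}

/-- The product operator of `n` operators on the blocks. -/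
def tprod {n : ℕ} (x : Fin n → Op I) : Op (Fin n → I) :=
  Matrix.of fun w w' => ∏ j, x j (w j) (w' j)

theorem tprod_apply {n : ℕ} (x : Fin n → Op I) (w w' : Fin n → I) :
    tprod x w w' = ∏ j, x j (w j) (w' j) := rfl

theorem tprod_update_apply {n : ℕ} (x : Fin n → Op I) (j : Fin n) (y : Op I) (w w' : Fin n → I) :
    tprod (Function.update x j y) w w' =
      y (w j) (w' j) * ∏ k ∈ Finset.univ.erase j, x k (w k) (w' k) := by
  rw [tprod_apply, ← Finset.mul_prod_erase _ _ (Finset.mem_univ j)]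
  simp only [Function.update_self]
  congr 1
  exact Finset.prod_congr rfl fun k hk => by rw [Function.update_of_ne (Finset.ne_of_mem_erase hk)]

/-- The code words of `n` independent blocks. -/
theorem tprod_ketbra {n : ℕ} (ψ φ : I → ℂ) :
    tprod (fun _ : Fin n => ketbra ψ φ) =
      ketbra (fun w => ∏ j, ψ (w j)) (fun w => ∏ j, φ (w j)) := by
  ext w w'
  simp [tprod_apply, ketbra, Matrix.vecMulVec_apply, Finset.prod_mul_distrib]

variable [DecidableEq I]

theorem conjTranspose_onBlock {n : ℕ} (j : Fin n) (B : Op I) :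
    (onBlock j B)ᴴ = onBlock j Bᴴ := by
  ext w w'
  simp only [Matrix.conjTranspose_apply, onBlock, Matrix.of_apply, apply_ite star, star_zero]
  refine if_congr ?_ rfl rfl
  exact forall₂_congr fun _ _ => eq_comm

theorem onBlock_sum {n : ℕ} {κ : Type} [Fintype κ] (j : Fin n) (B : κ → Op I) :
    onBlock j (∑ i, B i) = ∑ i, onBlock j (B i) := by
  ext w w'
  simp only [onBlock, Matrix.of_apply, Matrix.sum_apply]
  split_ifs <;> simp

variable [Fintype I]

/-- A block operator changes only one coordinate, so matrix products with it reduce to a sum over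
that coordinate. -/
theorem sum_eq_of_update {n : ℕ} (j : Fin n) (w : Fin n → I) (f : (Fin n → I) → ℂ)
    (hf : ∀ a, (∃ k, k ≠ j ∧ w k ≠ a k) → f a = 0) :
    ∑ a, f a = ∑ i, f (Function.update w j i) := by
  refine (Finset.sum_of_injOn (fun i => Function.update w j i)
    (fun i _ i' _ h => by simpa using congrFun h j) (fun _ _ => Finset.mem_coe.2 (Finset.mem_univ _))
    (fun a _ ha => hf a ?_) (fun _ _ => rfl)).symm
  by_contra! h
  refine ha ⟨a j, Finset.mem_coe.2 (Finset.mem_univ _), ?_⟩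
  funext k
  by_cases hk : k = j
  · subst hk; simp
  · simp only [Function.update_of_ne hk]
    exact h k hk

theorem onBlock_mul_tprod {n : ℕ} (j : Fin n) (B : Op I) (x : Fin n → Op I) :
    onBlock j B * tprod x = tprod (Function.update x j (B * x j)) := by
  ext w w'
  rw [Matrix.mul_apply, tprod_update_apply, sum_eq_of_update j w, Matrix.mul_apply, Finset.sum_mul]
  · refine Finset.sum_congr rfl fun i _ => ?_
    rw [tprod_apply, ← Finset.mul_prod_erase _ _ (Finset.mem_univ j), ← mul_assoc]
    simp only [onBlock, Matrix.of_apply, Function.update_self]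
    rw [if_pos fun k hk => by rw [Function.update_of_ne hk]]
    congr 1
    exact Finset.prod_congr rfl fun k hk => by
      rw [Function.update_of_ne (Finset.ne_of_mem_erase hk)]
  · rintro a ⟨k, hk, hne⟩
    simp only [onBlock, Matrix.of_apply]
    rw [if_neg fun h => hne (h k hk), zero_mul]

theorem tprod_mul_onBlock {n : ℕ} (j : Fin n) (B : Op I) (x : Fin n → Op I) :
    tprod x * onBlock j B = tprod (Function.update x j (x j * B)) := by
  ext w w'
  rw [Matrix.mul_apply, tprod_update_apply, sum_eq_of_update j w', Matrix.mul_apply,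
    Finset.sum_mul]
  · refine Finset.sum_congr rfl fun i _ => ?_
    rw [tprod_apply, ← Finset.mul_prod_erase _ _ (Finset.mem_univ j)]
    simp only [onBlock, Matrix.of_apply, Function.update_self]
    rw [if_pos fun k hk => by rw [Function.update_of_ne hk], mul_right_comm]
    congr 1
    exact Finset.prod_congr rfl fun k hk => by
      rw [Function.update_of_ne (Finset.ne_of_mem_erase hk)]
  · rintro a ⟨k, hk, hne⟩
    simp only [onBlock, Matrix.of_apply]
    rw [if_neg fun h => hne (h k hk).symm, mul_zero]

/-- Expand each `Φ (x j)` in matrix units and distribute the product over the sums; this is the sum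
defining `tensorPower`. -/
theorem tensorPower_tprod {n : ℕ} (Φ : SuperOp I) (x : Fin n → Op I) :
    tensorPower n Φ (tprod x) = tprod fun j => Φ (x j) := by
  ext w w'
  have hΦ : ∀ X : Op I, ∀ a b, Φ X a b =
      ∑ p : I, ∑ q : I, Φ (Matrix.single p q 1) a b * X p q := fun X a b => by
    conv_lhs => rw [Matrix.matrix_eq_sum_single X]
    simp only [map_sum, Matrix.sum_apply]
    refine Finset.sum_congr rfl fun p _ => Finset.sum_congr rfl fun q _ => ?_
    have : Matrix.single p q (X p q) = X p q • Matrix.single p q (1 : ℂ) := by simp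
    rw [this, map_smul, Matrix.smul_apply, smul_eq_mul, mul_comm]
  simp only [tensorPower, LinearMap.coe_mk, AddHom.coe_mk, Matrix.of_apply, tprod_apply,
    ← Finset.prod_mul_distrib]
  simp_rw [hΦ (x _), Finset.prod_univ_sum, Fintype.piFinset_univ]

/-- Independent blocks evolve independently. -/
theorem lindbladian_tprod {n : ℕ} {κ : Type} [Fintype κ] (H : Op I) (J : κ → Op I) (ω : ℝ)
    (x : Fin n → Op I) :
    lindbladian (∑ j : Fin n, onBlock j H) (fun p : Fin n × κ => onBlock p.1 (J p.2)) ω (tprod x) =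
      ∑ j, tprod (Function.update x j (lindbladian H J ω (x j))) := by
  have hJ : ∀ (j : Fin n) (i : κ), onBlock j (J i) * tprod x * (onBlock j (J i))ᴴ =
      tprod (Function.update x j (J i * x j * (J i)ᴴ)) := fun j i => by
    rw [conjTranspose_onBlock, onBlock_mul_tprod, tprod_mul_onBlock]; simp
  have hJ2 : ∀ (j : Fin n) (i : κ), (onBlock j (J i))ᴴ * onBlock j (J i) * tprod x =
      tprod (Function.update x j ((J i)ᴴ * J i * x j)) := fun j i => by
    rw [mul_assoc, conjTranspose_onBlock, onBlock_mul_tprod, onBlock_mul_tprod]; simp [mul_assoc]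
  have hJ3 : ∀ (j : Fin n) (i : κ), tprod x * ((onBlock j (J i))ᴴ * onBlock j (J i)) =
      tprod (Function.update x j (x j * ((J i)ᴴ * J i))) := fun j i => by
    rw [← mul_assoc, conjTranspose_onBlock, tprod_mul_onBlock, tprod_mul_onBlock]; simp [mul_assoc]
  simp only [lindbladian, LinearMap.coe_mk, AddHom.coe_mk, Fintype.sum_prod_type, hJ, hJ2, hJ3]
  simp only [Finset.sum_mul, Finset.mul_sum, onBlock_mul_tprod, tprod_mul_onBlock]
  rw [← Finset.sum_sub_distrib, Finset.smul_sum, ← Finset.sum_add_distrib]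
  refine Finset.sum_congr rfl fun j _ => ?_
  ext w w'
  simp only [Matrix.add_apply, Matrix.smul_apply, Matrix.sub_apply, Matrix.sum_apply,
    tprod_update_apply, smul_eq_mul, add_mul, sub_mul, Finset.sum_mul, mul_assoc]

/-- By the Leibniz rule the product of the block evolutions solves the array's master equation, and
solutions are unique. -/
theorem evolution_tprod {n : ℕ} {κ : Type} [Fintype κ] (H : Op I) (J : κ → Op I) (ω s : ℝ)
    (x : Fin n → Op I) :
    evolution (lindbladian (∑ j : Fin n, onBlock j H)
        (fun p : Fin n × κ => onBlock p.1 (J p.2)) ω) s (tprod x) =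
      tprod fun j => evolution (lindbladian H J ω) s (x j) := by
  have h := eq_evolution_of_hasDerivAt (lindbladian (∑ j : Fin n, onBlock j H)
    (fun p : Fin n × κ => onBlock p.1 (J p.2)) ω)
    (y := fun u => tprod fun j => evolution (lindbladian H J ω) u (x j)) (fun u a b => ?_) s
  · rw [h]; simp [evolution_zero]
  · rw [lindbladian_tprod]
    have := HasDerivAt.fun_finsetProd (u := Finset.univ) fun j (_ : j ∈ Finset.univ) =>
      evolution_hasDerivAt (lindbladian H J ω) (x j) u (a j) (b j)
    refine this.congr_deriv ?_
    rw [Matrix.sum_apply]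
    refine Finset.sum_congr rfl fun j _ => ?_
    rw [tprod_update_apply, smul_eq_mul, mul_comm]

/-- Rounds of evolution and correction of independent blocks act blockwise on products. -/
theorem rounds_tprod {n m d : ℕ} {α : Type} [Fintype α] [DecidableEq α] (H L : Op (Fin d))
    (C : SuperOp ((Fin m → Fin d) × α)) (ω t : ℝ) (K : ℕ)
    (x : Fin n → Op ((Fin m → Fin d) × α)) :
    rounds (tensorPower n C) (arrayGenerator n m α H L ω) t K (tprod x) =
      tprod fun j => rounds C (blockGenerator m α H L ω) t K (x j) := by
  have hgen : arrayGenerator n m α H L ω = lindbladian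
      (∑ j : Fin n, onBlock j (∑ ℓ : Fin m, onProbe ℓ H))
      (fun p : Fin n × Fin m => onBlock p.1 (onProbe p.2 L)) ω := by
    simp only [arrayGenerator, onBlock_sum]
  have hC := evolution_tprod (n := n) (∑ ℓ : Fin m, onProbe (α := α) ℓ H)
    (fun ℓ => onProbe ℓ L) ω (t / K)
  rw [hgen]
  unfold rounds blockGenerator
  generalize t / (K : ℝ) = s at hC ⊢
  induction K generalizing x with
  | zero => simp
  | succ K ih =>
    rw [pow_succ, Module.End.mul_apply, LinearMap.comp_apply, hC, tensorPower_tprod, ih]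
    rfl

/-- Tensor powers of completely positive maps are positive. -/
theorem posSemidef_tensorPower {n : ℕ} {κ : Type} [Fintype κ] {Φ : SuperOp I}
    {V : κ → Op I} (hV : ∀ X, Φ X = ∑ i, V i * X * (V i)ᴴ) {X : Op (Fin n → I)}
    (hX : X.PosSemidef) : (tensorPower n Φ X).PosSemidef := by
  classical
  -- The Kraus operators of the tensor power are all products of Kraus operators of `Φ`, one chosen
  -- for each block.
  have h : tensorPower n Φ X = ∑ i : Fin n → κ,
      tprod (fun j => V (i j)) * X * (tprod fun j => V (i j))ᴴ := by
    have e : ∀ a b p q, Φ (Matrix.single a b 1) p q = ∑ i, V i p a * star (V i q b) :=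
      fun a b p q => by
        rw [hV, Matrix.sum_apply]
        refine Finset.sum_congr rfl fun i _ => ?_
        simp [Matrix.mul_apply, Matrix.single_apply, ite_and]
    ext w w'
    simp only [tensorPower, LinearMap.coe_mk, AddHom.coe_mk, Matrix.of_apply, e,
      Matrix.sum_apply, Finset.prod_univ_sum, Fintype.piFinset_univ, Matrix.mul_apply,
      Matrix.conjTranspose_apply, tprod_apply, Finset.sum_mul, star_prod, Finset.prod_mul_distrib]
    refine Finset.sum_comm.trans
      ((Finset.sum_congr rfl fun y _ => Finset.sum_comm).trans (Finset.sum_comm.trans ?_))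
    refine Finset.sum_congr rfl fun i _ => Finset.sum_congr rfl fun b _ =>
      Finset.sum_congr rfl fun a _ => ?_
    ring
  rw [h]
  exact Matrix.posSemidef_sum _ fun i _ => hX.mul_mul_conjTranspose_same _

end Blocks


/-! ### Symmetric logarithmic derivatives -/

section SLD

variable {I : Type} [Fintype I]

theorem trace_mul_conjTranspose_mul_self_nonneg {ρ : Op I} (hρ : ρ.PosSemidef) (X : Op I) :
    0 ≤ (ρ * Xᴴ * X).trace := by
  rw [Matrix.trace_mul_comm, ← mul_assoc]
  exact (hρ.mul_mul_conjTranspose_same X).trace_nonneg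

variable [DecidableEq I]

/-- Polarisation with the test vectors `e_i ± c e_j`, `|c| = 1`: the parallelogram law for the two
signs removes the diagonal entries, and `c = 1`, `c = I` control the real and imaginary parts of `D
i j`. -/
theorem norm_entry_sq_le_of_form_le {D : Op I} {l : I → ℝ} (hl : ∀ i, 0 ≤ l i)
    (hD : D.IsHermitian) {M : ℝ}
    (h : ∀ v : I → ℂ, ‖star v ⬝ᵥ D *ᵥ v‖ ^ 2 ≤ M * ‖star v ⬝ᵥ v‖ *
      ‖star v ⬝ᵥ Matrix.diagonal (fun i => (l i : ℂ)) *ᵥ v‖) (i j : I) :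
    ‖D i j‖ ^ 2 ≤ M * (l i + l j) := by
  have hji : D j i = star (D i j) := by rw [← hD.apply]
  by_cases hij : i = j
  · subst hij
    have := h (Pi.single i 1)
    simp [abs_of_nonneg (hl i)] at this
    nlinarith [sq_nonneg ‖D i i‖]
  · have key : ∀ c : ℂ, ‖c‖ = 1 → (c * D i j).re ^ 2 ≤ M * (l i + l j) / 2 := by
      intro c hc
      have hcc : star c * c = 1 := by
        rw [RCLike.star_def, Complex.conj_mul', hc]; simp
      have hv : ∀ c : ℂ, star c * c = 1 →
          ‖D i i + D j j + (c * D i j + star (c * D i j))‖ ^ 2 ≤ M * 2 * (l i + l j) := by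
        intro c hcc
        have := h (Pi.single i 1 + Pi.single j c)
        have e1 : star (Pi.single i 1 + Pi.single j c) ⬝ᵥ D *ᵥ (Pi.single i 1 + Pi.single j c) =
            D i i + D j j + (c * D i j + star (c * D i j)) := by
          simp only [star_add, ← Pi.single_star, star_one, Matrix.mulVec_add, add_dotProduct,
            dotProduct_add, single_dotProduct, Matrix.mulVec_single,
            Matrix.col_apply, Pi.smul_apply, hji, star_mul']
          simp only [MulOpposite.smul_eq_mul_unop, MulOpposite.unop_op]
          linear_combination (D j j) * hcc
        have e2 : star (Pi.single i (1 : ℂ) + Pi.single j c) ⬝ᵥ (Pi.single i 1 + Pi.single j c) =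
            ((2 : ℝ) : ℂ) := by
          simp [dotProduct_add, hij, Ne.symm hij]
          rw [← RCLike.star_def, hcc]; norm_num
        have e3 : star (Pi.single i (1 : ℂ) + Pi.single j c) ⬝ᵥ
            Matrix.diagonal (fun i => (l i : ℂ)) *ᵥ (Pi.single i 1 + Pi.single j c) =
            ((l i + l j : ℝ) : ℂ) := by
          simp [add_dotProduct, hij, Ne.symm hij, Matrix.mulVec_diagonal]
          rw [← RCLike.star_def]; linear_combination (l j : ℂ) * hcc
        rw [e1, e2, e3, Complex.norm_real, Complex.norm_real, Real.norm_of_nonneg zero_le_two,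
          Real.norm_of_nonneg (add_nonneg (hl i) (hl j))] at this
        exact this
      have h1 := hv c hcc
      have h2 := hv (-c) (by simpa using hcc)
      set p := D i i + D j j
      set r := (c * D i j).re with hr
      have e : c * D i j + star (c * D i j) = ((2 * r : ℝ) : ℂ) := by
        rw [RCLike.star_def, Complex.add_conj]; 
      have e' : -c * D i j + star (-c * D i j) = -((2 * r : ℝ) : ℂ) := by
        rw [← e, neg_mul, star_neg]; ring
      rw [e] at h1
      rw [e'] at h2
      have h3 := parallelogram_law_with_norm ℝ p ((2 * r : ℝ) : ℂ)
      rw [Complex.norm_real, Real.norm_eq_abs, ← sub_eq_add_neg] at *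
      have := sq_abs (2 * r)
      nlinarith [sq_nonneg ‖p‖]
    have h1 := key 1 (by simp)
    have h2 := key Complex.I (by simp)
    rw [← Complex.normSq_eq_norm_sq, Complex.normSq_apply]
    simp at h1 h2
    nlinarith

/-- A Hermitian `D` whose quadratic form is dominated by that of `ρ` has a symmetric logarithmic
derivative with respect to `ρ`, with the corresponding bound on the Fisher information; the case of
a diagonal `ρ`. -/
theorem exists_sld_diagonal {D : Op I} {l : I → ℝ} (hl : ∀ i, 0 ≤ l i)
    (hD : D.IsHermitian) {M : ℝ} (hM : 0 ≤ M)
    (h : ∀ v : I → ℂ, ‖star v ⬝ᵥ D *ᵥ v‖ ^ 2 ≤ M * ‖star v ⬝ᵥ v‖ *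
      ‖star v ⬝ᵥ Matrix.diagonal (fun i => (l i : ℂ)) *ᵥ v‖) :
    ∃ Λ : Op I, Λ.IsHermitian ∧
      D = (1 / 2 : ℂ) • (Λ * Matrix.diagonal (fun i => (l i : ℂ)) +
        Matrix.diagonal (fun i => (l i : ℂ)) * Λ) ∧
      (Matrix.diagonal (fun i => (l i : ℂ)) * Λ ^ 2).trace.re ≤
        4 * (Fintype.card I : ℝ) ^ 2 * M := by
  have hb := norm_entry_sq_le_of_form_le hl hD h
  -- Solves the logarithmic-derivative equation entrywise in the eigenbasis. Where `l i + l j = 0`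
  -- the quotient is `0` by convention; this is consistent, as the entry bound forces `D i j = 0`
  -- there.
  set Λ : Op I := Matrix.of fun i j => 2 * D i j / ((l i + l j : ℝ) : ℂ) with hΛdef
  have hΛ : Λ.IsHermitian := by
    ext i j
    simp only [hΛdef, Matrix.conjTranspose_apply, Matrix.of_apply, star_div₀, star_mul', hD.apply]
    rw [add_comm]
    simp
  refine ⟨Λ, hΛ, ?_, ?_⟩
  · ext i j
    simp only [Matrix.smul_apply, Matrix.add_apply, Matrix.mul_diagonal, Matrix.diagonal_mul,
      hΛdef, Matrix.of_apply, smul_eq_mul]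
    by_cases h0 : l i + l j = 0
    · have := hb i j
      rw [h0, mul_zero] at this
      have : D i j = 0 := by simpa using this
      simp [this]
    · have : (l i : ℂ) + l j ≠ 0 := by exact_mod_cast h0
      push_cast
      field_simp
      ring
  · have e : (Matrix.diagonal (fun i => (l i : ℂ)) * Λ ^ 2).trace =
        ((∑ i, ∑ j, l i * ‖Λ i j‖ ^ 2 : ℝ) : ℂ) := by
      simp only [Matrix.trace, Matrix.diag_apply, Matrix.diagonal_mul, pow_two Λ]
      push_cast
      refine Finset.sum_congr rfl fun i _ => ?_
      rw [Matrix.mul_apply, Finset.mul_sum]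
      refine Finset.sum_congr rfl fun j _ => ?_
      rw [← hΛ.apply j i, RCLike.star_def, Complex.mul_conj']
    rw [e, Complex.ofReal_re]
    -- Of the denominator `(l i + l j)²`, one factor is absorbed by the bound on `D i j` and the
    -- other by `l i ≤ l i + l j`, so no lower bound on the eigenvalues enters.
    have hij : ∀ i j, l i * ‖Λ i j‖ ^ 2 ≤ 4 * M := fun i j => by
      simp only [hΛdef, Matrix.of_apply, norm_div, norm_mul, Complex.norm_real]
      rcases (add_nonneg (hl i) (hl j)).eq_or_lt with h0 | h0
      · rw [← h0]; simp; positivity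
      · rw [Real.norm_of_nonneg h0.le, div_pow, mul_pow, ← mul_div_assoc,
          div_le_iff₀ (by positivity)]
        have h1 := hb i j
        have h2 := hl i
        have h3 := hl j
        rw [Complex.norm_ofNat]
        calc l i * (2 ^ 2 * ‖D i j‖ ^ 2) ≤ l i * (2 ^ 2 * (M * (l i + l j))) := by gcongr
          _ ≤ (l i + l j) * (2 ^ 2 * (M * (l i + l j))) := by
              gcongr
              linarith
          _ = _ := by ring
    calc _ ≤ ∑ _i : I, ∑ _j : I, 4 * M := Finset.sum_le_sum fun i _ =>
          Finset.sum_le_sum fun j _ => hij i j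
      _ = _ := by simp; ring

/-- The hypothesis, the equation and the trace are all invariant under unitary conjugation, so `ρ`
may be diagonalised. -/
theorem exists_sld {ρ D : Op I} (hρ : ρ.PosSemidef) (hD : D.IsHermitian) {M : ℝ} (hM : 0 ≤ M)
    (h : ∀ v : I → ℂ, ‖star v ⬝ᵥ D *ᵥ v‖ ^ 2 ≤ M * ‖star v ⬝ᵥ v‖ * ‖star v ⬝ᵥ ρ *ᵥ v‖) :
    ∃ Λ : Op I, Λ.IsHermitian ∧ D = (1 / 2 : ℂ) • (Λ * ρ + ρ * Λ) ∧
      (ρ * Λ ^ 2).trace.re ≤ 4 * (Fintype.card I : ℝ) ^ 2 * M := by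
  set U : Op I := hρ.isHermitian.eigenvectorUnitary.1 with hU
  set l := hρ.isHermitian.eigenvalues with hldef
  set d : Op I := Matrix.diagonal (fun i => (l i : ℂ)) with hd
  have hUU : Uᴴ * U = 1 := Unitary.coe_star_mul_self hρ.isHermitian.eigenvectorUnitary
  have hUU' : U * Uᴴ = 1 := Unitary.coe_mul_star_self hρ.isHermitian.eigenvectorUnitary
  have hρd : ρ = U * d * Uᴴ := by
    conv_lhs => rw [hρ.isHermitian.spectral_theorem]
    rfl
  have hconj : ∀ (X : Op I) (v : I → ℂ),
      star v ⬝ᵥ (Uᴴ * X * U) *ᵥ v = star (U *ᵥ v) ⬝ᵥ X *ᵥ (U *ᵥ v) := fun X v => by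
    rw [Matrix.star_mulVec, ← Matrix.dotProduct_mulVec, Matrix.mulVec_mulVec, Matrix.mulVec_mulVec,
      mul_assoc]
  have hd' : d = Uᴴ * ρ * U := by
    rw [hρd]
    calc d = (Uᴴ * U) * d * (Uᴴ * U) := by rw [hUU]; simp
      _ = _ := by noncomm_ring
  obtain ⟨Λ, hΛ, h1, h2⟩ := exists_sld_diagonal (D := Uᴴ * D * U) (l := l)
    hρ.eigenvalues_nonneg (Matrix.isHermitian_conjTranspose_mul_mul U hD) hM (fun v => by
      have e : star v ⬝ᵥ v = star (U *ᵥ v) ⬝ᵥ (U *ᵥ v) := by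
        have := hconj 1 v
        rwa [mul_one, hUU, Matrix.one_mulVec, Matrix.one_mulVec] at this
      rw [← hd, hd', hconj, hconj, e]
      exact h _)
  refine ⟨U * Λ * Uᴴ, Matrix.isHermitian_mul_mul_conjTranspose U hΛ, ?_, ?_⟩
  · calc D = (U * Uᴴ) * D * (U * Uᴴ) := by rw [hUU']; simp
      _ = U * (Uᴴ * D * U) * Uᴴ := by noncomm_ring
      _ = (1 / 2 : ℂ) • (U * Λ * (1 * d) * Uᴴ + U * (d * 1) * Λ * Uᴴ) := by
        rw [h1, ← hd]
        simp only [Matrix.mul_smul, Matrix.smul_mul, mul_add, add_mul, mul_assoc, one_mul, mul_one]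
      _ = _ := by
        rw [hρd, ← hUU]
        simp only [mul_assoc, ← mul_assoc Uᴴ U, hUU, one_mul]
  · refine le_of_eq_of_le ?_ h2
    rw [← hd, hρd]
    congr 1
    calc (U * d * Uᴴ * (U * Λ * Uᴴ) ^ 2).trace
        = (U * (d * (Uᴴ * U) * Λ * (Uᴴ * U) * Λ) * Uᴴ).trace := by
          congr 1; noncomm_ring
      _ = _ := by
          rw [hUU, Matrix.trace_mul_comm, ← mul_assoc, hUU]
          congr 1; noncomm_ring

/-- The Fisher information is bounded by any purification-type representation of the
derivative. -/
theorem trace_sld_le {ρ Λ B : Op I} (hρ : ρ.PosSemidef) (hΛ : Λ.IsHermitian)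
    (h : Λ * ρ + ρ * Λ = B * ρ + ρ * Bᴴ) :
    (ρ * Λ ^ 2).trace.re ≤ (ρ * Bᴴ * B).trace.re := by
  have h0 := (Complex.le_def.1 (trace_mul_conjTranspose_mul_self_nonneg hρ (Λ - B))).1
  have e1 : (ρ * (Λ - B)ᴴ * (Λ - B)).trace =
      (ρ * Λ ^ 2).trace + (ρ * Bᴴ * B).trace - ((ρ * Λ * B).trace + (ρ * Bᴴ * Λ).trace) := by
    rw [Matrix.conjTranspose_sub, hΛ.eq, ← Matrix.trace_add, ← Matrix.trace_add,
      ← Matrix.trace_sub]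
    congr 1
    noncomm_ring
  -- The cross terms see `B` only through `Bρ + ρB†`, so `B` may be replaced by `Λ` in them: `Λ` is
  -- the best approximation of `B` in the seminorm of `ρ`.
  have e2 : (ρ * Λ * B).trace + (ρ * Bᴴ * Λ).trace = 2 * (ρ * Λ ^ 2).trace := by
    rw [Matrix.trace_mul_comm (ρ * Λ) B, ← mul_assoc, ← Matrix.trace_add, ← add_mul, ← h, add_mul,
      Matrix.trace_add, mul_assoc Λ, Matrix.trace_mul_comm Λ, mul_assoc, ← pow_two]
    ring
  rw [e1, e2] at h0
  simp at h0
  linarith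

/-- The variational lower bound for the Fisher information. -/
theorem le_trace_sld {ρ Λ X : Op I} (hρ : ρ.PosSemidef) (hΛ : Λ.IsHermitian)
    (hX : X.IsHermitian) :
    2 * (((1 / 2 : ℂ) • (Λ * ρ + ρ * Λ)) * X).trace.re - (ρ * X ^ 2).trace.re ≤
      (ρ * Λ ^ 2).trace.re := by
  have h0 := (Complex.le_def.1 (trace_mul_conjTranspose_mul_self_nonneg hρ (Λ - X))).1
  have e1 : (ρ * (Λ - X)ᴴ * (Λ - X)).trace =
      (ρ * Λ ^ 2).trace + (ρ * X ^ 2).trace - ((ρ * Λ * X).trace + (ρ * X * Λ).trace) := by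
    rw [Matrix.conjTranspose_sub, hΛ.eq, hX.eq, ← Matrix.trace_add, ← Matrix.trace_add,
      ← Matrix.trace_sub]
    congr 1
    noncomm_ring
  have e2 : (ρ * Λ * X).trace + (ρ * X * Λ).trace =
      2 * (((1 / 2 : ℂ) • (Λ * ρ + ρ * Λ)) * X).trace := by
    rw [Matrix.smul_mul, Matrix.trace_smul, add_mul, Matrix.trace_add,
      Matrix.trace_mul_comm (ρ * X) Λ, ← mul_assoc, smul_eq_mul]
    ring
  rw [e1, e2] at h0
  simp at h0 ⊢
  linarith

/-- Young's inequality for the semi-inner product `Tr ρ x†y`, from nonnegativity at `s x + s⁻¹ y`.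
The free weight `s` lets a small `y` disturb the `x` term only slightly. -/
theorem trace_sub_le {ρ x y : Op I} (hρ : ρ.PosSemidef) {s : ℝ} (hs : s ≠ 0) :
    (ρ * (x - y)ᴴ * (x - y)).trace.re ≤
      (1 + s ^ 2) * (ρ * xᴴ * x).trace.re + (1 + (s ^ 2)⁻¹) * (ρ * yᴴ * y).trace.re := by
  have h0 := (Complex.le_def.1 (trace_mul_conjTranspose_mul_self_nonneg hρ
    ((s : ℂ) • x + ((s : ℂ)⁻¹) • y))).1
  have hs' : (s : ℂ) ≠ 0 := by exact_mod_cast hs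
  have e1 : (ρ * ((s : ℂ) • x + ((s : ℂ)⁻¹) • y)ᴴ * ((s : ℂ) • x + ((s : ℂ)⁻¹) • y)).trace =
      (s : ℂ) ^ 2 * (ρ * xᴴ * x).trace + ((s : ℂ) ^ 2)⁻¹ * (ρ * yᴴ * y).trace +
        ((ρ * xᴴ * y).trace + (ρ * yᴴ * x).trace) := by
    simp only [Matrix.conjTranspose_add, Matrix.conjTranspose_smul, RCLike.star_def, map_inv₀,
      Complex.conj_ofReal, mul_add, add_mul, Matrix.mul_smul, Matrix.smul_mul, Matrix.trace_add,
      Matrix.trace_smul, smul_eq_mul]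
    field_simp
    ring
  have e2 : (ρ * (x - y)ᴴ * (x - y)).trace =
      (ρ * xᴴ * x).trace + (ρ * yᴴ * y).trace - ((ρ * xᴴ * y).trace + (ρ * yᴴ * x).trace) := by
    simp only [Matrix.conjTranspose_sub, mul_sub, sub_mul, Matrix.trace_sub]
    ring
  rw [e1] at h0
  rw [e2]
  have : ((s : ℂ) ^ 2 * (ρ * xᴴ * x).trace).re = s ^ 2 * (ρ * xᴴ * x).trace.re := by
    rw [← Complex.ofReal_pow, Complex.re_ofReal_mul]
  have : (((s : ℂ) ^ 2)⁻¹ * (ρ * yᴴ * y).trace).re = (s ^ 2)⁻¹ * (ρ * yᴴ * y).trace.re := by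
    rw [← Complex.ofReal_pow, ← Complex.ofReal_inv, Complex.re_ofReal_mul]
  simp only [Complex.add_re, Complex.sub_re, Complex.zero_re] at *
  linarith

theorem trace_mul_sq_eq_re {ρ Λ : Op I} (hρ : ρ.PosSemidef) (hΛ : Λ.IsHermitian) :
    (ρ * Λ ^ 2).trace = ((ρ * Λ ^ 2).trace.re : ℂ) := by
  have h := trace_mul_conjTranspose_mul_self_nonneg hρ Λ
  rw [hΛ.eq, mul_assoc, ← pow_two] at h
  exact (Complex.eq_re_of_ofReal_le (r := 0) (by simpa using h))

end SLD


/-! ### Convergence of the quantum Fisher information -/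

section QFI

variable {I : Type} [Fintype I]

theorem isHermitian_deriv {A : ℂ → Op I} {ω : ℝ} {A' : Op I} (hA : HasDerivAt A A' (ω : ℂ))
    (hpos : ∀ x : ℝ, (A x).PosSemidef) : A'.IsHermitian := by
  ext a b
  have h1 := (hasDerivAt_op_iff.1 hA a b).comp_ofReal
  have h2 := (hasDerivAt_op_iff.1 hA b a).comp_ofReal.star
  have e : (fun x : ℝ => star (A x b a)) = fun x : ℝ => A x a b := by
    funext x
    exact (hpos x).isHermitian.apply a b
  rw [e] at h2
  exact h2.unique h1

variable [DecidableEq I]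

/-- The derivative of a holomorphic family of operators which is positive on the real axis and
nearly constant has a symmetric logarithmic derivative with small Fisher information. -/
theorem exists_sld_of_near_constant {A : ℂ → Op I} (hA : Differentiable ℂ A)
    (hpos : ∀ x : ℝ, (A x).PosSemidef) {c : Op I} {ε : ℝ}
    (hε : ∀ z : ℂ, ‖z‖ ≤ 1 → ‖A z - c‖ ≤ ε) :
    ∃ Λ : Op I, Λ.IsHermitian ∧ deriv A 0 = (1 / 2 : ℂ) • (Λ * A 0 + A 0 * Λ) ∧
      (A 0 * Λ ^ 2).trace.re ≤ 4 * (Fintype.card I : ℝ) ^ 2 * (12 * ε) := by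
  have hε0 : 0 ≤ ε := (norm_nonneg _).trans (hε 0 (by simp))
  have hd : HasDerivAt A (deriv A 0) ((0 : ℝ) : ℂ) := by simpa using (hA 0).hasDerivAt
  have h0 : (A 0).PosSemidef := by simpa using hpos 0
  refine exists_sld h0 (isHermitian_deriv hd hpos) (by positivity) fun v => ?_
  set φ : Op I →L[ℂ] ℂ := LinearMap.toContinuousLinearMap
    { toFun := fun X => star v ⬝ᵥ X *ᵥ v
      map_add' := fun X Y => by simp [Matrix.add_mulVec, dotProduct_add]
      map_smul' := fun r X => by simp [Matrix.smul_mulVec, dotProduct_smul] } with hφ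
  have hφa : ∀ X, φ X = star v ⬝ᵥ X *ᵥ v := fun X => rfl
  have hf : ∀ z, HasDerivAt (fun z => φ (A z)) (φ (deriv A z)) z := fun z =>
    φ.hasFDerivAt.comp_hasDerivAt z (hA z).hasDerivAt
  have hvv : ‖star v ⬝ᵥ v‖ = ‖WithLp.toLp 2 v‖ ^ 2 := by
    rw [← norm_toLp_sq, Complex.norm_real, Real.norm_of_nonneg (by positivity)]
  -- The scalar estimate for `⟨v, A(z) v⟩`, which is nonnegative on the real axis and within `ε
  -- ‖v‖²` of a constant on the disc, is exactly the form domination required by `exists_sld`.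
  have h := norm_deriv_sq_le_of_nonneg (f := fun z => φ (A z)) (fun z => (hf z).differentiableAt)
    (fun x => (Matrix.posSemidef_iff_dotProduct_mulVec.1 (hpos x)).2 v) (c := φ c)
    (ε := ε * ‖star v ⬝ᵥ v‖) (fun z hz => by
      rw [← map_sub, hφa, hvv]
      refine (norm_dotProduct_mulVec_le _ _ _).trans ?_
      rw [mul_assoc, ← pow_two]
      gcongr
      exact hε z hz)
  rw [(hf 0).deriv] at h
  simpa only [hφa, mul_assoc] using h

variable [Nonempty I]

theorem norm_exp_smul_le (G : Op I) {z : ℂ} (hz : ‖z‖ ≤ 1) :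
    ‖NormedSpace.exp (z • G)‖ ≤ Real.exp ‖G‖ := by
  refine (norm_exp_le _).trans (Real.exp_le_exp.2 ?_)
  rw [norm_smul]
  exact mul_le_of_le_one_left (norm_nonneg _) hz

/-- If a sequence of holomorphic families of states converges to a family generated by a
Hamiltonian `G` whose Fisher information is `4 Tr(ρ G²)`, then the Fisher informations exist and
converge. -/
theorem exists_isQFI_tendsto {ρK : ℕ → ℂ → Op I} {ρl : ℂ → Op I} {ω : ℝ} {G : Op I} {F₀ : ℝ}
    (hdiff : ∀ K, Differentiable ℂ (ρK K)) (hdl : Differentiable ℂ ρl)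
    (hpos : ∀ K (x : ℝ), (ρK K x).PosSemidef)
    (hconv : ∃ E : ℝ, ∀ K : ℕ, 1 ≤ K → ∀ z : ℂ, ‖z - ω‖ ≤ 1 → ‖ρK K z - ρl z‖ ≤ E / K)
    (hG : G.IsHermitian)
    (hcov : ∀ z : ℂ, NormedSpace.exp (z • (Complex.I • G)) * ρl (ω + z) *
      NormedSpace.exp ((-z) • (Complex.I • G)) = ρl ω)
    (hF : 4 * (ρl ω * G ^ 2).trace.re = F₀) (hlim : IsQFI (fun x : ℝ => ρl x) ω F₀) :
    ∃ F : ℕ → ℝ, (∀ K, IsQFI (fun x : ℝ => ρK K x) ω (F K)) ∧ Tendsto F atTop (𝓝 F₀) := by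
  obtain ⟨E, hE⟩ := hconv
  have hE0 : 0 ≤ E := by
    have := (norm_nonneg _).trans (hE 1 le_rfl ω (by simp))
    simpa using this
  have hρd : ∀ K, HasDerivAt (ρK K) (deriv (ρK K) ω) (ω : ℂ) := fun K => (hdiff K _).hasDerivAt
  have hposω : ∀ K, (ρK K ω).PosSemidef := fun K => hpos K ω
  -- existence
  have hex : ∀ K, ∃ Λ : Op I, Λ.IsHermitian ∧
      deriv (ρK K) ω = (1 / 2 : ℂ) • (Λ * ρK K ω + ρK K ω * Λ) := fun K => by
    have hd : Differentiable ℂ fun z => ρK K (ω + z) :=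
      (hdiff K).comp (differentiable_id.const_add _)
    obtain ⟨ε, hε⟩ := (isCompact_closedBall (0 : ℂ) 1).exists_bound_of_continuousOn
      hd.continuous.continuousOn
    -- Mere existence needs no smallness, so the comparison constant is `0` and `ε` is any bound on
    -- the unit disc.
    obtain ⟨Λ, hΛ, h1, -⟩ := exists_sld_of_near_constant hd
      (fun x => by simpa using hpos K (ω + x)) (c := 0) (ε := ε)
      (fun z hz => by simpa using hε z (by simpa using hz))
    refine ⟨Λ, hΛ, ?_⟩
    rw [deriv_comp_const_add] at h1
    simpa using h1
  choose Λ hΛ hΛd using hex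
  refine ⟨fun K => (ρK K ω * Λ K ^ 2).trace.re, fun K => ⟨Λ K, hΛ K, fun a b => ?_,
    trace_mul_sq_eq_re (hposω K) (hΛ K)⟩, ?_⟩
  · have := (hasDerivAt_op_iff.1 (hρd K) a b).comp_ofReal
    rwa [hΛd K] at this
  -- the comparison with the frame moving with `G`
  set e := Real.exp ‖Complex.I • G‖ with he
  set M := 4 * (Fintype.card I : ℝ) ^ 2 * (12 * (e * E * e)) with hM
  have hM0 : 0 ≤ M := by positivity
  have hframe : ∀ K : ℕ, 1 ≤ K → ∃ X : Op I, X.IsHermitian ∧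
      (ρK K ω * X ^ 2).trace.re ≤ M / K ∧
      Λ K * ρK K ω + ρK K ω * Λ K = (X - (2 * Complex.I) • G) * ρK K ω +
        ρK K ω * (X - (2 * Complex.I) • G)ᴴ := fun K hK => by
    -- By `hcov` the same conjugation makes the limiting family constant, so `A` is `O(1/K)`-close
    -- to `ρl ω`. Its derivative at `0` is `∂ρ_K + i[G, ρ_K]`, and the extra commutator becomes the
    -- shift of `X` by `-2iG`.
    set A : ℂ → Op I := fun z => NormedSpace.exp (z • (Complex.I • G)) * ρK K (ω + z) *
      NormedSpace.exp ((-z) • (Complex.I • G)) with hA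
    have hder : ∀ z, HasDerivAt A
        ((NormedSpace.exp (z • (Complex.I • G)) * (Complex.I • G) * ρK K (ω + z) +
          NormedSpace.exp (z • (Complex.I • G)) * deriv (ρK K) (ω + z)) *
          NormedSpace.exp ((-z) • (Complex.I • G)) +
        NormedSpace.exp (z • (Complex.I • G)) * ρK K (ω + z) *
          (-(NormedSpace.exp ((-z) • (Complex.I • G)) * (Complex.I • G)))) z := fun z => by
      have h1 := hasDerivAt_exp_smul_const (𝕂 := ℂ) (Complex.I • G) z
      have h2 : HasDerivAt (fun z => ρK K (ω + z)) (deriv (ρK K) (ω + z)) z :=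
        HasDerivAt.comp_const_add _ _ (hdiff K _).hasDerivAt
      have h3 : HasDerivAt (fun z : ℂ => NormedSpace.exp ((-z) • (Complex.I • G)))
          (-(NormedSpace.exp ((-z) • (Complex.I • G)) * (Complex.I • G))) z := by
        have := (hasDerivAt_exp_smul_const (𝕂 := ℂ) (Complex.I • G) (-z)).scomp z
          (hasDerivAt_neg z)
        simpa [Function.comp_def] using this
      exact (h1.mul h2).mul h3
    have hA0 : A 0 = ρK K ω := by simp [hA]
    have hAd : deriv A 0 = deriv (ρK K) ω + Complex.I • (G * ρK K ω - ρK K ω * G) := by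
      rw [(hder 0).deriv]
      simp only [zero_smul, NormedSpace.exp_zero, neg_zero, one_mul, mul_one, add_zero, mul_neg,
        Matrix.smul_mul, Matrix.mul_smul, smul_sub]
      abel
    have hexpH : ∀ x : ℝ, (NormedSpace.exp ((x : ℂ) • (Complex.I • G)))ᴴ =
        NormedSpace.exp ((-(x : ℂ)) • (Complex.I • G)) := fun x => by
      rw [← Matrix.exp_conjTranspose]
      simp [Matrix.conjTranspose_smul, hG.eq]
    obtain ⟨X, hX, h1, h2⟩ := exists_sld_of_near_constant (A := A)
      (fun z => (hder z).differentiableAt) (fun x => by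
        have := (hpos K (ω + x)).mul_mul_conjTranspose_same
          (NormedSpace.exp ((x : ℂ) • (Complex.I • G)))
        rw [hexpH] at this
        simpa [hA] using this) (c := ρl ω) (ε := e * (E / K) * e) (fun z hz => by
        rw [← hcov z, hA]
        simp only
        rw [← sub_mul, ← mul_sub]
        refine (norm_mul_le _ _).trans (mul_le_mul ((norm_mul_le _ _).trans
          (mul_le_mul (norm_exp_smul_le _ hz) (hE K hK _ (by simpa using hz)) (norm_nonneg _)
            (by positivity))) (norm_exp_smul_le _ (by simpa using hz)) (norm_nonneg _)
            (by positivity)))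
    refine ⟨X, hX, ?_, ?_⟩
    · rw [← hA0]
      refine h2.trans (le_of_eq ?_)
      rw [hM]
      ring
    · rw [hAd, hA0, hΛd K] at h1
      have h3 : Λ K * ρK K ω + ρK K ω * Λ K = X * ρK K ω + ρK K ω * X -
          (2 * Complex.I) • (G * ρK K ω - ρK K ω * G) := by
        have : (2 : ℂ) • ((1 / 2 : ℂ) • (Λ K * ρK K ω + ρK K ω * Λ K) +
            Complex.I • (G * ρK K ω - ρK K ω * G)) =
            (2 : ℂ) • ((1 / 2 : ℂ) • (X * ρK K ω + ρK K ω * X)) := by rw [h1]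
        rw [smul_add, smul_smul, smul_smul, smul_smul] at this
        norm_num at this
        rw [← this]
        abel
      rw [h3, Matrix.conjTranspose_sub, Matrix.conjTranspose_smul, hX.eq, hG.eq]
      simp only [sub_mul, mul_sub, Matrix.smul_mul, Matrix.mul_smul, smul_sub, star_mul',
        RCLike.star_def, Complex.conj_I, Complex.conj_ofNat, mul_neg, neg_smul]
      abel
  have hρlim : Tendsto (fun K => ρK K ω) atTop (𝓝 (ρl ω)) := by
    rw [tendsto_iff_norm_sub_tendsto_zero]
    refine squeeze_zero' (Eventually.of_forall fun _ => norm_nonneg _)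
      ((eventually_ge_atTop 1).mono fun K hK => hE K hK ω (by simp)) ?_
    exact tendsto_const_div_atTop_nhds_zero_nat _
  have hdlim : Tendsto (fun K => deriv (ρK K) ω) atTop (𝓝 (deriv ρl ω)) := by
    rw [tendsto_iff_norm_sub_tendsto_zero]
    refine squeeze_zero' (Eventually.of_forall fun _ => norm_nonneg _)
      ((eventually_ge_atTop 1).mono fun K hK => ?_) (tendsto_const_div_atTop_nhds_zero_nat E)
    -- Cauchy's estimate: uniform convergence on the complex disc carries over to the derivatives.
    have h := Complex.norm_deriv_le_of_forall_mem_sphere_norm_le (f := fun z => ρK K z - ρl z)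
      (c := ω) (R := 1) (C := E / K) one_pos ((hdiff K).sub hdl).diffContOnCl
      (fun z hz => hE K hK z (by rw [← dist_eq_norm]; exact (Metric.mem_sphere.1 hz).le))
    rw [div_one, deriv_fun_sub (hdiff K _) (hdl _)] at h
    exact h
  have htr : ∀ X : Op I, Tendsto (fun K => (ρK K ω * X).trace.re) atTop
      (𝓝 (ρl ω * X).trace.re) := fun X => by
    have hc : Continuous fun Y : Op I => (Y * X).trace.re :=
      Complex.continuous_re.comp (Continuous.matrix_trace (by fun_prop))
    exact (hc.tendsto _).comp hρlim
  -- lower bound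
  obtain ⟨Λl, hΛl, hld, hlF⟩ := hlim
  have hDl : deriv ρl ω = (1 / 2 : ℂ) • (Λl * ρl ω + ρl ω * Λl) := by
    ext a b
    exact (hasDerivAt_op_iff.1 (hdl ω).hasDerivAt a b).comp_ofReal.unique (hld a b)
  have hlow : Tendsto (fun K => 2 * (deriv (ρK K) ω * Λl).trace.re -
      (ρK K ω * Λl ^ 2).trace.re) atTop (𝓝 F₀) := by
    have hc : Continuous fun Y : Op I => (Y * Λl).trace.re :=
      Complex.continuous_re.comp (Continuous.matrix_trace (by fun_prop))
    have h := (((hc.tendsto _).comp hdlim).const_mul 2).sub (htr (Λl ^ 2))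
    have h1 : (deriv ρl ω * Λl).trace = F₀ := by
      rw [hDl, ← hlF, Matrix.smul_mul, Matrix.trace_smul, add_mul, Matrix.trace_add, mul_assoc Λl,
        Matrix.trace_mul_comm Λl, mul_assoc, ← pow_two, smul_eq_mul]
      ring
    have hlF' : (ρl ω * Λl ^ 2).trace.re = F₀ := by rw [hlF, Complex.ofReal_re]
    rw [h1, hlF', Complex.ofReal_re] at h
    have e : 2 * F₀ - F₀ = F₀ := by ring
    rwa [e] at h
  -- upper bound
  have hup : Tendsto (fun K : ℕ => (1 + Real.sqrt ((M + 1) / K)) * ((M + 1) / K) / 1 +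
      Real.sqrt ((M + 1) / K) +
      (1 + Real.sqrt ((M + 1) / K)) * (4 * (ρK K ω * G ^ 2).trace.re)) atTop (𝓝 F₀) := by
    have h1 : Tendsto (fun K : ℕ => (M + 1) / (K : ℝ)) atTop (𝓝 0) :=
      tendsto_const_div_atTop_nhds_zero_nat _
    have h2 : Tendsto (fun K : ℕ => Real.sqrt ((M + 1) / (K : ℝ))) atTop (𝓝 0) := by
      have := (Real.continuous_sqrt.tendsto 0).comp h1
      rwa [Real.sqrt_zero] at this
    have h3 := ((h2.const_add 1).mul h1).div_const 1
    have h4 := (h3.add h2).add ((h2.const_add 1).mul ((htr (G ^ 2)).const_mul 4))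
    simpa [hF] using h4
  refine tendsto_of_tendsto_of_tendsto_of_le_of_le' hlow hup
    (Eventually.of_forall fun K => ?_) ((eventually_ge_atTop 1).mono fun K hK => ?_)
  · rw [hΛd K]
    exact le_trace_sld (hposω K) (hΛ K) hΛl
  · obtain ⟨X, hX, hXM, hB⟩ := hframe K hK
    have hK' : (1 : ℝ) ≤ K := by exact_mod_cast hK
    -- `M + 1` in place of `M` makes `η` strictly positive. The weight `s = η^(1/4)` gives `s² =
    -- √η`, so `(1 + s⁻²) η = η + √η` vanishes in the limit while the factor `1 + s²` of the main
    -- term tends to `1`.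
    set η := (M + 1) / (K : ℝ) with hη
    have hη0 : 0 < η := by positivity
    have hXη : (ρK K ω * X ^ 2).trace.re ≤ η := hXM.trans (by rw [hη]; gcongr; linarith)
    have hs : Real.sqrt (Real.sqrt η) ≠ 0 := by positivity
    have h1 := trace_sld_le (hposω K) (hΛ K) hB
    have h2 := trace_sub_le (x := (2 * Complex.I) • G) (y := X) (hposω K) hs
    have e1 : (ρK K ω * (X - (2 * Complex.I) • G)ᴴ * (X - (2 * Complex.I) • G)).trace =
        (ρK K ω * ((2 * Complex.I) • G - X)ᴴ * ((2 * Complex.I) • G - X)).trace := by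
      rw [← neg_sub X, Matrix.conjTranspose_neg, mul_neg, mul_neg, neg_mul, neg_neg]
    have e2 : (ρK K ω * ((2 * Complex.I) • G)ᴴ * ((2 * Complex.I) • G)).trace.re =
        4 * (ρK K ω * G ^ 2).trace.re := by
      rw [Matrix.conjTranspose_smul, hG.eq, Matrix.mul_smul, Matrix.mul_smul, Matrix.smul_mul,
        smul_smul, mul_assoc (ρK K ω), ← pow_two, Matrix.trace_smul]
      have : 2 * Complex.I * star (2 * Complex.I) = ((4 : ℝ) : ℂ) := by
        simp only [RCLike.star_def, map_mul, Complex.conj_I, Complex.conj_ofNat]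
        push_cast
        linear_combination (-4) * Complex.I_mul_I
      rw [this, smul_eq_mul, Complex.re_ofReal_mul]
    have e3 : ρK K ω * Xᴴ * X = ρK K ω * X ^ 2 := by rw [hX.eq, mul_assoc, pow_two]
    rw [e1] at h1
    rw [e2, e3, Real.sq_sqrt (Real.sqrt_nonneg _)] at h2
    refine h1.trans (h2.trans ?_)
    have hsq : (Real.sqrt η)⁻¹ * η = Real.sqrt η := by
      rw [inv_mul_eq_div, Real.div_sqrt]
    have h5 : (1 + (Real.sqrt η)⁻¹) * (ρK K ω * X ^ 2).trace.re ≤ (1 + (Real.sqrt η)⁻¹) * η := by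
      gcongr
    have : (1 + (Real.sqrt η)⁻¹) * η = η + Real.sqrt η := by rw [add_mul, hsq, one_mul]
    have : 0 ≤ Real.sqrt η * η := by positivity
    linarith

end QFI


/-! ### Kets and bras -/

section Ketbra

variable {I : Type}

theorem conjTranspose_ketbra (ψ φ : I → ℂ) : (ketbra ψ φ)ᴴ = ketbra φ ψ := by
  simp [ketbra, Matrix.conjTranspose_vecMulVec]

theorem conjTranspose_codeProj (ψ : Fin 2 → I → ℂ) : (codeProj ψ)ᴴ = codeProj ψ := by
  simp [codeProj, conjTranspose_ketbra]

theorem conjTranspose_logicalZ (ψ : Fin 2 → I → ℂ) : (logicalZ ψ)ᴴ = logicalZ ψ := by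
  simp [logicalZ, conjTranspose_ketbra]

variable [Fintype I]

theorem mul_ketbra (A : Op I) (ψ φ : I → ℂ) : A * ketbra ψ φ = ketbra (A *ᵥ ψ) φ := by
  rw [ketbra, Matrix.mul_vecMulVec, ketbra]

theorem ketbra_mul (A : Op I) (ψ φ : I → ℂ) : ketbra ψ φ * A = ketbra ψ (Aᴴ *ᵥ φ) := by
  rw [ketbra, Matrix.vecMulVec_mul, ketbra, Matrix.star_mulVec, Matrix.conjTranspose_conjTranspose]

theorem ketbra_mul_ketbra (ψ φ ψ' φ' : I → ℂ) :
    ketbra ψ φ * ketbra ψ' φ' = (star φ ⬝ᵥ ψ') • ketbra ψ φ' := by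
  rw [ketbra, ketbra, Matrix.vecMulVec_mul_vecMulVec, ketbra]
  ext a b
  simp [Matrix.vecMulVec_apply]
  ring

theorem ketbra_mul_mul_ketbra (A : Op I) (ψ φ ψ' φ' : I → ℂ) :
    ketbra ψ φ * A * ketbra ψ' φ' = (star φ ⬝ᵥ A *ᵥ ψ') • ketbra ψ φ' := by
  rw [mul_assoc, mul_ketbra, ketbra_mul_ketbra]

theorem trace_ketbra (ψ φ : I → ℂ) : (ketbra ψ φ).trace = star φ ⬝ᵥ ψ := by
  rw [ketbra, Matrix.trace_vecMulVec, dotProduct_comm]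

/-- The logical phases `±1`. -/
def zsign : Fin 2 → ℝ := ![1, -1]

variable {ψ : Fin 2 → I → ℂ} (hψ : ∀ k k', star (ψ k) ⬝ᵥ ψ k' = if k = k' then 1 else 0)

theorem codeProj_mul_mul_codeProj (ψ : Fin 2 → I → ℂ) (A : Op I) :
    codeProj ψ * A * codeProj ψ =
      ∑ k, ∑ k', (star (ψ k) ⬝ᵥ A *ᵥ ψ k') • ketbra (ψ k) (ψ k') := by
  simp only [codeProj, Fin.sum_univ_two, add_mul, mul_add, ketbra_mul_mul_ketbra]
  abel

include hψ

theorem codeProj_mulVec (k : Fin 2) : codeProj ψ *ᵥ ψ k = ψ k := by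
  simp only [codeProj, Matrix.add_mulVec, ketbra, Matrix.vecMulVec_mulVec, hψ]
  fin_cases k <;> simp

theorem logicalZ_mulVec (k : Fin 2) : logicalZ ψ *ᵥ ψ k = (zsign k : ℂ) • ψ k := by
  simp only [logicalZ, Matrix.sub_mulVec, ketbra, Matrix.vecMulVec_mulVec, hψ]
  fin_cases k <;> simp [zsign]

theorem codeProj_mul_ketbra (k : Fin 2) (φ : I → ℂ) :
    codeProj ψ * ketbra (ψ k) φ = ketbra (ψ k) φ := by
  rw [mul_ketbra, codeProj_mulVec hψ]

theorem ketbra_mul_codeProj (k : Fin 2) (φ : I → ℂ) :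
    ketbra φ (ψ k) * codeProj ψ = ketbra φ (ψ k) := by
  rw [ketbra_mul, conjTranspose_codeProj, codeProj_mulVec hψ]

theorem codeProj_mul_self : codeProj ψ * codeProj ψ = codeProj ψ := by
  have h : codeProj ψ = ketbra (ψ 0) (ψ 0) + ketbra (ψ 1) (ψ 1) := rfl
  nth_rewrite 1 [h]
  rw [add_mul, ketbra_mul_codeProj hψ, ketbra_mul_codeProj hψ, h]

theorem logicalZ_mul_ketbra (k : Fin 2) (φ : I → ℂ) :
    logicalZ ψ * ketbra (ψ k) φ = (zsign k : ℂ) • ketbra (ψ k) φ := by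
  rw [mul_ketbra, logicalZ_mulVec hψ]
  simp [ketbra, Matrix.smul_vecMulVec]

theorem ketbra_mul_logicalZ (k : Fin 2) (φ : I → ℂ) :
    ketbra φ (ψ k) * logicalZ ψ = (zsign k : ℂ) • ketbra φ (ψ k) := by
  have := congrArg Matrix.conjTranspose (logicalZ_mul_ketbra hψ k φ)
  rw [Matrix.conjTranspose_mul, conjTranspose_logicalZ, conjTranspose_ketbra,
    Matrix.conjTranspose_smul, conjTranspose_ketbra] at this
  simpa using this

end Ketbra

/-! ### The recovery channel -/

section Recovery

variable {I κ : Type} [Fintype I] [DecidableEq I] [Fintype κ]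

/-- The completely positive map with given Kraus operators. -/
noncomputable def krausMap (V : κ → Op I) : SuperOp I :=
  ∑ i, LinearMap.mulLeft ℂ (V i) ∘ₗ LinearMap.mulRight ℂ (V i)ᴴ

theorem krausMap_apply (V : κ → Op I) (X : Op I) : krausMap V X = ∑ i, V i * X * (V i)ᴴ := by
  simp [krausMap, mul_assoc]

theorem isChannel_krausMap {V : κ → Op I} (hV : ∑ i, (V i)ᴴ * V i = 1) :
    IsChannel (krausMap V) := by
  refine ⟨Fintype.card κ, fun i => V ((Fintype.equivFin κ).symm i), fun X => ?_, ?_⟩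
  · rw [krausMap_apply]
    exact ((Fintype.equivFin κ).symm.sum_comp fun i => V i * X * (V i)ᴴ).symm
  · rw [← hV]
    exact (Fintype.equivFin κ).symm.sum_comp fun i => (V i)ᴴ * V i

/-- The projection onto the complement of the error spaces. -/
noncomputable def residual (P : Op I) (J : κ → Op I) : Op I := 1 - ∑ i, J i * P * (J i)ᴴ

/-- The Kraus operators of the recovery: undo the jump `J i` on its error space, and reset to the
code word `φ` elsewhere. -/
noncomputable def recoveryKraus (P : Op I) (φ : I → ℂ) (J : κ → Op I) : κ ⊕ I → Op I
  | .inl i => P * (J i)ᴴ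
  | .inr b => ketbra φ (Pi.single b 1) * residual P J

variable {P H : Op I} {J : κ → Op I} {φ : I → ℂ}
  (hP : Pᴴ = P)

include hP

theorem sandwich_recovery (hPP : P * P = P) (hPφ : P *ᵥ φ = φ) :
    sandwich P ∘ₗ krausMap (recoveryKraus P φ J) = krausMap (recoveryKraus P φ J) := by
  have h : ∀ x, P * recoveryKraus P φ J x = recoveryKraus P φ J x := by
    rintro (i | b)
    · simp only [recoveryKraus]
      rw [← mul_assoc, hPP]
    · simp only [recoveryKraus]
      rw [← mul_assoc, mul_ketbra, hPφ]
  refine LinearMap.ext fun X => ?_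
  rw [LinearMap.comp_apply, krausMap_apply]
  simp only [sandwich, LinearMap.comp_apply, LinearMap.mulLeft_apply, LinearMap.mulRight_apply,
    Finset.sum_mul, Finset.mul_sum]
  refine Finset.sum_congr rfl fun x _ => ?_
  calc _ = (P * recoveryKraus P φ J x) * X * (P * recoveryKraus P φ J x)ᴴ := by
        rw [Matrix.conjTranspose_mul, hP]; noncomm_ring
    _ = _ := by rw [h]

variable [DecidableEq κ]
  (hJJ : ∀ i j, P * (J i)ᴴ * J j * P = if i = j then P else 0)

include hJJ

/-- By `hJJ` the operators `J i P (J i)†` are mutually orthogonal projections, so `residual` is the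
complementary projection. The undoing operators contribute the former and the resets the latter to
the resolution of the identity. -/
theorem isChannel_recovery (hPP : P * P = P) (hφ : star φ ⬝ᵥ φ = 1) : IsChannel (krausMap (recoveryKraus P φ J)) := by
  refine isChannel_krausMap ?_
  have hQ : (residual P J)ᴴ = residual P J := by
    simp only [residual, Matrix.conjTranspose_sub, Matrix.conjTranspose_one,
      Matrix.conjTranspose_sum, Matrix.conjTranspose_mul, Matrix.conjTranspose_conjTranspose, hP,
      mul_assoc]
  have hS : (∑ i, J i * P * (J i)ᴴ) * (∑ i, J i * P * (J i)ᴴ) = ∑ i, J i * P * (J i)ᴴ := by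
    rw [Finset.sum_mul]
    refine Finset.sum_congr rfl fun i _ => ?_
    rw [Finset.mul_sum, Finset.sum_eq_single i]
    · calc _ = J i * (P * (J i)ᴴ * J i * P) * (J i)ᴴ := by noncomm_ring
        _ = _ := by rw [hJJ, if_pos rfl]
    · intro j _ hji
      calc _ = J i * (P * (J i)ᴴ * J j * P) * (J j)ᴴ := by noncomm_ring
        _ = _ := by rw [hJJ, if_neg hji.symm]; simp
    · simp
  have hQQ : residual P J * residual P J = residual P J := by
    simp only [residual, sub_mul, mul_sub, one_mul, mul_one, hS]
    abel
  rw [Fintype.sum_sum_type]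
  simp only [recoveryKraus]
  have h1 : ∀ i, (P * (J i)ᴴ)ᴴ * (P * (J i)ᴴ) = J i * P * (J i)ᴴ := fun i => by
    rw [Matrix.conjTranspose_mul, Matrix.conjTranspose_conjTranspose, hP]
    calc _ = J i * (P * P) * (J i)ᴴ := by noncomm_ring
      _ = _ := by rw [hPP]
  have h2 : ∑ b, (ketbra φ (Pi.single b 1) * residual P J)ᴴ *
      (ketbra φ (Pi.single b 1) * residual P J) = residual P J := by
    have h3 : ∑ b : I, ketbra (Pi.single b 1) (Pi.single b (1 : ℂ)) = (1 : Op I) := by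
      ext a c
      simp [Matrix.sum_apply, ketbra, Matrix.vecMulVec_apply, Matrix.one_apply, Pi.single_apply,
        apply_ite]
    calc _ = ∑ b : I, residual P J * ketbra (Pi.single b 1) (Pi.single b (1 : ℂ)) *
          residual P J := by
            refine Finset.sum_congr rfl fun b _ => ?_
            rw [Matrix.conjTranspose_mul, hQ, conjTranspose_ketbra, mul_assoc,
              ← mul_assoc (ketbra _ _), ketbra_mul_ketbra, hφ, one_smul, mul_assoc]
      _ = _ := by rw [← Finset.sum_mul, ← Finset.mul_sum, h3, mul_one, hQQ]
  simp only [h1, h2]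
  simp [residual]

/-- To first order in time, error correction removes the dissipation and leaves the projected
Hamiltonian. -/
theorem qecOp_lindbladian (hJ : ∀ i, P * J i * P = 0) (ω : ℝ) {X : Op I} (hX : P * X = X) (hX' : X * P = X) :
    qecOp P (krausMap (recoveryKraus P φ J)) (lindbladian H J ω X) =
      (-Complex.I * ω) • (P * H * P * X - X * (P * H * P)) := by
  have hJP : ∀ i, P * (J i)ᴴ * P = 0 := fun i => by
    have := congrArg Matrix.conjTranspose (hJ i)
    simpa [Matrix.conjTranspose_mul, hP, mul_assoc] using this
  have hPJX : ∀ i, P * (J i * X) = 0 := fun i => by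
    rw [← hX, ← mul_assoc, ← mul_assoc, hJ, zero_mul]
  have hQX : (1 - P) * X = 0 := by rw [sub_mul, one_mul, hX, sub_self]
  have hXQ : X * (1 - P) = 0 := by rw [mul_sub, mul_one, hX', sub_self]
  have hPJJX : ∀ i j, P * (J i)ᴴ * (J j * X) = if i = j then X else 0 := fun i j => by
    calc _ = P * (J i)ᴴ * (J j * (P * X)) := by rw [hX]
      _ = P * (J i)ᴴ * J j * P * X := by noncomm_ring
      _ = _ := by rw [hJJ]; split_ifs <;> simp [hX]
  have hXJJP : ∀ i j, X * (J j)ᴴ * (J i * P) = if i = j then X else 0 := fun i j => by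
    calc _ = X * P * (J j)ᴴ * (J i * P) := by rw [hX']
      _ = X * (P * (J j)ᴴ * J i * P) := by noncomm_ring
      _ = _ := by
        rw [hJJ]
        by_cases h : i = j
        · simp [h, hX']
        · simp [h, Ne.symm h]
  have hQJ : ∀ i, (1 - P) * (J i * X) = J i * X := fun i => by
    rw [sub_mul, one_mul, hPJX, sub_zero]
  have hres : ∀ i, residual P J * (J i * X) = 0 := fun i => by
    rw [residual, sub_mul, one_mul, Finset.sum_mul, Finset.sum_eq_single i]
    · rw [mul_assoc, mul_assoc, ← mul_assoc P, hPJJX, if_pos rfl, sub_self]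
    · intro j _ hj
      rw [mul_assoc, mul_assoc, ← mul_assoc P, hPJJX, if_neg hj, mul_zero]
    · simp
  -- the part that stays in the code space
  have h1 : P * lindbladian H J ω X * P =
      (-Complex.I * ω) • (P * H * P * X - X * (P * H * P)) - (Fintype.card κ : ℂ) • X := by
    simp only [lindbladian, LinearMap.coe_mk, AddHom.coe_mk, mul_add, add_mul, Finset.mul_sum,
      Finset.sum_mul, Matrix.mul_smul, Matrix.smul_mul, mul_sub, sub_mul]
    have e1 : P * (H * X) * P = P * H * P * X := by
      calc _ = P * H * (X * P) := by noncomm_ring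
        _ = P * H * (P * X) := by rw [hX', hX]
        _ = _ := by noncomm_ring
    have e2 : P * (X * H) * P = X * (P * H * P) := by
      calc _ = (P * X) * H * P := by noncomm_ring
        _ = (X * P) * H * P := by rw [hX', hX]
        _ = _ := by noncomm_ring
    have e3 : ∀ i, P * (J i * X * (J i)ᴴ) * P = 0 := fun i => by
      rw [← mul_assoc, hPJX]; simp
    have e4 : ∀ i, P * ((J i)ᴴ * J i * X) * P = X := fun i => by
      calc _ = P * (J i)ᴴ * (J i * X) * P := by noncomm_ring
        _ = _ := by rw [hPJJX, if_pos rfl, hX']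
    have e5 : ∀ i, P * (X * ((J i)ᴴ * J i)) * P = X := fun i => by
      calc _ = P * (X * (J i)ᴴ * (J i * P)) := by noncomm_ring
        _ = _ := by rw [hXJJP, if_pos rfl, hX]
    simp only [e1, e2, e3, e4, e5]
    rw [sub_eq_add_neg _ ((Fintype.card κ : ℂ) • X)]
    congr 1
    have : (1 / 2 : ℂ) • (X + X) = X := by rw [smul_add, ← add_smul]; norm_num
    simp only [this, zero_sub, Finset.sum_neg_distrib, Finset.sum_const, Finset.card_univ,
      ← Nat.cast_smul_eq_nsmul ℂ]
  -- the part that has jumped out of it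
  have h2 : (1 - P) * lindbladian H J ω X * (1 - P) = ∑ i, J i * X * (J i)ᴴ := by
    set Q : Op I := 1 - P with hQ
    have hJQ : ∀ i, X * (J i)ᴴ * Q = X * (J i)ᴴ := fun i => by
      rw [hQ, mul_sub, mul_one, sub_eq_self]
      calc _ = X * P * (J i)ᴴ * P := by rw [hX']
        _ = X * (P * (J i)ᴴ * P) := by noncomm_ring
        _ = 0 := by rw [hJP, mul_zero]
    clear_value Q
    simp only [lindbladian, LinearMap.coe_mk, AddHom.coe_mk]
    rw [mul_add, add_mul, Matrix.mul_smul, Matrix.smul_mul, mul_sub, sub_mul]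
    have e1 : Q * (H * X) * Q = 0 := by
      rw [← mul_assoc, mul_assoc _ X, hXQ, mul_zero]
    have e2 : Q * (X * H) * Q = 0 := by rw [← mul_assoc, hQX]; simp
    rw [e1, e2, sub_zero, smul_zero, zero_add, Finset.mul_sum, Finset.sum_mul]
    refine Finset.sum_congr rfl fun i _ => ?_
    rw [mul_sub, sub_mul, Matrix.mul_smul, Matrix.smul_mul, mul_add, add_mul]
    have e3 : Q * (J i * X * (J i)ᴴ) * Q = J i * X * (J i)ᴴ := by
      calc _ = Q * (J i * (X * (J i)ᴴ * Q)) := by noncomm_ring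
        _ = Q * (J i * X) * (J i)ᴴ := by rw [hJQ]; noncomm_ring
        _ = _ := by rw [hQJ]
    have e4 : Q * ((J i)ᴴ * J i * X) * Q = 0 := by
      rw [← mul_assoc, mul_assoc _ X, hXQ, mul_zero]
    have e5 : Q * (X * ((J i)ᴴ * J i)) * Q = 0 := by rw [← mul_assoc, hQX]; simp
    rw [e3, e4, e5]
    simp
  -- Each jump is undone exactly and returns one copy of `X`; the sum cancels the loss `-(card κ) X`
  -- of the part that stayed in the code space.
  have h3 : krausMap (recoveryKraus P φ J) (∑ i, J i * X * (J i)ᴴ) = (Fintype.card κ : ℂ) • X := by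
    rw [map_sum]
    have : ∀ i, krausMap (recoveryKraus P φ J) (J i * X * (J i)ᴴ) = X := fun i => by
      rw [krausMap_apply, Fintype.sum_sum_type]
      have e1 : ∀ b, recoveryKraus P φ J (.inr b) * (J i * X * (J i)ᴴ) *
          (recoveryKraus P φ J (.inr b))ᴴ = 0 := fun b => by
        simp only [recoveryKraus]
        rw [mul_assoc (ketbra _ _), ← mul_assoc (residual P J), hres]
        simp
      rw [Finset.sum_eq_single i]
      · simp only [e1, Finset.sum_const_zero, add_zero]
        simp only [recoveryKraus]
        rw [Matrix.conjTranspose_mul, Matrix.conjTranspose_conjTranspose, hP]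
        calc _ = P * (J i)ᴴ * (J i * X) * (J i)ᴴ * (J i * P) := by noncomm_ring
          _ = _ := by rw [hPJJX, if_pos rfl, hXJJP, if_pos rfl]
      · intro j _ hj
        simp only [recoveryKraus]
        calc _ = P * (J j)ᴴ * (J i * X) * (J i)ᴴ * (P * (J j)ᴴ)ᴴ := by noncomm_ring
          _ = _ := by rw [hPJJX, if_neg hj]; simp
      · simp
    simp [this, ← Nat.cast_smul_eq_nsmul ℂ]
  have hs : ∀ A Y : Op I, sandwich A Y = A * Y * A := fun A Y => by simp [sandwich, mul_assoc]
  rw [qecOp, LinearMap.add_apply, LinearMap.comp_apply, hs, hs, h1, h2, h3]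
  abel

end Recovery


/-! ### The limit of fast error correction on one block -/

section Block

variable {I κ : Type} [Fintype I] [Fintype κ]

/-- The generator is affine in `ω`, which is what permits the continuation to complex frequencies.
-/
theorem lindbladian_eq_add_smul (H : Op I) (J : κ → Op I) (ω : ℝ) :
    lindbladian H J ω =
      lindbladian H J 0 + (ω : ℂ) • (lindbladian H J 1 - lindbladian H J 0) := by
  refine LinearMap.ext fun X => ?_
  simp only [lindbladian, LinearMap.add_apply, LinearMap.smul_apply, LinearMap.sub_apply,
    LinearMap.coe_mk, AddHom.coe_mk, Complex.ofReal_one, Complex.ofReal_zero, mul_one, mul_zero,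
    zero_smul, zero_add, add_sub_cancel_right, smul_smul]
  rw [add_comm, mul_comm]

theorem sandwich_ketbra {ψ : Fin 2 → I → ℂ}
    (hψ : ∀ k k', star (ψ k) ⬝ᵥ ψ k' = if k = k' then 1 else 0) (a b : Fin 2) :
    sandwich (codeProj ψ) (ketbra (ψ a) (ψ b)) = ketbra (ψ a) (ψ b) := by
  simp only [sandwich, LinearMap.comp_apply, LinearMap.mulLeft_apply, LinearMap.mulRight_apply]
  rw [ketbra_mul_codeProj hψ, codeProj_mul_ketbra hψ]

variable [DecidableEq I]

/-- The rounds of evolution and error correction, continued to complex frequencies. -/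
noncomputable def complexRounds (C : SuperOp I) (H : Op I) (J : κ → Op I) (t : ℝ) (K : ℕ) (z : ℂ) :
    SuperOp I :=
  (C * superExp (((t / K : ℝ) : ℂ) •
    (lindbladian H J 0 + z • (lindbladian H J 1 - lindbladian H J 0)))) ^ K

theorem complexRounds_ofReal (C : SuperOp I) (H : Op I) (J : κ → Op I) (t : ℝ) (K : ℕ) (ω : ℝ) :
    complexRounds C H J t K ω = rounds C (lindbladian H J ω) t K := by
  rw [complexRounds, ← lindbladian_eq_add_smul, ← evolution_eq_superExp]
  rfl

theorem differentiable_complexRounds (C : SuperOp I) (H : Op I) (J : κ → Op I) (t : ℝ)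
    (K : ℕ) (X : Op I) : Differentiable ℂ fun z => complexRounds C H J t K z X := by
  have e : ∀ z, complexRounds C H J t K z X = evalRep X ((superRep I C *
      NormedSpace.exp (((t / K : ℝ) : ℂ) • (superRep I (lindbladian H J 0) +
        z • superRep I (lindbladian H J 1 - lindbladian H J 0)))) ^ K) := fun z => by
    rw [← evalRep_superRep, complexRounds]
    simp only [map_pow, map_mul, superRep_superExp, map_smul, map_add]
  simp only [e]
  have h1 : Differentiable ℂ fun z : ℂ => ((t / K : ℝ) : ℂ) • (superRep I (lindbladian H J 0) +
        z • superRep I (lindbladian H J 1 - lindbladian H J 0)) := by fun_prop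
  have h2 : Differentiable ℂ (NormedSpace.exp : Op (I × I) → Op (I × I)) := fun x =>
    (NormedSpace.exp_analytic (𝕂 := ℂ) x).differentiableAt
  exact (evalRep X).differentiable.comp (((h2.comp h1).const_mul _).pow K)

variable {ψ : Fin 2 → I → ℂ} (hψ : ∀ k k', star (ψ k) ⬝ᵥ ψ k' = if k = k' then 1 else 0)
  {H : Op I} {J : κ → Op I}

/-- The error-correcting operation of a code. -/
noncomputable def codeQEC (ψ : Fin 2 → I → ℂ) (J : κ → Op I) : SuperOp I :=
  qecOp (codeProj ψ) (krausMap (recoveryKraus (codeProj ψ) (ψ 1) J))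

include hψ

/-- With `codeQEC_mul_sandwich` this supplies the hypotheses on `C` and `π` of the product formula
`norm_rounds_sub_superExp_le`. -/
theorem sandwich_mul_codeQEC : sandwich (codeProj ψ) * codeQEC ψ J = codeQEC ψ J := by
  have h1 := sandwich_recovery (J := J) (conjTranspose_codeProj ψ) (codeProj_mul_self hψ)
    (codeProj_mulVec hψ 1)
  have h2 : sandwich (codeProj ψ) * sandwich (codeProj ψ) = sandwich (codeProj ψ) := by
    refine LinearMap.ext fun X => ?_
    simp only [sandwich, Module.End.mul_apply, LinearMap.comp_apply, LinearMap.mulLeft_apply,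
      LinearMap.mulRight_apply]
    calc _ = (codeProj ψ * codeProj ψ) * X * (codeProj ψ * codeProj ψ) := by noncomm_ring
      _ = _ := by rw [codeProj_mul_self hψ, mul_assoc]
  rw [codeQEC, qecOp, mul_add, h2, ← Module.End.mul_eq_comp, ← mul_assoc, Module.End.mul_eq_comp _
    (krausMap _), h1]

theorem codeQEC_mul_sandwich :
    codeQEC ψ J * sandwich (codeProj ψ) = sandwich (codeProj ψ) := by
  refine LinearMap.ext fun X => ?_
  have hP := codeProj_mul_self hψ
  simp only [codeQEC, qecOp, sandwich, Module.End.mul_apply, LinearMap.add_apply,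
    LinearMap.comp_apply, LinearMap.mulLeft_apply, LinearMap.mulRight_apply]
  have e1 : codeProj ψ * (codeProj ψ * (X * codeProj ψ) * codeProj ψ) =
      codeProj ψ * (X * codeProj ψ) := by
    calc _ = (codeProj ψ * codeProj ψ) * X * (codeProj ψ * codeProj ψ) := by noncomm_ring
      _ = _ := by rw [hP, mul_assoc]
  have e2 : (1 - codeProj ψ) * (codeProj ψ * (X * codeProj ψ) * (1 - codeProj ψ)) = 0 := by
    rw [← mul_assoc, ← mul_assoc, sub_mul, one_mul, hP, sub_self]
    simp
  rw [e1, e2, map_zero, add_zero]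

variable [DecidableEq κ] (hJ : ∀ i, codeProj ψ * J i * codeProj ψ = 0)
  (hJJ : ∀ i j, codeProj ψ * (J i)ᴴ * J j * codeProj ψ = if i = j then codeProj ψ else 0)
  {q r : ℝ} (hH : codeProj ψ * H * codeProj ψ = (q : ℂ) • codeProj ψ + (r : ℂ) • logicalZ ψ)

include hJ hJJ hH

/-- The logical matrix units diagonalise the corrected generator. The scalar part `q P` of the
projected Hamiltonian drops out of the commutator. -/
theorem codeQEC_lindbladian_ketbra (ω : ℝ) (a b : Fin 2) :
    codeQEC ψ J (lindbladian H J ω (ketbra (ψ a) (ψ b))) =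
      (-Complex.I * ω * (r * (zsign a - zsign b))) • ketbra (ψ a) (ψ b) := by
  rw [codeQEC, qecOp_lindbladian (conjTranspose_codeProj ψ) hJJ hJ ω (codeProj_mul_ketbra hψ _ _)
    (ketbra_mul_codeProj hψ _ _), hH]
  simp only [add_mul, mul_add, Matrix.smul_mul, Matrix.mul_smul, codeProj_mul_ketbra hψ,
    ketbra_mul_codeProj hψ, logicalZ_mul_ketbra hψ, ketbra_mul_logicalZ hψ, add_sub_add_left_eq_sub,
    smul_smul, ← sub_smul]
  congr 1
  ring

theorem projected_generator_ketbra (z : ℂ) (a b : Fin 2) :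
    (codeQEC ψ J * (lindbladian H J 0 + z • (lindbladian H J 1 - lindbladian H J 0)) *
      sandwich (codeProj ψ)) (ketbra (ψ a) (ψ b)) =
      (-Complex.I * z * (r * (zsign a - zsign b))) • ketbra (ψ a) (ψ b) := by
  simp only [Module.End.mul_apply, sandwich_ketbra hψ, LinearMap.add_apply, LinearMap.smul_apply,
    LinearMap.sub_apply, map_add, map_smul, map_sub, codeQEC_lindbladian_ketbra hψ hJ hJJ hH,
    smul_smul, ← sub_smul, ← add_smul]
  congr 1
  push_cast
  ring

/-- Fast error correction leaves a unitary evolution of the logical operators, uniformly for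
bounded complex frequencies. -/
theorem norm_complexRounds_sub_le [Nonempty I] (t R : ℝ) (a b : Fin 2) :
    ∃ E : ℝ, ∀ K : ℕ, 1 ≤ K → ∀ z : ℂ, ‖z‖ ≤ R →
      ‖complexRounds (codeQEC ψ J) H J t K z (ketbra (ψ a) (ψ b)) -
        Complex.exp (-Complex.I * z * (t * r * (zsign a - zsign b))) • ketbra (ψ a) (ψ b)‖ ≤
          E / K := by
  obtain ⟨E, hE⟩ := norm_rounds_sub_superExp_le (sandwich_mul_codeQEC (J := J) hψ)
    (codeQEC_mul_sandwich hψ) (lindbladian H J 0) (lindbladian H J 1 - lindbladian H J 0) t R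
    (sandwich_ketbra hψ a b)
  refine ⟨E, fun K hK z hz => ?_⟩
  have h := hE K hK z hz
  have e : ((t : ℂ) • (codeQEC ψ J * (lindbladian H J 0 +
      z • (lindbladian H J 1 - lindbladian H J 0)) * sandwich (codeProj ψ))) (ketbra (ψ a) (ψ b)) =
      (-Complex.I * z * (t * r * (zsign a - zsign b))) • ketbra (ψ a) (ψ b) := by
    rw [LinearMap.smul_apply, projected_generator_ketbra hψ hJ hJJ hH, smul_smul]
    congr 1
    ring
  rwa [superExp_apply_of_eigenvector e] at h

theorem tendsto_rounds_ketbra [Nonempty I] (t ω : ℝ) (a b : Fin 2) :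
    Tendsto (fun K : ℕ => rounds (codeQEC ψ J) (lindbladian H J ω) t K (ketbra (ψ a) (ψ b))) atTop
      (𝓝 (Complex.exp (-Complex.I * ω * (t * r * (zsign a - zsign b))) • ketbra (ψ a) (ψ b))) := by
  obtain ⟨E, hE⟩ := norm_complexRounds_sub_le hψ hJ hJJ hH t ‖(ω : ℂ)‖ a b
  rw [tendsto_iff_norm_sub_tendsto_zero]
  refine squeeze_zero' (Eventually.of_forall fun _ => norm_nonneg _)
    ((eventually_ge_atTop 1).mono fun K hK => ?_) (tendsto_const_div_atTop_nhds_zero_nat E)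
  rw [← complexRounds_ofReal]
  exact hE K hK ω le_rfl

/-- In the limit of fast error correction the logical state follows the noiseless equation. -/
theorem exists_logical_evolution [Nonempty I] (ω : ℝ) {ρ : Op I}
    (hρ : sandwich (codeProj ψ) ρ = ρ) :
    ∃ ρL : ℝ → Op I, ρL 0 = ρ ∧
      (∀ t a b, HasDerivAt (fun s => ρL s a b)
        (((-Complex.I * ((ω * r : ℝ) : ℂ)) •
          (logicalZ ψ * ρL t - ρL t * logicalZ ψ)) a b) t) ∧
      ∀ t : ℝ, 0 ≤ t → Tendsto (fun K : ℕ => rounds (codeQEC ψ J) (lindbladian H J ω) t K ρ)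
        atTop (𝓝 (ρL t)) := by
  set m : Fin 2 → Fin 2 → ℂ := fun a b => star (ψ a) ⬝ᵥ ρ *ᵥ ψ b with hm
  -- A state supported on the code is a combination of logical matrix units, each of which only
  -- acquires a phase.
  have hρm : ρ = ∑ a, ∑ b, m a b • ketbra (ψ a) (ψ b) := by
    rw [hm, ← codeProj_mul_mul_codeProj]
    conv_lhs => rw [← hρ]
    simp [sandwich, mul_assoc]
  refine ⟨fun t => ∑ a, ∑ b, m a b •
    (Complex.exp (-Complex.I * ω * (t * r * (zsign a - zsign b))) • ketbra (ψ a) (ψ b)), ?_, ?_, ?_⟩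
  · conv_rhs => rw [hρm]
    simp
  · intro t i j
    have hd : HasDerivAt (fun t : ℝ => ∑ a, ∑ b, m a b *
        (Complex.exp (-Complex.I * ω * (t * r * (zsign a - zsign b))) * ketbra (ψ a) (ψ b) i j))
        (∑ a, ∑ b, m a b * ((Complex.exp (-Complex.I * ω * (t * r * (zsign a - zsign b))) *
          (-Complex.I * ω * (1 * r * (zsign a - zsign b)))) * ketbra (ψ a) (ψ b) i j)) t := by
      refine HasDerivAt.fun_sum fun a _ => HasDerivAt.fun_sum fun b _ => ?_
      refine HasDerivAt.const_mul _ (HasDerivAt.mul_const ?_ _)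
      have h0 : HasDerivAt (fun t : ℝ => (t : ℂ)) 1 t := Complex.ofRealCLM.hasDerivAt
      exact (((h0.mul_const (r : ℂ)).mul_const _).const_mul _).cexp
    simp only [Matrix.sum_apply, Matrix.smul_apply, smul_eq_mul]
    refine hd.congr_deriv ?_
    simp only [Finset.mul_sum, Finset.sum_mul, ← Finset.sum_sub_distrib,
      Matrix.mul_smul, Matrix.smul_mul, logicalZ_mul_ketbra hψ, ketbra_mul_logicalZ hψ, smul_smul,
      ← sub_smul, Matrix.sum_apply, Matrix.smul_apply, smul_eq_mul]
    refine Finset.sum_congr rfl fun a _ => Finset.sum_congr rfl fun b _ => ?_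
    push_cast
    ring
  · intro t _
    conv in rounds _ _ _ _ _ => rw [hρm]
    simp only [map_sum, map_smul]
    exact tendsto_finsetSum _ fun a _ => tendsto_finsetSum _ fun b _ =>
      (tendsto_rounds_ketbra hψ hJ hJJ hH t ω a b).const_smul _

end Block


/-! ### The Fisher information of a logical GHZ state -/

section GHZ

variable {I : Type}

/-- The GHZ state of the code words `Ψ` with the relative phase `e^{-i c z}`. -/
noncomputable def phaseState (Ψ : Fin 2 → I → ℂ) (c : ℝ) (z : ℂ) : Op I :=
  (1 / 2 : ℂ) • ∑ a, ∑ b,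
    Complex.exp (-Complex.I * z * (c / 2 * (zsign a - zsign b))) • ketbra (Ψ a) (Ψ b)

theorem phaseState_eq (Ψ : Fin 2 → I → ℂ) (c : ℝ) (z : ℂ) : phaseState Ψ c z = (1 / 2 : ℂ) •
    (ketbra (Ψ 0) (Ψ 0) + Complex.exp (-(Complex.I * z * c)) • ketbra (Ψ 0) (Ψ 1) +
      (Complex.exp (Complex.I * z * c) • ketbra (Ψ 1) (Ψ 0) + ketbra (Ψ 1) (Ψ 1))) := by
  have e1 : -Complex.I * z * (c / 2 * ((zsign 0 : ℝ) - (zsign 1 : ℝ))) = -(Complex.I * z * c) := by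
    simp only [zsign, Matrix.cons_val_zero, Matrix.cons_val_one]; push_cast; ring
  have e2 : -Complex.I * z * (c / 2 * ((zsign 1 : ℝ) - (zsign 0 : ℝ))) = Complex.I * z * c := by
    simp only [zsign, Matrix.cons_val_zero, Matrix.cons_val_one]; push_cast; ring
  rw [phaseState, Fin.sum_univ_two, Fin.sum_univ_two, Fin.sum_univ_two, e1, e2]
  simp

variable [Fintype I]

theorem trace_phaseState {Ψ : Fin 2 → I → ℂ}
    (hΨ : ∀ k k', star (Ψ k) ⬝ᵥ Ψ k' = if k = k' then 1 else 0) (c : ℝ) (z : ℂ) : (phaseState Ψ c z).trace = 1 := by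
  rw [phaseState_eq]
  simp [Matrix.trace_add, Matrix.trace_smul, trace_ketbra, hΨ]
  norm_num

variable [DecidableEq I]

theorem differentiable_op_iff {f : ℂ → Op I} :
    Differentiable ℂ f ↔ ∀ a b, Differentiable ℂ fun z => f z a b := by
  refine ⟨fun h a b z => (hasDerivAt_op_iff.1 (h z).hasDerivAt a b).differentiableAt,
    fun h z => ?_⟩
  have : HasDerivAt f (Matrix.of fun a b => deriv (fun z => f z a b) z) z :=
    hasDerivAt_op_iff.2 fun a b => (h a b z).hasDerivAt
  exact this.differentiableAt

theorem differentiable_phaseState (Ψ : Fin 2 → I → ℂ) (c : ℝ) :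
    Differentiable ℂ (phaseState Ψ c) := by
  rw [differentiable_op_iff]
  intro a b
  simp only [phaseState, Matrix.smul_apply, Matrix.sum_apply, smul_eq_mul]
  fun_prop

variable {Ψ : Fin 2 → I → ℂ} (hΨ : ∀ k k', star (Ψ k) ⬝ᵥ Ψ k' = if k = k' then 1 else 0)

include hΨ

theorem exp_logicalZ_mul_ketbra (s : ℂ) (k : Fin 2) (φ : I → ℂ) :
    NormedSpace.exp (s • logicalZ Ψ) * ketbra (Ψ k) φ =
      Complex.exp (s * zsign k) • ketbra (Ψ k) φ := by
  have h := exp_apply_of_eigenvector ((ContinuousLinearMap.mul ℂ (Op I)).flip (ketbra (Ψ k) φ))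
    (A := s • logicalZ Ψ) (μ := s * zsign k) fun m => by
      simp only [ContinuousLinearMap.flip_apply, ContinuousLinearMap.mul_apply', one_mul]
      induction m with
      | zero => simp
      | succ m ih =>
        rw [pow_succ, mul_assoc, Matrix.smul_mul, logicalZ_mul_ketbra hΨ, smul_smul,
          Matrix.mul_smul, ih, smul_smul, pow_succ']
  simpa using h

theorem ketbra_mul_exp_logicalZ (s : ℂ) (k : Fin 2) (φ : I → ℂ) :
    ketbra φ (Ψ k) * NormedSpace.exp (s • logicalZ Ψ) =
      Complex.exp (s * zsign k) • ketbra φ (Ψ k) := by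
  have h := exp_apply_of_eigenvector (ContinuousLinearMap.mul ℂ (Op I) (ketbra φ (Ψ k)))
    (A := s • logicalZ Ψ) (μ := s * zsign k) fun m => by
      simp only [ContinuousLinearMap.mul_apply', mul_one]
      induction m with
      | zero => simp
      | succ m ih =>
        rw [pow_succ, ← mul_assoc, ih, Matrix.smul_mul, Matrix.mul_smul, ketbra_mul_logicalZ hΨ,
          smul_smul, smul_smul, pow_succ]
        congr 1
        ring
  simpa using h

/-- Supplies `hcov` of `exists_isQFI_tendsto` with `G = (c / 2) Z_L`: the conjugation undoes a shift
of the parameter, also for complex `z`. -/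
theorem phaseState_covariant (c : ℝ) (w z : ℂ) :
    NormedSpace.exp (z • (Complex.I • ((c / 2 : ℂ) • logicalZ Ψ))) * phaseState Ψ c (w + z) *
      NormedSpace.exp ((-z) • (Complex.I • ((c / 2 : ℂ) • logicalZ Ψ))) = phaseState Ψ c w := by
  simp only [phaseState, smul_smul, Matrix.mul_smul, Matrix.smul_mul, Finset.mul_sum,
    Finset.sum_mul, exp_logicalZ_mul_ketbra hΨ, ketbra_mul_exp_logicalZ hΨ]
  congr 1
  refine Finset.sum_congr rfl fun a _ => Finset.sum_congr rfl fun b _ => ?_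
  rw [← Complex.exp_add, ← Complex.exp_add]
  congr 2
  ring

/-- The state is pure for real parameters, so differentiating `ρ² = ρ` shows that `Λ = 2 ∂ρ` is a
logarithmic derivative; here `Λ²` is `c²` times the code projection. -/
theorem isQFI_phaseState (c ω : ℝ) : IsQFI (fun x : ℝ => phaseState Ψ c x) ω (c ^ 2) := by
  set x := Complex.exp (-(Complex.I * ω * c)) with hx
  set y := Complex.exp (Complex.I * ω * c) with hy
  have hxy : x * y = 1 := by rw [hx, hy, ← Complex.exp_add]; simp
  have hstar : star x = y := by
    rw [hx, hy, RCLike.star_def, ← Complex.exp_conj]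
    simp
  have hstar' : star y = x := by rw [← hstar, star_star]
  set Λ : Op I := (-(Complex.I * c * x)) • ketbra (Ψ 0) (Ψ 1) +
    (Complex.I * c * y) • ketbra (Ψ 1) (Ψ 0) with hΛ
  have hΛ2 : Λ ^ 2 = ((c : ℂ) ^ 2) • codeProj Ψ := by
    rw [hΛ, pow_two, codeProj]
    simp only [add_mul, mul_add, Matrix.smul_mul, Matrix.mul_smul, ketbra_mul_ketbra, hΨ]
    simp only [Fin.isValue, zero_ne_one, one_ne_zero, if_true, if_false, smul_zero, one_smul,
      zero_smul, smul_smul, add_zero, zero_add]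
    have hI := Complex.I_mul_I
    have e : -(Complex.I * c * x) * (Complex.I * c * y) = (c : ℂ) ^ 2 := by
      linear_combination (-(c : ℂ) ^ 2 * (x * y)) * hI + (c : ℂ) ^ 2 * hxy
    rw [mul_comm (Complex.I * c * y), e, smul_add, add_comm]
  refine ⟨Λ, ?_, ?_, ?_⟩
  · rw [Matrix.IsHermitian, hΛ]
    simp only [Matrix.conjTranspose_add, Matrix.conjTranspose_smul, conjTranspose_ketbra, star_neg,
      star_mul', hstar, hstar', RCLike.star_def, Complex.conj_I, Complex.conj_ofReal]
    rw [add_comm]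
    congr 1 <;> congr 1 <;> ring
  · have hd : ∀ a b, HasDerivAt (fun u : ℝ => phaseState Ψ c u a b)
        (((1 / 2 : ℂ) • ((-(Complex.I * c * x)) • ketbra (Ψ 0) (Ψ 1) +
          (Complex.I * c * y) • ketbra (Ψ 1) (Ψ 0))) a b) ω := fun a b => by
      simp only [phaseState_eq, Matrix.smul_apply, Matrix.add_apply, smul_eq_mul]
      have h0 : HasDerivAt (fun u : ℝ => (u : ℂ)) 1 ω := Complex.ofRealCLM.hasDerivAt
      have h1 := ((h0.const_mul Complex.I).mul_const (c : ℂ))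
      have h2 := (h1.neg.cexp.mul_const (ketbra (Ψ 0) (Ψ 1) a b)).const_add
        (ketbra (Ψ 0) (Ψ 0) a b)
      have h3 := (h1.cexp.mul_const (ketbra (Ψ 1) (Ψ 0) a b)).add_const
        (ketbra (Ψ 1) (Ψ 1) a b)
      refine ((h2.add h3).const_mul (1 / 2 : ℂ)).congr_deriv ?_
      simp only [Pi.neg_apply, ← hx, ← hy]
      ring
    intro a b
    refine (hd a b).congr_deriv ?_
    refine congrFun (congrFun ?_ a) b
    rw [← hΛ]
    simp only
    rw [phaseState_eq, ← hx, ← hy]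
    congr 1
    rw [hΛ]
    simp only [add_mul, mul_add, smul_add, Matrix.smul_mul, Matrix.mul_smul, ketbra_mul_ketbra, hΨ]
    simp only [Fin.isValue, zero_ne_one, one_ne_zero, if_true, if_false, smul_zero, one_smul,
      zero_smul, smul_smul, add_zero, zero_add]
    module
  · simp only [hΛ2]
    have e : phaseState Ψ c ω * codeProj Ψ = phaseState Ψ c ω := by
      simp only [phaseState, Matrix.smul_mul, Finset.sum_mul, ketbra_mul_codeProj hΨ]
    rw [Matrix.mul_smul, e, Matrix.trace_smul, trace_phaseState hΨ]
    simp

/-- `Z_L² = 1` on the code. The mean of `Z_L` vanishes in this balanced state, so the second moment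
of `G` is already its variance. -/
theorem trace_phaseState_mul_sq (c ω : ℝ) :
    4 * (phaseState Ψ c ω * ((c / 2 : ℂ) • logicalZ Ψ) ^ 2).trace.re = c ^ 2 := by
  have e : phaseState Ψ c ω * ((c / 2 : ℂ) • logicalZ Ψ) ^ 2 =
      ((c ^ 2 / 4 : ℝ) : ℂ) • phaseState Ψ c ω := by
    rw [pow_two, ← mul_assoc]
    simp only [phaseState, Matrix.smul_mul, Matrix.mul_smul, Finset.sum_mul,
      ketbra_mul_logicalZ hΨ, smul_smul, Finset.smul_sum]
    refine Finset.sum_congr rfl fun a _ => Finset.sum_congr rfl fun b _ => ?_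
    congr 1
    have : ((zsign b : ℝ) : ℂ) * zsign b = 1 := by fin_cases b <;> simp [zsign]
    push_cast
    linear_combination ((c : ℂ) ^ 2 / 8 *
      Complex.exp (-Complex.I * ω * (c / 2 * (zsign a - zsign b)))) * this
  rw [e, Matrix.trace_smul, trace_phaseState hΨ, smul_eq_mul, mul_one, Complex.ofReal_re]
  ring

end GHZ


/-! ### Arrays of blocks in a logical GHZ state -/

section Array

theorem norm_prod_sub_prod_le {ι : Type} (s : Finset ι) {a b : ι → ℂ} {M δ : ℝ} (hM : 1 ≤ M)
    (ha : ∀ i, ‖a i‖ ≤ M) (hb : ∀ i, ‖b i‖ ≤ M) (hab : ∀ i, ‖a i - b i‖ ≤ δ) :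
    ‖∏ i ∈ s, a i - ∏ i ∈ s, b i‖ ≤ s.card * M ^ s.card * δ := by
  classical
  induction s using Finset.induction_on with
  | empty => simp
  | insert i s hi ih =>
    have hδ : 0 ≤ δ := (norm_nonneg _).trans (hab i)
    have hbs : ‖∏ j ∈ s, b j‖ ≤ M ^ s.card := by
      rw [norm_prod]
      exact (Finset.prod_le_prod (fun j _ => norm_nonneg _) fun j _ => hb j).trans_eq (by simp)
    rw [Finset.prod_insert hi, Finset.prod_insert hi, Finset.card_insert_of_notMem hi]
    have e : a i * ∏ j ∈ s, a j - b i * ∏ j ∈ s, b j =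
        a i * (∏ j ∈ s, a j - ∏ j ∈ s, b j) + (a i - b i) * ∏ j ∈ s, b j := by ring
    rw [e]
    calc _ ≤ M * (s.card * M ^ s.card * δ) + δ * M ^ s.card := by
          refine (norm_add_le _ _).trans ?_
          rw [norm_mul, norm_mul]
          gcongr
          · exact ha i
          · exact hab i
      _ ≤ M * (s.card * M ^ s.card * δ) + δ * (M ^ s.card * M) := by
          gcongr
          exact le_mul_of_one_le_right (by positivity) hM
      _ = _ := by push_cast; ring

section

variable {I : Type}

/-- The code words of an array. -/
noncomputable def arrayCode (ψ : Fin 2 → I → ℂ) (n : ℕ) (a : Fin 2) : (Fin n → I) → ℂ :=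
  fun w => ∏ j, ψ a (w j)

theorem ketbra_ghz (ψ : Fin 2 → I → ℂ) (n : ℕ) :
    ketbra (ghz ψ n) (ghz ψ n) =
      (1 / 2 : ℂ) • ∑ a, ∑ b, tprod fun _ : Fin n => ketbra (ψ a) (ψ b) := by
  have h2 : ((Real.sqrt 2 : ℝ) : ℂ) * ((Real.sqrt 2 : ℝ) : ℂ) = 2 := by
    rw [← Complex.ofReal_mul, Real.mul_self_sqrt zero_le_two]; norm_num
  have h3 : (1 / (Real.sqrt 2 : ℂ)) * (1 / (Real.sqrt 2 : ℂ)) = 1 / 2 := by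
    rw [div_mul_div_comm, h2, one_mul]
  ext w w'
  simp only [tprod_ketbra]
  simp only [Fin.sum_univ_two, Matrix.smul_apply, Matrix.add_apply, ketbra,
    Matrix.vecMulVec_apply, ghz, Pi.star_apply, star_mul', star_add, smul_eq_mul, RCLike.star_def,
    map_div₀, map_one, map_prod, Complex.conj_ofReal, ← h3]
  ring

/-- The phases of the `n` blocks multiply. This linear growth of the total phase in `n` is the
source of the quadratic scaling of the Fisher information. -/
theorem phaseState_arrayCode (ψ : Fin 2 → I → ℂ) (n : ℕ) (s : ℝ) (z : ℂ) :
    phaseState (arrayCode ψ n) (2 * (n * s)) z = (1 / 2 : ℂ) • ∑ a, ∑ b, tprod fun _ : Fin n =>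
      Complex.exp (-Complex.I * z * (s * (zsign a - zsign b))) • ketbra (ψ a) (ψ b) := by
  rw [phaseState]
  congr 1
  refine Finset.sum_congr rfl fun a _ => Finset.sum_congr rfl fun b _ => ?_
  have e : tprod (fun _ : Fin n => Complex.exp (-Complex.I * z * (s * (zsign a - zsign b))) •
      ketbra (ψ a) (ψ b)) = Complex.exp (-Complex.I * z * (s * (zsign a - zsign b))) ^ n •
        tprod (fun _ : Fin n => ketbra (ψ a) (ψ b)) := by
    ext w w'
    simp [tprod_apply, Finset.prod_mul_distrib]
  rw [e, tprod_ketbra, ← Complex.exp_nat_mul]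
  congr 2
  push_cast
  ring

variable [Fintype I]

theorem arrayCode_orthonormal {ψ : Fin 2 → I → ℂ}
    (hψ : ∀ k k', star (ψ k) ⬝ᵥ ψ k' = if k = k' then 1 else 0) {n : ℕ} (hn : 1 ≤ n)
    (k k' : Fin 2) : star (arrayCode ψ n k) ⬝ᵥ arrayCode ψ n k' = if k = k' then 1 else 0 := by
  have e : star (arrayCode ψ n k) ⬝ᵥ arrayCode ψ n k' = ∏ _j : Fin n, star (ψ k) ⬝ᵥ ψ k' := by
    simp only [dotProduct, arrayCode, Finset.prod_univ_sum, Fintype.piFinset_univ, Pi.star_apply,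
      star_prod, Finset.prod_mul_distrib]
  rw [e, hψ]
  split_ifs with h
  · simp
  · simp
    -- For `n = 0` both array words would be the empty product, with overlap `1`.
    omega

variable [DecidableEq I]

/-- Uniform approximation passes to tensor powers. -/
theorem norm_tprod_sub_le (n : ℕ) {f : ℕ → ℂ → Op I} {g : ℂ → Op I} {S : Set ℂ} {E M : ℝ}
    (hE : ∀ K : ℕ, 1 ≤ K → ∀ z ∈ S, ‖f K z - g z‖ ≤ E / K) (hg : ∀ z ∈ S, ‖g z‖ ≤ M) :
    ∃ E' : ℝ, ∀ K : ℕ, 1 ≤ K → ∀ z ∈ S,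
      ‖tprod (fun _ : Fin n => f K z) - tprod (fun _ : Fin n => g z)‖ ≤ E' / K := by
  obtain ⟨c, hc, hcb⟩ := exists_norm_le_entries (Fin n → I)
  set M' := 1 + |M| + |E| with hM'
  refine ⟨c * (n * M' ^ n * E), fun K hK z hz => ?_⟩
  have hK' : (1 : ℝ) ≤ K := by exact_mod_cast hK
  rw [mul_div_assoc, mul_div_assoc]
  refine hcb _ _ fun w w' => ?_
  have h1 : ∀ a b, ‖f K z a b - g z a b‖ ≤ E / K := fun a b =>
    (norm_entry_le (f K z - g z) a b).trans (hE K hK z hz)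
  have h2 : ∀ a b, ‖g z a b‖ ≤ M' := fun a b => by
    have := (norm_entry_le (g z) a b).trans (hg z hz)
    linarith [le_abs_self M, abs_nonneg E]
  have h3 : ∀ a b, ‖f K z a b‖ ≤ M' := fun a b => by
    have e : f K z a b = (f K z a b - g z a b) + g z a b := by ring
    have h4 := (norm_entry_le (g z) a b).trans (hg z hz)
    have h5 : E / K ≤ |E| := (div_le_div_of_nonneg_right (le_abs_self E) (by positivity)).trans
      (div_le_self (abs_nonneg E) hK')
    rw [e]
    refine (norm_add_le _ _).trans ?_
    linarith [le_abs_self M, h1 a b]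
  have := norm_prod_sub_prod_le (Finset.univ : Finset (Fin n)) (M := M')
    (a := fun j => f K z (w j) (w' j)) (b := fun j => g z (w j) (w' j)) (δ := E / K)
    (by linarith [abs_nonneg M, abs_nonneg E]) (fun j => h3 _ _) (fun j => h2 _ _) fun j => h1 _ _
  simpa [tprod_apply] using this

theorem differentiable_tprod (n : ℕ) {f : ℂ → Op I} (hf : Differentiable ℂ f) :
    Differentiable ℂ fun z => tprod fun _ : Fin n => f z := by
  rw [differentiable_op_iff] at hf ⊢
  intro w w'
  simp only [tprod_apply]
  exact Differentiable.fun_finsetProd fun j _ => hf _ _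

end

variable {m d : ℕ} {α : Type} [DecidableEq α]

theorem conjTranspose_onProbe (ℓ : Fin m) (A : Op (Fin d)) :
    (onProbe (α := α) ℓ A)ᴴ = onProbe ℓ Aᴴ := by
  ext p q
  simp only [Matrix.conjTranspose_apply, onProbe, Matrix.of_apply, apply_ite star, star_zero]
  refine if_congr (and_congr ?_ eq_comm) rfl rfl
  exact forall₂_congr fun _ _ => eq_comm

/-- Complete positivity of the correction, which keeps the array states positive for real
frequencies. -/
theorem codeQEC_eq_sum {I κ : Type} [Fintype I] [DecidableEq I] [Fintype κ] (ψ : Fin 2 → I → ℂ)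
    (J : κ → Op I) : ∃ V : Option (κ ⊕ I) → Op I, ∀ X, codeQEC ψ J X = ∑ i, V i * X * (V i)ᴴ := by
  refine ⟨fun i => i.elim (codeProj ψ)
    fun x => recoveryKraus (codeProj ψ) (ψ 1) J x * (1 - codeProj ψ), fun X => ?_⟩
  rw [Fintype.sum_option, codeQEC, qecOp, LinearMap.add_apply, LinearMap.comp_apply,
    krausMap_apply]
  simp only [Option.elim_none, Option.elim_some, Matrix.conjTranspose_mul,
    Matrix.conjTranspose_sub, Matrix.conjTranspose_one, conjTranspose_codeProj, sandwich,
    LinearMap.comp_apply, LinearMap.mulLeft_apply, LinearMap.mulRight_apply, mul_assoc]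

variable [Fintype α] {H L : Op (Fin d)}

theorem posSemidef_rounds [Nonempty ((Fin m → Fin d) × α)] (hH : H.IsHermitian)
    (ψ : Fin 2 → (Fin m → Fin d) × α → ℂ) (J : Fin m → Op ((Fin m → Fin d) × α)) (n K : ℕ) (ω : ℝ)
    {t : ℝ} (ht : 0 ≤ t) {X : Op (Fin n → (Fin m → Fin d) × α)} (hX : X.PosSemidef) :
    (rounds (tensorPower n (codeQEC ψ J)) (arrayGenerator n m α H L ω) t K X).PosSemidef := by
  obtain ⟨V, hV⟩ := codeQEC_eq_sum ψ J
  have hHn : (∑ j : Fin n, ∑ ℓ : Fin m, onBlock j (onProbe (α := α) ℓ H)).IsHermitian := by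
    rw [Matrix.IsHermitian]
    simp only [Matrix.conjTranspose_sum, conjTranspose_onBlock, conjTranspose_onProbe, hH.eq]
  have hs : (0 : ℝ) ≤ t / K := by positivity
  unfold rounds
  generalize t / (K : ℝ) = s at hs
  induction K with
  | zero => simpa using hX
  | succ K ih =>
    rw [pow_succ', Module.End.mul_apply, LinearMap.comp_apply]
    exact posSemidef_tensorPower hV (posSemidef_evolution hHn _ ω hs ih)

variable {ψ : Fin 2 → (Fin m → Fin d) × α → ℂ}
  (hψ : ∀ k k', star (ψ k) ⬝ᵥ ψ k' = if k = k' then 1 else 0)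
  (hJ : ∀ i : Fin m, codeProj ψ * onProbe i L * codeProj ψ = 0)
  (hJJ : ∀ i j : Fin m, codeProj ψ * (onProbe i L)ᴴ * onProbe j L * codeProj ψ =
    if i = j then codeProj ψ else 0)
  {q r : ℝ} (hP : codeProj ψ * (∑ ℓ : Fin m, onProbe ℓ H) * codeProj ψ =
    (q : ℂ) • codeProj ψ + (r : ℂ) • logicalZ ψ)

include hψ hJ hJJ hP

/-- The states of an array started in the logical GHZ state, together with their Fisher
informations, converge in the limit of fast error correction. -/
theorem array_limit [Nonempty ((Fin m → Fin d) × α)] (hH : H.IsHermitian) {n : ℕ} (hn : 1 ≤ n)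
    {t : ℝ} (ht : 0 ≤ t) (ω : ℝ) :
    Tendsto (fun K : ℕ => rounds (tensorPower n (codeQEC ψ fun ℓ : Fin m => onProbe ℓ L))
      (arrayGenerator n m α H L ω) t K (ketbra (ghz ψ n) (ghz ψ n))) atTop
      (𝓝 (phaseState (arrayCode ψ n) (2 * (n * (t * r))) ω)) ∧
    IsQFI (fun x : ℝ => phaseState (arrayCode ψ n) (2 * (n * (t * r))) x) ω
      ((2 * (n * (t * r))) ^ 2) ∧
    ∃ F : ℕ → ℝ, (∀ K, IsQFI (fun x : ℝ =>
      rounds (tensorPower n (codeQEC ψ fun ℓ : Fin m => onProbe ℓ L))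
        (arrayGenerator n m α H L x) t K (ketbra (ghz ψ n) (ghz ψ n))) ω (F K)) ∧
      Tendsto F atTop (𝓝 ((2 * (n * (t * r))) ^ 2)) := by
  set C := codeQEC ψ fun ℓ : Fin m => onProbe ℓ L with hC
  set Hb : Op ((Fin m → Fin d) × α) := ∑ ℓ : Fin m, onProbe ℓ H with hHb
  set Jb : Fin m → Op ((Fin m → Fin d) × α) := fun ℓ => onProbe ℓ L with hJb
  have hΨ := arrayCode_orthonormal hψ hn
  -- The holomorphic continuation in `ω` of the `K`-round state, available because the GHZ projector
  -- is a sum of tensor powers of logical matrix units and the rounds act blockwise.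
  set ρK : ℕ → ℂ → Op (Fin n → (Fin m → Fin d) × α) := fun K z => (1 / 2 : ℂ) • ∑ a, ∑ b,
    tprod fun _ : Fin n => complexRounds C Hb Jb t K z (ketbra (ψ a) (ψ b)) with hρK
  have hreal : ∀ (K : ℕ) (x : ℝ), ρK K x = rounds (tensorPower n C) (arrayGenerator n m α H L x) t K
      (ketbra (ghz ψ n) (ghz ψ n)) := fun K x => by
    simp only [hρK, ketbra_ghz, map_smul, map_sum, rounds_tprod, complexRounds_ofReal]
    rfl
  have hdiff : ∀ K, Differentiable ℂ (ρK K) := fun K => by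
    have h : Differentiable ℂ fun z => ∑ a, ∑ b, tprod fun _ : Fin n =>
        complexRounds C Hb Jb t K z (ketbra (ψ a) (ψ b)) :=
      Differentiable.fun_sum fun a _ => Differentiable.fun_sum fun b _ =>
        differentiable_tprod n (differentiable_complexRounds _ _ _ _ _ _)
    exact h.const_smul (1 / 2 : ℂ)
  have hpos : ∀ K (x : ℝ), (ρK K x).PosSemidef := fun K x => by
    rw [hreal]
    exact posSemidef_rounds hH ψ _ n K x ht (posSemidef_ketbra _)
  have hconv : ∃ E : ℝ, ∀ K : ℕ, 1 ≤ K → ∀ z : ℂ, ‖z - ω‖ ≤ 1 →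
      ‖ρK K z - phaseState (arrayCode ψ n) (2 * (n * (t * r))) z‖ ≤ E / K := by
    have hab : ∀ a b, ∃ E : ℝ, ∀ K : ℕ, 1 ≤ K → ∀ z ∈ Metric.closedBall (ω : ℂ) 1,
        ‖(tprod fun _ : Fin n => complexRounds C Hb Jb t K z (ketbra (ψ a) (ψ b))) -
          tprod fun _ : Fin n => Complex.exp (-Complex.I * z * (t * r * (zsign a - zsign b))) •
            ketbra (ψ a) (ψ b)‖ ≤ E / K := fun a b => by
      obtain ⟨E, hE⟩ := norm_complexRounds_sub_le hψ hJ hJJ hP t (‖(ω : ℂ)‖ + 1) a b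
      have hcont : Continuous fun z : ℂ =>
          Complex.exp (-Complex.I * z * (t * r * (zsign a - zsign b))) • ketbra (ψ a) (ψ b) := by
        fun_prop
      obtain ⟨M, hM⟩ := (isCompact_closedBall (ω : ℂ) 1).exists_bound_of_continuousOn
        hcont.continuousOn
      refine norm_tprod_sub_le n (fun K hK z hz => hE K hK z ?_) hM
      have h1 : ‖z - ω‖ ≤ 1 := by rw [← dist_eq_norm]; exact hz
      calc ‖z‖ = ‖ω + (z - ω)‖ := by rw [add_sub_cancel]
        _ ≤ _ := (norm_add_le _ _).trans (by gcongr)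
    choose E hE using hab
    refine ⟨∑ a, ∑ b, E a b, fun K hK z hz => ?_⟩
    have hz' : z ∈ Metric.closedBall (ω : ℂ) 1 := by
      rw [Metric.mem_closedBall, dist_eq_norm]; exact hz
    have e : phaseState (arrayCode ψ n) (2 * (n * (t * r))) z = (1 / 2 : ℂ) • ∑ a, ∑ b,
        tprod fun _ : Fin n => Complex.exp (-Complex.I * z * (t * r * (zsign a - zsign b))) •
          ketbra (ψ a) (ψ b) := by
      rw [phaseState_arrayCode]
      push_cast
      rfl
    rw [e, hρK]
    simp only [← smul_sub, ← Finset.sum_sub_distrib]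
    rw [norm_smul, Finset.sum_div]
    refine (mul_le_of_le_one_left (norm_nonneg _) (by norm_num)).trans ?_
    refine norm_sum_le_of_le _ fun a _ => ?_
    rw [Finset.sum_div]
    exact norm_sum_le_of_le _ fun b _ => hE a b K hK z hz'
  have hq := isQFI_phaseState hΨ (2 * (n * (t * r))) ω
  refine ⟨?_, hq, ?_⟩
  · obtain ⟨E, hE⟩ := hconv
    simp only [← hreal]
    rw [tendsto_iff_norm_sub_tendsto_zero]
    exact squeeze_zero' (Eventually.of_forall fun _ => norm_nonneg _)
      ((eventually_ge_atTop 1).mono fun K hK => hE K hK ω (by simp))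
      (tendsto_const_div_atTop_nhds_zero_nat E)
  · simp only [← hreal]
    refine exists_isQFI_tendsto hdiff (differentiable_phaseState _ _) hpos hconv
      (G := (((2 * (n * (t * r)) : ℝ) : ℂ) / 2) • logicalZ (arrayCode ψ n)) ?_
      (phaseState_covariant hΨ _ _) (trace_phaseState_mul_sq hΨ _ _) hq
    rw [Matrix.IsHermitian, Matrix.conjTranspose_smul, conjTranspose_logicalZ, star_div₀,
      RCLike.star_def, Complex.conj_ofReal, Complex.conj_ofNat]

end Array


/-! ### Two-probe marginals -/

section Marginals

theorem trace_twoProbeMarginal_mul {m d : ℕ} {α : Type} [Fintype α] (ℓ ℓ' : Fin m)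
    (X : Op ((Fin m → Fin d) × α))
    (M : Op (Fin d × Fin d)) :
    (twoProbeMarginal ℓ ℓ' X * M).trace = ∑ w, ∑ w', ∑ x,
      if ∀ k, k ≠ ℓ → k ≠ ℓ' → w k = w' k then
        X (w, x) (w', x) * M (w' ℓ, w' ℓ') (w ℓ, w ℓ') else 0 := by
  have e : (twoProbeMarginal ℓ ℓ' X * M).trace = ∑ pq : (Fin d × Fin d) × (Fin d × Fin d),
      ∑ s : (Fin m → Fin d) × (Fin m → Fin d) × α,
        (if pq = ((s.1 ℓ, s.1 ℓ'), (s.2.1 ℓ, s.2.1 ℓ')) then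
          if ∀ k, k ≠ ℓ → k ≠ ℓ' → s.1 k = s.2.1 k then
            X (s.1, s.2.2) (s.2.1, s.2.2) * M (s.2.1 ℓ, s.2.1 ℓ') (s.1 ℓ, s.1 ℓ') else 0
          else 0) := by
    rw [Fintype.sum_prod_type]
    simp only [Matrix.trace, Matrix.diag_apply, Matrix.mul_apply]
    refine Finset.sum_congr rfl fun p _ => Finset.sum_congr rfl fun q _ => ?_
    simp only [twoProbeMarginal, Matrix.of_apply, Fintype.sum_prod_type, Finset.sum_mul]
    refine Finset.sum_congr rfl fun w _ => Finset.sum_congr rfl fun w' _ =>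
      Finset.sum_congr rfl fun x _ => ?_
    by_cases h : (p, q) = ((w ℓ, w ℓ'), (w' ℓ, w' ℓ'))
    · rw [if_pos h]
      obtain ⟨rfl, rfl⟩ := Prod.ext_iff.1 h
      simp
    · rw [if_neg h, if_neg, zero_mul]
      rintro ⟨h1, h2, h3, h4, -⟩
      exact h (by rw [h1, h2, h3, h4])
  rw [e, Finset.sum_comm]
  simp only [Finset.sum_ite_eq', Finset.mem_univ, if_true,
    Fintype.sum_prod_type (α₁ := Fin m → Fin d)]

variable {m d : ℕ} {α : Type} [DecidableEq α]

theorem onProbe_one (ℓ : Fin m) : onProbe (α := α) ℓ (1 : Op (Fin d)) = 1 := by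
  ext p q
  simp only [onProbe, Matrix.of_apply, Matrix.one_apply]
  by_cases h : p = q
  · subst h; simp
  · rw [if_neg h]
    split_ifs with h1 h2
    · refine absurd (Prod.ext (funext fun k => ?_) h1.2) h
      by_cases hk : k = ℓ
      · rw [hk, h2]
      · exact h1.1 k hk
    · rfl
    · rfl

variable [Fintype α]

/-- Only one intermediate string contributes: the row string with its letter at `ℓ` already
replaced. -/
theorem onProbe_mul_onProbe_apply {ℓ ℓ' : Fin m} (hℓ : ℓ ≠ ℓ') (A B : Op (Fin d))
    (p q : (Fin m → Fin d) × α) :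
    (onProbe ℓ A * onProbe ℓ' B : Op ((Fin m → Fin d) × α)) p q =
      if (∀ k, k ≠ ℓ → k ≠ ℓ' → p.1 k = q.1 k) ∧ p.2 = q.2 then
        A (p.1 ℓ) (q.1 ℓ) * B (p.1 ℓ') (q.1 ℓ') else 0 := by
  rw [Matrix.mul_apply, Finset.sum_eq_single (Function.update p.1 ℓ (q.1 ℓ), p.2)]
  · simp only [onProbe, Matrix.of_apply, Function.update_self, and_true]
    rw [if_pos fun k hk => by rw [Function.update_of_ne hk], mul_ite, mul_zero,
      Function.update_of_ne hℓ.symm]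
    refine if_congr (and_congr ⟨fun h k hk hk' => ?_, fun h k hk => ?_⟩ Iff.rfl) rfl rfl
    · rw [← h k hk', Function.update_of_ne hk]
    · by_cases hkℓ : k = ℓ
      · rw [hkℓ, Function.update_self]
      · rw [Function.update_of_ne hkℓ, h k hkℓ hk]
  · intro r _ hr
    simp only [onProbe, Matrix.of_apply]
    split_ifs with h1 h2
    · refine absurd (?_ : r = (Function.update p.1 ℓ (q.1 ℓ), p.2)) hr
      refine Prod.ext (funext fun k => ?_) h1.2.symm
      change r.1 k = Function.update p.1 ℓ (q.1 ℓ) k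
      by_cases hkℓ : k = ℓ
      · rw [hkℓ, Function.update_self, h2.1 ℓ hℓ]
      · rw [Function.update_of_ne hkℓ, h1.1 k hkℓ]
    all_goals simp
  · simp

theorem onProbe_mul (ℓ : Fin m) (A B : Op (Fin d)) :
    onProbe (α := α) ℓ (A * B) = onProbe ℓ A * onProbe ℓ B := by
  ext p q
  rw [Matrix.mul_apply]
  simp only [onProbe, Matrix.of_apply]
  by_cases hpq : (∀ k, k ≠ ℓ → p.1 k = q.1 k) ∧ p.2 = q.2
  · rw [if_pos hpq, Matrix.mul_apply]
    refine Finset.sum_of_injOn (fun i => (Function.update p.1 ℓ i, p.2))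
      (fun i _ i' _ h => by simpa using congrFun (congrArg Prod.fst h) ℓ)
      (fun _ _ => Finset.mem_coe.2 (Finset.mem_univ _)) (fun r _ hr => ?_) fun i _ => ?_
    · split_ifs with h1 h2
      · refine absurd ⟨r.1 ℓ, Finset.mem_coe.2 (Finset.mem_univ _),
          Prod.ext (funext fun k => ?_) h1.2⟩ hr
        change Function.update p.1 ℓ (r.1 ℓ) k = r.1 k
        by_cases hkℓ : k = ℓ
        · rw [hkℓ, Function.update_self]
        · rw [Function.update_of_ne hkℓ, h1.1 k hkℓ]
      all_goals simp
    · simp only [Function.update_self, and_true]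
      rw [if_pos fun k hk => by rw [Function.update_of_ne hk],
        if_pos ⟨fun k hk => by rw [Function.update_of_ne hk, hpq.1 k hk], hpq.2⟩]
  · rw [if_neg hpq]
    refine (Finset.sum_eq_zero fun r _ => ?_).symm
    split_ifs with h1 h2
    · exact absurd ⟨fun k hk => (h1.1 k hk).trans (h2.1 k hk), h1.2.trans h2.2⟩ hpq
    all_goals simp

/-- Expectation values of two-probe operators are determined by the two-probe marginals. -/
theorem dotProduct_onProbe_mul_onProbe {ℓ ℓ' : Fin m} (hℓ : ℓ ≠ ℓ') (A B : Op (Fin d))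
    (ψ φ : (Fin m → Fin d) × α → ℂ) :
    star ψ ⬝ᵥ (onProbe ℓ A * onProbe ℓ' B) *ᵥ φ =
      (twoProbeMarginal ℓ ℓ' (ketbra φ ψ) * (A ⊗ₖ B)).trace := by
  rw [trace_twoProbeMarginal_mul]
  simp only [dotProduct, Matrix.mulVec, onProbe_mul_onProbe_apply hℓ, Fintype.sum_prod_type,
    Finset.mul_sum]
  have e : ∀ (w' : Fin m → Fin d) (x' : α) (w : Fin m → Fin d), ∑ x : α, star ψ (w', x') *
      ((if (∀ k, k ≠ ℓ → k ≠ ℓ' → w' k = w k) ∧ x' = x then A (w' ℓ) (w ℓ) * B (w' ℓ') (w ℓ')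
        else 0) * φ (w, x)) = if ∀ k, k ≠ ℓ → k ≠ ℓ' → w k = w' k then
          ketbra φ ψ (w, x') (w', x') * (A ⊗ₖ B) (w' ℓ, w' ℓ') (w ℓ, w ℓ') else 0 := by
    intro w' x' w
    rw [Finset.sum_eq_single x']
    · simp only [and_true, eq_comm (a := w' _), Matrix.kroneckerMap_apply, ketbra,
        Matrix.vecMulVec_apply, ite_mul, zero_mul, mul_ite, mul_zero]
      refine if_congr Iff.rfl ?_ rfl
      ring
    · intro x _ hx
      rw [if_neg fun h => hx h.2.symm]
      simp
    · simp
  simp only [e]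
  rw [Finset.sum_congr rfl fun w' _ => Finset.sum_comm, Finset.sum_comm]

theorem dotProduct_onProbe_mul_onProbe_of_condition {L : Op (Fin d)} {ρ Q : Fin 2 → Op (Fin d)}
    {ψ : Fin 2 → (Fin m → Fin d) × α → ℂ} (h : MultiProbeCondition L ρ Q ψ) {ℓ ℓ' : Fin m}
    (hℓ : ℓ ≠ ℓ') (A B : Op (Fin d)) (k k' : Fin 2) :
    star (ψ k) ⬝ᵥ (onProbe ℓ A * onProbe ℓ' B) *ᵥ ψ k' =
      if k = k' then (ρ k * A).trace * (ρ k * B).trace - (Q k * A).trace * (Q k * B).trace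
      else 0 := by
  rw [dotProduct_onProbe_mul_onProbe hℓ, h.2 k' k ℓ ℓ' hℓ]
  by_cases hk : k = k'
  · subst hk
    rw [if_pos rfl, if_pos rfl, sub_mul, ← Matrix.mul_kronecker_mul, ← Matrix.mul_kronecker_mul,
      Matrix.trace_sub, Matrix.trace_kronecker, Matrix.trace_kronecker]
  · rw [if_neg hk, if_neg (Ne.symm hk), zero_mul, Matrix.trace_zero]

/-- Matrix elements of single-probe operators. -/
theorem dotProduct_onProbe_of_condition [Nontrivial (Fin m)] {L : Op (Fin d)}
    {ρ Q : Fin 2 → Op (Fin d)} {ψ : Fin 2 → (Fin m → Fin d) × α → ℂ}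
    (h : MultiProbeCondition L ρ Q ψ) (hρ : ∀ k, (ρ k).trace = 1) (ℓ : Fin m) (A : Op (Fin d))
    (k k' : Fin 2) :
    star (ψ k) ⬝ᵥ onProbe ℓ A *ᵥ ψ k' = if k = k' then (ρ k * A).trace else 0 := by
  obtain ⟨ℓ', hℓ⟩ := exists_ne ℓ
  -- A second probe carrying the identity reduces to the two-probe formula; there `Tr Q_k = 0`
  -- removes the correction term.
  have := dotProduct_onProbe_mul_onProbe_of_condition h hℓ.symm A 1 k k'
  rw [onProbe_one, mul_one, mul_one, mul_one, hρ, (h.1 k).2.1, mul_zero, sub_zero, mul_one] at this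
  exact this

/-- The words of a code, tagged by ancilla states, in uniform superposition: the two-probe
marginals count pairs of words. -/
theorem twoProbeMarginal_tagged (ℓ ℓ' : Fin m) (c : (Fin m → Fin d) → α)
    (A B : Finset (Fin m → Fin d)) (a b : ℂ) (p q : Fin d × Fin d) :
    twoProbeMarginal ℓ ℓ' (ketbra (a • ∑ w ∈ A, Pi.single (w, c w) 1 :
      (Fin m → Fin d) × α → ℂ) (b • ∑ w ∈ B, Pi.single (w, c w) 1)) p q = a * star b *
      ((∑ w ∈ A, ∑ w' ∈ B, if c w = c w' ∧ w ℓ = p.1 ∧ w ℓ' = p.2 ∧ w' ℓ = q.1 ∧ w' ℓ' = q.2 ∧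
        (∀ k, k ≠ ℓ → k ≠ ℓ' → w k = w' k) then 1 else 0 : ℕ) : ℂ) := by
  have hs : ∀ (A : Finset (Fin m → Fin d)) (w : Fin m → Fin d) (x : α),
      (∑ v ∈ A, Pi.single (v, c v) 1 : (Fin m → Fin d) × α → ℂ) (w, x) = if w ∈ A ∧ c w = x then 1 else 0 := by
    intro A w x
    rw [Finset.sum_apply]
    simp only [Pi.single_apply, Prod.mk.injEq, ite_and]
    rw [Finset.sum_ite_eq]
    simp only [eq_comm]
  simp only [twoProbeMarginal, Matrix.of_apply, ketbra, Matrix.vecMulVec_apply, Pi.smul_apply,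
    Pi.star_apply, smul_eq_mul, hs]
  push_cast
  rw [Finset.mul_sum, ← Finset.sum_subset (Finset.subset_univ A)]
  · refine Finset.sum_congr rfl fun w hw => ?_
    rw [Finset.mul_sum, ← Finset.sum_subset (Finset.subset_univ B)]
    · refine Finset.sum_congr rfl fun w' hw' => ?_
      rw [Finset.sum_eq_single (c w)]
      · simp only [hw, hw', true_and, if_true, eq_comm (a := c w')]
        by_cases hc : c w = c w'
        · simp [hc]
        · simp [hc]
      · intro x _ hx
        simp [Ne.symm hx]
      · simp
    · intro w' _ hw'
      simp [hw']
  · intro w _ hw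
    simp [hw]

end Marginals


/-! ### The Lindblad span of the qutrit model -/

theorem trace_qutritRho_sub_mul {X : Op (Fin 3)} (hX : X ∈ lindbladSpan qutritL) :
    ((qutritRho 0 - qutritRho 1) * X).trace = 0 := by
  induction hX using Submodule.span_induction with
  | mem X hX =>
    rcases hX with rfl | rfl | rfl | rfl <;>
      simp [qutritRho, qutritL, Matrix.trace, Matrix.mul_apply, Fin.sum_univ_three,
        Matrix.diagonal] <;> norm_num
  | zero => simp
  | add X Y _ _ hX hY => rw [mul_add, Matrix.trace_add, hX, hY, add_zero]
  | smul c X _ hX => rw [Matrix.mul_smul, Matrix.trace_smul, hX, smul_zero]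

theorem trace_qutritRho_sub_mul_H : ((qutritRho 0 - qutritRho 1) * qutritH).trace = 1 := by
  simp [qutritRho, qutritH, Matrix.trace, Matrix.mul_apply, Fin.sum_univ_three, Matrix.diagonal]

theorem half_one_mem_lindbladSpan {I : Type} [Fintype I] [DecidableEq I] (L : Op I) :
    (1 / 2 : ℂ) • (1 : Op I) ∈ lindbladSpan L := by
  have : (1 / 2 : ℂ) • (1 : Op I) = (1 / 2 : ℝ) • 1 := by
    ext i j
    simp [Complex.real_smul]
  rw [this]
  exact Submodule.smul_mem _ _ (Submodule.subset_span (by simp))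

theorem qutritS_mem_lindbladSpan : qutritS ∈ lindbladSpan qutritL :=
  Submodule.sub_mem _ (half_one_mem_lindbladSpan _) (Submodule.subset_span (by simp))

theorem qutritH_sub_qutritS :
    qutritH - qutritS = Matrix.diagonal ![1 / 2, -1 / 2, 1 / 2] := by
  ext i j
  fin_cases i <;> fin_cases j <;>
    simp [qutritH, qutritS, qutritL, Matrix.mul_apply, Fin.sum_univ_three] <;> norm_num

theorem norm_qutritH_sub_qutritS : ‖qutritH - qutritS‖ = 1 / 2 := by
  rw [qutritH_sub_qutritS, Matrix.l2_opNorm_diagonal]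
  refine le_antisymm ((pi_norm_le_iff_of_nonneg (by norm_num)).2 fun i => ?_) ?_
  · fin_cases i <;> simp
  · simpa using norm_le_pi_norm (![1 / 2, -1 / 2, 1 / 2] : Fin 3 → ℂ) 0

/-- Duality with the diagonal certificate `ρ₀ - ρ₁`: only diagonal entries of `H - X` enter, with
weights `1/2, -1, 1/2` of total absolute value `2`. -/
theorem half_le_norm_qutritH_sub {X : Op (Fin 3)} (hX : X ∈ lindbladSpan qutritL) :
    1 / 2 ≤ ‖qutritH - X‖ := by
  have h : ((qutritRho 0 - qutritRho 1) * (qutritH - X)).trace = 1 := by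
    rw [mul_sub, Matrix.trace_sub, trace_qutritRho_sub_mul hX, trace_qutritRho_sub_mul_H, sub_zero]
  generalize qutritH - X = A at h ⊢
  have e : (1 / 2 : ℂ) * A 0 0 - A 1 1 + (1 / 2 : ℂ) * A 2 2 = 1 := by
    refine Eq.trans ?_ h
    simp [qutritRho, Matrix.trace, Matrix.mul_apply, Fin.sum_univ_three, Matrix.diagonal]
    ring
  have h0 := norm_entry_le A 0 0
  have h1 := norm_entry_le A 1 1
  have h2 := norm_entry_le A 2 2
  have : ‖(1 / 2 : ℂ) * A 0 0 - A 1 1 + (1 / 2 : ℂ) * A 2 2‖ ≤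
      1 / 2 * ‖A 0 0‖ + ‖A 1 1‖ + 1 / 2 * ‖A 2 2‖ := by
    refine (norm_add_le _ _).trans (add_le_add ((norm_sub_le _ _).trans ?_) ?_) <;> simp
  rw [e, norm_one] at this
  linarith

theorem qutritH_notMem_lindbladSpan : qutritH ∉ lindbladSpan qutritL := fun h => by
  have := half_le_norm_qutritH_sub h
  rw [sub_self, norm_zero] at this
  norm_num at this

theorem isLeast_norm_qutritH_sub : IsLeast ((fun X : Op (Fin 3) => ‖qutritH - X‖) ''
    (lindbladSpan qutritL : Set (Op (Fin 3)))) ‖qutritH - qutritS‖ := by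
  refine ⟨⟨_, qutritS_mem_lindbladSpan, rfl⟩, ?_⟩
  rintro _ ⟨X, hX, rfl⟩
  exact norm_qutritH_sub_qutritS.trans_le (half_le_norm_qutritH_sub hX)

theorem lindbladDist_qutrit : lindbladDist qutritH qutritL = ‖qutritH - qutritS‖ :=
  isLeast_norm_qutritH_sub.csInf_eq

/-! ### The optimal pair of density operators -/

theorem isDensity_qutritRho (k : Fin 2) : IsDensity (qutritRho k) := by
  fin_cases k
  · refine ⟨Matrix.PosSemidef.diagonal fun i => ?_, ?_⟩
    · fin_cases i <;> simp
    · simp [qutritRho, Matrix.trace, Fin.sum_univ_three]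
      norm_num
  · refine ⟨Matrix.PosSemidef.diagonal fun i => ?_, ?_⟩
    · fin_cases i <;> simp
    · simp [qutritRho, Matrix.trace, Fin.sum_univ_three]

theorem apply_eq_zero_of_diag_eq_zero {I : Type} [Fintype I] [DecidableEq I] {A : Op I}
    (hA : A.PosSemidef) {j : I} (hj : A j j = 0) (i : I) : A i j = 0 ∧ A j i = 0 := by
  have h : A *ᵥ Pi.single j 1 = 0 := (hA.dotProduct_mulVec_zero_iff _).1 (by
    rw [Matrix.mulVec_single_one, Pi.star_single, star_one, single_dotProduct]
    simpa using hj)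
  have h1 : A i j = 0 := by simpa using congrFun h i
  exact ⟨h1, by rw [← hA.isHermitian.apply, h1, star_zero]⟩

/-- Complementary slackness. Pairing with the diagonal `H - S` and using both traces gives `σ₁(1,1)
- σ₀(1,1) = 1`, which forces the extreme values `1` and `0`. Positivity then kills the rows and
columns of the vanishing diagonal entries. `L†L` fixes the remaining populations of `σ₀`, and the
two Hermitian parts of `L` its remaining coherence. -/
theorem eq_qutritRho {σ : Fin 2 → Op (Fin 3)} (hσ : ∀ k, IsDensity (σ k))
    (hH : ((σ 0 - σ 1) * qutritH).trace = 1)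
    (hX : ∀ X ∈ lindbladSpan qutritL, ((σ 0 - σ 1) * X).trace = 0) : σ = qutritRho := by
  have hS := hX _ qutritS_mem_lindbladSpan
  have hd : ((σ 0 - σ 1) * (qutritH - qutritS)).trace = 1 := by
    rw [mul_sub, Matrix.trace_sub, hH, hS, sub_zero]
  have hp := hX (qutritL + qutritLᴴ) (Submodule.subset_span (by simp))
  have hm := hX (Complex.I • (qutritL - qutritLᴴ)) (Submodule.subset_span (by simp))
  have hq := hX (qutritLᴴ * qutritL) (Submodule.subset_span (by simp))
  have t0 := (hσ 0).2
  have t1 := (hσ 1).2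
  rw [qutritH_sub_qutritS] at hd
  simp only [Matrix.trace, Matrix.diag_apply, Fin.sum_univ_three] at t0 t1
  simp [Matrix.trace, Matrix.mul_apply, Fin.sum_univ_three, Matrix.diagonal] at hd
  have p0 := fun i => Complex.nonneg_iff.1 ((hσ 0).1.diag_nonneg (i := i))
  have p1 := fun i => Complex.nonneg_iff.1 ((hσ 1).1.diag_nonneg (i := i))
  have hreal : (σ 1 1 1).re - (σ 0 1 1).re = 1 := by
    have e : σ 1 1 1 - σ 0 1 1 = 1 := by linear_combination hd - t0 / 2 + t1 / 2
    simpa using congrArg Complex.re e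
  have t0r := congrArg Complex.re t0
  have t1r := congrArg Complex.re t1
  simp only [Complex.add_re, Complex.one_re] at t0r t1r
  have z : ∀ k i, (σ k i i).re = 0 → σ k i i = 0 := fun k i h => by
    refine Complex.ext h ?_
    fin_cases k
    · exact (p0 i).2.symm
    · exact (p1 i).2.symm
  have a1 := z 0 1 (by linarith [(p0 1).1, (p1 0).1, (p1 2).1])
  have b0 := z 1 0 (by linarith [(p0 1).1, (p1 0).1, (p1 2).1])
  have b2 := z 1 2 (by linarith [(p0 1).1, (p1 0).1, (p1 2).1])
  have r01 := apply_eq_zero_of_diag_eq_zero (hσ 0).1 a1 0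
  have r21 := apply_eq_zero_of_diag_eq_zero (hσ 0).1 a1 2
  have s10 := apply_eq_zero_of_diag_eq_zero (hσ 1).1 b0 1
  have s20 := apply_eq_zero_of_diag_eq_zero (hσ 1).1 b0 2
  have s12 := apply_eq_zero_of_diag_eq_zero (hσ 1).1 b2 1
  have b1 : σ 1 1 1 = 1 := by linear_combination t1 - b0 - b2
  simp [qutritL, Matrix.trace, Matrix.mul_apply, Fin.sum_univ_three, r01, r21, s10, s20, s12,
    a1, b0, b1, b2] at hp hm hq
  have a2 : σ 0 2 2 = 1 / 2 := by linear_combination hq / 2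
  have a0 : σ 0 0 0 = 1 / 2 := by linear_combination t0 - a1 - a2
  have e02 : σ 0 0 2 = 0 := by
    linear_combination hp / 2 + Complex.I / 2 * hm + (σ 0 0 2 - σ 0 2 0) / 2 * Complex.I_mul_I
  have e20 : σ 0 2 0 = 0 := by linear_combination hp - e02
  ext k i j
  fin_cases k <;> fin_cases i <;> fin_cases j <;>
    simp [qutritRho, a0, a1, a2, b0, b1, b2, r01, r21, s10, s20, s12, e02, e20]


/-! ### The code words -/

/-- The ancilla state attached to a string. -/
def tag (w : Fin 4 → Fin 3) : Fin 3 :=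
  if w 0 = w 1 then 0 else if w 0 = w 2 then 1 else 2

theorem W₀_eq : W₀ = {![0, 0, 2, 2], ![2, 2, 0, 0], ![0, 2, 0, 2], ![2, 0, 2, 0], ![0, 2, 2, 0],
    ![2, 0, 0, 2]} := by
  decide +kernel

theorem code41_eq_taggedCode : code41 = taggedCode tag := by
  rw [taggedCode, W₀_eq, Finset.sum_insert (by decide), Finset.sum_insert (by decide),
    Finset.sum_insert (by decide), Finset.sum_insert (by decide), Finset.sum_insert (by decide),
    Finset.sum_singleton, code41]
  have h : tag ![0, 0, 2, 2] = 0 ∧ tag ![2, 2, 0, 0] = 0 ∧ tag ![0, 2, 0, 2] = 1 ∧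
      tag ![2, 0, 2, 0] = 1 ∧ tag ![0, 2, 2, 0] = 2 ∧ tag ![2, 0, 0, 2] = 2 ∧
      tag ![1, 1, 1, 1] = 0 := by decide
  obtain ⟨h1, h2, h3, h4, h5, h6, h7⟩ := h
  simp only [h1, h2, h3, h4, h5, h6, h7, ket, add_assoc]

/-- The strings in the superposition of each code word. -/
def words : Fin 2 → Finset (Fin 4 → Fin 3) := ![W₀, {![1, 1, 1, 1]}]

/-- The amplitude of each string in a code word. -/
noncomputable def amplitude : Fin 2 → ℂ := ![1 / (Real.sqrt 6 : ℂ), 1]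

theorem taggedCode_apply {D : ℕ} (c : (Fin 4 → Fin 3) → Fin D) (k : Fin 2) :
    taggedCode c k = amplitude k • ∑ w ∈ words k, Pi.single (w, c w) 1 := by
  fin_cases k
  · rfl
  · simp [taggedCode, amplitude, words]

/-- The number of pairs of strings contributing to an entry of a two-probe marginal. -/
def pairCount {D : ℕ} (c : (Fin 4 → Fin 3) → Fin D) (A B : Finset (Fin 4 → Fin 3)) (ℓ ℓ' : Fin 4)
    (p q : Fin 3 × Fin 3) : ℕ :=
  ∑ w ∈ A, ∑ w' ∈ B, if c w = c w' ∧ w ℓ = p.1 ∧ w ℓ' = p.2 ∧ w' ℓ = q.1 ∧ w' ℓ' = q.2 ∧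
    (∀ k, k ≠ ℓ → k ≠ ℓ' → w k = w' k) then 1 else 0

theorem twoProbeMarginal_taggedCode {D : ℕ} (c : (Fin 4 → Fin 3) → Fin D) (k k' : Fin 2)
    (ℓ ℓ' : Fin 4) (p q : Fin 3 × Fin 3) :
    twoProbeMarginal ℓ ℓ' (ketbra (taggedCode c k) (taggedCode c k')) p q =
      amplitude k * star (amplitude k') * (pairCount c (words k) (words k') ℓ ℓ' p q : ℂ) := by
  rw [taggedCode_apply, taggedCode_apply, twoProbeMarginal_tagged]
  rfl

/-- Distinct strings of `W₀` that agree off two sites differ by a swap and so carry different tags;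
hence no coherences. Fixing equal letters at two sites determines the string, fixing `0` and `2`
leaves two choices. -/
theorem pairCount_tag_W₀ : ∀ ℓ ℓ' : Fin 4, ℓ ≠ ℓ' → ∀ p q : Fin 3 × Fin 3,
    pairCount tag W₀ W₀ ℓ ℓ' p q = if p = q then
      if p.1 = 1 ∨ p.2 = 1 then 0 else if p.1 = p.2 then 1 else 2 else 0 := by
  rw [W₀_eq]
  decide +kernel

/-- A string without the letter `1` differs from `1111` at all four sites, more than two probes can
account for. -/
theorem pairCount_tag_words : ∀ k k' : Fin 2, k ≠ k' → ∀ ℓ ℓ' : Fin 4, ℓ ≠ ℓ' →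
    ∀ p q : Fin 3 × Fin 3, pairCount tag (words k) (words k') ℓ ℓ' p q = 0 := by
  rw [words, W₀_eq]
  decide +kernel

theorem pairCount_tag_one : ∀ ℓ ℓ' : Fin 4, ℓ ≠ ℓ' → ∀ p q : Fin 3 × Fin 3,
    pairCount tag {![1, 1, 1, 1]} {![1, 1, 1, 1]} ℓ ℓ' p q =
      if p = q ∧ p.1 = 1 ∧ p.2 = 1 then 1 else 0 := by
  decide +kernel

theorem amplitude_zero_mul_star : amplitude 0 * star (amplitude 0) = 1 / 6 := by
  have h : ((Real.sqrt 6 : ℝ) : ℂ) * (Real.sqrt 6 : ℝ) = 6 := by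
    exact_mod_cast Real.mul_self_sqrt (by norm_num : (0 : ℝ) ≤ 6)
  simp only [amplitude, Matrix.cons_val_zero, RCLike.star_def, map_div₀, map_one,
    Complex.conj_ofReal]
  rw [div_mul_div_comm, h, one_mul]

theorem qutritQ_condition (k : Fin 2) : (qutritQ k).IsHermitian ∧ (qutritQ k).trace = 0 ∧
    (qutritQ k * qutritL).trace = 0 := by
  fin_cases k
  · refine ⟨?_, ?_, ?_⟩
    · ext i j
      fin_cases i <;> fin_cases j <;> simp [qutritQ]
    · simp [qutritQ, Matrix.trace, Fin.sum_univ_three]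
    · simp [qutritQ, qutritL, Matrix.trace, Matrix.mul_apply, Fin.sum_univ_three, Matrix.diagonal]
  · simp [qutritQ]

/-- The counts `1` and `2` out of six give `1/6 = 1/4 - 1/12` for equal letters and `1/3 = 1/4 +
1/12` for different ones. The deviation from `ρ₀ ⊗ ρ₀` is therefore a product, which dictates `Q₀`
and its normalisation `1/√12`. -/
theorem multiProbeCondition_code41 :
    MultiProbeCondition qutritL qutritRho qutritQ code41 := by
  refine ⟨qutritQ_condition, fun k k' ℓ ℓ' hℓ => ?_⟩
  rw [code41_eq_taggedCode]
  ext p q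
  rw [twoProbeMarginal_taggedCode]
  by_cases hk : k = k'
  · subst hk
    rw [if_pos rfl, Matrix.sub_apply]
    fin_cases k
    · have h : ((Real.sqrt 12 : ℝ) : ℂ)⁻¹ * ((Real.sqrt 12 : ℝ) : ℂ)⁻¹ = 1 / 12 := by
        rw [← mul_inv, one_div]
        congr 1
        exact_mod_cast Real.mul_self_sqrt (by norm_num : (0 : ℝ) ≤ 12)
      change amplitude 0 * star (amplitude 0) * (pairCount tag W₀ W₀ ℓ ℓ' p q : ℂ) =
        (Matrix.diagonal ![1 / 2, 0, 1 / 2] ⊗ₖ Matrix.diagonal ![1 / 2, 0, 1 / 2]) p q -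
        (((1 / (Real.sqrt 12 : ℂ)) • Matrix.diagonal ![1, 0, -1]) ⊗ₖ
          ((1 / (Real.sqrt 12 : ℂ)) • Matrix.diagonal ![1, 0, -1])) p q
      rw [amplitude_zero_mul_star, pairCount_tag_W₀ ℓ ℓ' hℓ p q, Matrix.smul_kronecker,
        Matrix.kronecker_smul, smul_smul, one_div (Real.sqrt 12 : ℂ), h,
        Matrix.diagonal_kronecker_diagonal, Matrix.diagonal_kronecker_diagonal,
        Matrix.smul_apply, Matrix.diagonal_apply, Matrix.diagonal_apply]
      by_cases hpq : p = q
      · simp only [if_pos hpq]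
        clear hpq
        obtain ⟨p1, p2⟩ := p
        fin_cases p1 <;> fin_cases p2 <;> norm_num
      · simp [hpq]
    · change (1 : ℂ) * star 1 * (pairCount tag {![1, 1, 1, 1]} {![1, 1, 1, 1]} ℓ ℓ' p q : ℂ) =
        (Matrix.diagonal ![0, 1, 0] ⊗ₖ Matrix.diagonal ![0, 1, 0]) p q -
        ((0 : Op (Fin 3)) ⊗ₖ (0 : Op (Fin 3))) p q
      rw [pairCount_tag_one ℓ ℓ' hℓ p q, Matrix.diagonal_kronecker_diagonal,
        Matrix.diagonal_apply, Matrix.zero_kronecker]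
      by_cases hpq : p = q
      · simp only [hpq, true_and, if_true]
        clear hpq
        obtain ⟨q1, q2⟩ := q
        fin_cases q1 <;> fin_cases q2 <;> simp
      · simp [hpq]
  · rw [if_neg hk, pairCount_tag_words k k' hk ℓ ℓ' hℓ, Nat.cast_zero, mul_zero]
    rfl


/-! ### Error-correction conditions and the projected Hamiltonian of the code -/

theorem trace_qutritRho (k : Fin 2) : (qutritRho k).trace = 1 := (isDensity_qutritRho k).2

theorem orthonormal_code41 (k k' : Fin 2) :
    star (code41 k) ⬝ᵥ code41 k' = if k = k' then 1 else 0 := by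
  have h := dotProduct_onProbe_of_condition multiProbeCondition_code41 trace_qutritRho 0 1 k k'
  rwa [onProbe_one, Matrix.one_mulVec, mul_one, trace_qutritRho] at h

theorem codeProj_onProbe_codeProj (ℓ : Fin 4) (A : Op (Fin 3)) :
    codeProj code41 * onProbe ℓ A * codeProj code41 =
      ∑ k, (qutritRho k * A).trace • ketbra (code41 k) (code41 k) := by
  rw [codeProj_mul_mul_codeProj]
  refine Finset.sum_congr rfl fun k _ => ?_
  simp only [dotProduct_onProbe_of_condition multiProbeCondition_code41 trace_qutritRho,
    ite_smul, zero_smul, Finset.sum_ite_eq, Finset.mem_univ, if_true]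

theorem codeProj_onProbe_L_codeProj (ℓ : Fin 4) :
    codeProj code41 * onProbe ℓ qutritL * codeProj code41 = 0 := by
  rw [codeProj_onProbe_codeProj]
  refine Finset.sum_eq_zero fun k _ => ?_
  have : (qutritRho k * qutritL).trace = 0 := by
    fin_cases k <;>
      simp [qutritRho, qutritL, Matrix.trace, Matrix.mul_apply, Fin.sum_univ_three,
        Matrix.diagonal]
  rw [this, zero_smul]

theorem codeProj_sum_onProbe_H_codeProj :
    codeProj code41 * (∑ ℓ, onProbe ℓ qutritH) * codeProj code41 =
      ((-2 : ℝ) : ℂ) • codeProj code41 + ((2 : ℝ) : ℂ) • logicalZ code41 := by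
  -- The logical energies per probe are `0` and `-1`; over four probes the projected Hamiltonian is
  -- `-4 |1_L⟩⟨1_L| = -2P + 2Z_L`.
  have h0 : (qutritRho 0 * qutritH).trace = 0 := by
    simp [qutritRho, qutritH, Matrix.trace, Matrix.mul_apply, Fin.sum_univ_three, Matrix.diagonal]
  have h1 : (qutritRho 1 * qutritH).trace = -1 := by
    simp [qutritRho, qutritH, Matrix.trace, Matrix.mul_apply, Fin.sum_univ_three, Matrix.diagonal]
  rw [Finset.mul_sum, Finset.sum_mul,
    Finset.sum_congr rfl fun ℓ _ => codeProj_onProbe_codeProj ℓ qutritH]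
  simp only [Fin.sum_univ_two, h0, h1, Finset.sum_const,
    Finset.card_univ, Fintype.card_fin, codeProj, logicalZ]
  push_cast
  module

/-- On one probe both code words have jump rate `Tr ρ_k L†L = 1`, so a jump reveals nothing about
the logical state. On two probes the matrix element splits into products containing `Tr ρ_k L` or
`Tr Q_k L`, both zero. -/
theorem codeProj_onProbe_L_conjTranspose_mul_codeProj (i j : Fin 4) :
    codeProj code41 * (onProbe i qutritL)ᴴ * onProbe j qutritL * codeProj code41 =
      if i = j then codeProj code41 else 0 := by
  rw [mul_assoc (codeProj code41), conjTranspose_onProbe]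
  by_cases hij : i = j
  · subst hij
    have h : ∀ k, (qutritRho k * (qutritLᴴ * qutritL)).trace = 1 := fun k => by
      fin_cases k <;>
        simp [qutritRho, qutritL, Matrix.trace, Matrix.mul_apply, Fin.sum_univ_three,
          Matrix.diagonal]
      norm_num
    rw [if_pos rfl, ← onProbe_mul, codeProj_onProbe_codeProj]
    simp only [h, one_smul, Fin.sum_univ_two, codeProj]
  · rw [if_neg hij, codeProj_mul_mul_codeProj]
    refine Finset.sum_eq_zero fun k _ => Finset.sum_eq_zero fun k' _ => ?_
    have h : (qutritRho k * qutritL).trace = 0 := by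
      fin_cases k <;>
        simp [qutritRho, qutritL, Matrix.trace, Matrix.mul_apply, Fin.sum_univ_three,
          Matrix.diagonal]
    rw [dotProduct_onProbe_mul_onProbe_of_condition multiProbeCondition_code41 hij, h,
      (qutritQ_condition k).2.2, mul_zero, mul_zero, sub_zero, ite_self, zero_smul]

theorem isHermitian_qutritH : qutritH.IsHermitian := by
  ext i j
  fin_cases i <;> fin_cases j <;> simp [qutritH]

/-! ### The ancilla dimension -/

theorem tag_ne_of_swap : ∀ w ∈ W₀, ∀ ℓ ℓ' : Fin 4, w ℓ ≠ w ℓ' →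
    tag w ≠ tag (w ∘ Equiv.swap ℓ ℓ') := by
  rw [W₀_eq]
  decide +kernel

theorem codeString_eq_swap : ∀ w ∈ insert ![1, 1, 1, 1] W₀, ∀ w' ∈ insert ![1, 1, 1, 1] W₀,
    ∀ ℓ ℓ' : Fin 4, w ≠ w' → (∀ k, k ≠ ℓ → k ≠ ℓ' → w k = w' k) →
      w ℓ ≠ w ℓ' ∧ w' = w ∘ Equiv.swap ℓ ℓ' := by
  rw [W₀_eq]
  decide +kernel

theorem eq_zero_or_two_of_ne : ∀ w ∈ insert ![1, 1, 1, 1] W₀, ∀ ℓ ℓ' : Fin 4, w ℓ ≠ w ℓ' →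
    w ∈ W₀ ∧ (w ℓ = 0 ∧ w ℓ' = 2 ∨ w ℓ = 2 ∧ w ℓ' = 0) := by
  rw [W₀_eq]
  decide +kernel

/-- A two-probe operator alters at most two sites, and code strings so related differ by a swap,
whatever the operator is. Conversely `L† ⊗ L` realises every such swap. -/
theorem conflictGraph_adj_iff (w w' : CodeString) : conflictGraph.Adj w w' ↔
    ∃ ℓ ℓ' : Fin 4, w.1 ℓ ≠ w.1 ℓ' ∧ w'.1 = w.1 ∘ Equiv.swap ℓ ℓ' := by
  have hm : ∀ w : CodeString, w.1 ∈ insert ![1, 1, 1, 1] W₀ := fun w =>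
    Finset.mem_insert.2 w.2.symm
  rw [conflictGraph, SimpleGraph.fromRel_adj]
  constructor
  · rintro ⟨hne, ⟨B, -, ℓ, ℓ', -, h⟩ | ⟨B, -, ℓ, ℓ', -, h⟩⟩ <;>
    refine ⟨ℓ, ℓ', codeString_eq_swap _ (hm w) _ (hm w') ℓ ℓ' (fun e => hne (Subtype.ext e)) ?_⟩
      <;> by_contra hc <;> refine h ?_
    · rw [onTwoProbes, Matrix.of_apply, if_neg hc]
    · rw [onTwoProbes, Matrix.of_apply, if_neg fun h' => hc fun k hk hk' => (h' k hk hk').symm]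
  -- `L†` must act at the site holding `2` and `L` at the one holding `0`: the entries `L†(2,0)` and
  -- `L(0,2)` are nonzero, whereas the reversed ones vanish.
  · have key : ∀ ℓ ℓ' : Fin 4, w.1 ℓ = 2 → w.1 ℓ' = 0 → w'.1 = w.1 ∘ Equiv.swap ℓ ℓ' →
        ∃ B ∈ twoProbeSpan qutritL, ∃ ℓ ℓ' : Fin 4, ℓ ≠ ℓ' ∧ onTwoProbes ℓ ℓ' B w.1 w'.1 ≠ 0 := by
      intro ℓ ℓ' h2 h0 h
      refine ⟨qutritLᴴ ⊗ₖ qutritL, Submodule.subset_span (Or.inr rfl), ℓ, ℓ', ?_, ?_⟩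
      · rintro rfl
        rw [h2] at h0
        exact absurd h0 (by decide)
      · rw [onTwoProbes, Matrix.of_apply, if_pos, h]
        · simp [h2, h0, qutritL]
        · intro k hk hk'
          rw [h, Function.comp_apply, Equiv.swap_apply_of_ne_of_ne hk hk']
    rintro ⟨ℓ, ℓ', hne, h⟩
    refine ⟨?_, Or.inl ?_⟩
    · rintro rfl
      exact hne (by simpa using congrFun h ℓ)
    · rcases (eq_zero_or_two_of_ne _ (hm w) ℓ ℓ' hne).2 with ⟨h0, h2⟩ | ⟨h2, h0⟩
      · exact key ℓ' ℓ h2 h0 (by rw [Equiv.swap_comm, h])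
      · exact key ℓ ℓ' h2 h0 h

/-- Three strings that pairwise arise from each other by a swap. -/
def triangle : Fin 3 → Fin 4 → Fin 3 := ![![0, 0, 2, 2], ![0, 2, 0, 2], ![0, 2, 2, 0]]

theorem triangle_swap : ∀ i j, i ≠ j → ∃ ℓ ℓ' : Fin 4, triangle i ℓ ≠ triangle i ℓ' ∧
    triangle j = triangle i ∘ Equiv.swap ℓ ℓ' := by
  decide +kernel

theorem triangle_mem (i : Fin 3) : triangle i ∈ W₀ := by
  revert i
  decide +kernel

/-- `tag` is a proper colouring with three colours, and `triangle` is a clique of size three. -/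
theorem chromaticNumber_conflictGraph : conflictGraph.chromaticNumber = 3 := by
  refine le_antisymm ?_ ?_
  · have C : conflictGraph.Coloring (Fin 3) := SimpleGraph.Coloring.mk (fun w => tag w.1) (by
      intro w w' h
      obtain ⟨ℓ, ℓ', hne, e⟩ := (conflictGraph_adj_iff w w').1 h
      rw [e]
      exact tag_ne_of_swap _ (eq_zero_or_two_of_ne _ (Finset.mem_insert.2 w.2.symm) ℓ ℓ' hne).1
        ℓ ℓ' hne)
    exact C.colorable.chromaticNumber_le
  · have hinj : Function.Injective fun i : Fin 3 => (⟨triangle i, Or.inl (triangle_mem i)⟩ :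
        CodeString) := by
      intro i j h
      have : triangle i = triangle j := congrArg Subtype.val h
      revert i j
      decide +kernel
    have h : conflictGraph.IsClique (Finset.univ.map ⟨_, hinj⟩ : Finset CodeString) := by
      rw [Finset.coe_map, Finset.coe_univ, Set.image_univ]
      rintro _ ⟨i, rfl⟩ _ ⟨j, rfl⟩ hij
      exact (conflictGraph_adj_iff _ _).2 (triangle_swap i j fun e => hij (by rw [e]))
    simpa using h.card_le_chromaticNumber

/-- Compare the coherence between a pair of letters and its exchange. As `ρ₀` is diagonal and `Q₀`
Hermitian, the condition makes it `-|Q₀(a,b)|² ≤ 0`, while equal tags make the pair count at least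
`1`. This works for every admissible `Q₀`. -/
theorem tag_ne_of_condition {D : ℕ} {c : (Fin 4 → Fin 3) → Fin D} {Q : Fin 2 → Op (Fin 3)}
    (h : MultiProbeCondition qutritL qutritRho Q (taggedCode c)) {w : Fin 4 → Fin 3} (hw : w ∈ W₀)
    {ℓ ℓ' : Fin 4} (hℓ : w ℓ ≠ w ℓ') (hw' : w ∘ Equiv.swap ℓ ℓ' ∈ W₀) :
    c w ≠ c (w ∘ Equiv.swap ℓ ℓ') := by
  intro hc
  have hne : ℓ ≠ ℓ' := fun e => hℓ (by rw [e])
  have e := congrFun (congrFun (h.2 0 0 ℓ ℓ' hne) (w ℓ, w ℓ')) (w ℓ', w ℓ)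
  rw [twoProbeMarginal_taggedCode, amplitude_zero_mul_star, if_pos rfl, Matrix.sub_apply,
    Matrix.kroneckerMap_apply, Matrix.kroneckerMap_apply] at e
  have hρ : qutritRho 0 (w ℓ) (w ℓ') = 0 := Matrix.diagonal_apply_ne _ hℓ
  simp only [hρ, zero_mul, zero_sub] at e
  rw [← (h.1 0).1.apply (w ℓ') (w ℓ), RCLike.star_def, Complex.mul_conj] at e
  have hcount : 1 ≤ pairCount c (words 0) (words 0) ℓ ℓ' (w ℓ, w ℓ') (w ℓ', w ℓ) := by
    refine le_trans ?_ (Finset.single_le_sum (fun _ _ => Nat.zero_le _) hw)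
    refine le_trans ?_ (Finset.single_le_sum (fun _ _ => Nat.zero_le _) hw')
    rw [if_pos]
    refine ⟨hc, rfl, rfl, ?_, ?_, fun k hk hk' => ?_⟩
    · simp
    · simp
    · rw [Function.comp_apply, Equiv.swap_apply_of_ne_of_ne hk hk']
  have hr := congrArg Complex.re e
  have hcast : (1 : ℝ) ≤ pairCount c (words 0) (words 0) ℓ ℓ' (w ℓ, w ℓ') (w ℓ', w ℓ) := by
    exact_mod_cast hcount
  have hn := Complex.normSq_nonneg (Q 0 (w ℓ) (w ℓ'))
  simp at hr
  linarith

theorem isLeast_ancilla_dimension :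
    IsLeast {D : ℕ | ∃ (c : (Fin 4 → Fin 3) → Fin D) (Q' : Fin 2 → Op (Fin 3)),
      MultiProbeCondition qutritL qutritRho Q' (taggedCode c)} 3 := by
  refine ⟨⟨tag, qutritQ, code41_eq_taggedCode ▸ multiProbeCondition_code41⟩, ?_⟩
  rintro D ⟨c, Q, h⟩
  have hinj : Function.Injective fun i => c (triangle i) := by
    intro i j hij
    by_contra hne
    obtain ⟨ℓ, ℓ', hℓ, e⟩ := triangle_swap i j hne
    exact tag_ne_of_condition h (triangle_mem i) hℓ (e ▸ triangle_mem j) (e ▸ hij)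
  simpa using Fintype.card_le_of_injective _ hinj

end QutritSensing

open QutritSensing

/-! ### The main theorem -/

theorem mainTheorem7 :
    -- the distance of the Hamiltonian to the Lindblad span
    (qutritH ∉ lindbladSpan qutritL ∧
      qutritS ∈ lindbladSpan qutritL ∧
      qutritH - qutritS = Matrix.diagonal ![1 / 2, -1 / 2, 1 / 2] ∧
      IsLeast ((fun X : Op (Fin 3) => ‖qutritH - X‖) ''
        (lindbladSpan qutritL : Set (Op (Fin 3))))
        ‖qutritH - qutritS‖ ∧
      lindbladDist qutritH qutritL =
        ‖qutritH - qutritS‖ ∧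
      ‖qutritH - qutritS‖ = 1 / 2) ∧
    -- `ρ_0`, `ρ_1` are the orthogonal density operators singled out by the two sensing conditions
    ((qutritRho 0 * qutritRho 1).trace = 0 ∧
      ∀ σ : Fin 2 → Op (Fin 3),
        (((∀ k, IsDensity (σ k)) ∧
          ((σ 0 - σ 1) * qutritH).trace =
            ((2 * lindbladDist qutritH qutritL : ℝ) : ℂ) ∧
          ∀ X ∈ lindbladSpan qutritL, ((σ 0 - σ 1) * X).trace = 0) ↔
        σ = qutritRho)) ∧
    -- the code words are orthonormal and satisfy the multi-probe condition
    ((∀ k k' : Fin 2, star (code41 k) ⬝ᵥ code41 k' =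
        if k = k' then 1 else 0) ∧
      MultiProbeCondition qutritL qutritRho qutritQ
        code41) ∧
    -- one recovery channel, independent of `ω`, `t` and the number of blocks
    (∃ R : SuperOp ((Fin 4 → Fin 3) × Fin 3),
      IsChannel R ∧
      sandwich (codeProj code41) ∘ₗ R = R ∧
      -- in the limit of fast error correction the logical state obeys the noiseless equation
      (∀ (ω : ℝ) (ρ : Op ((Fin 4 → Fin 3) × Fin 3)),
        sandwich (codeProj code41) ρ = ρ →
        ∃ ρL : ℝ → Op ((Fin 4 → Fin 3) × Fin 3),
          ρL 0 = ρ ∧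
          (∀ t a b, HasDerivAt (fun s => ρL s a b)
            (((-Complex.I * ((ω * 4 / 2 : ℝ) : ℂ)) •
              (logicalZ code41 * ρL t -
                ρL t * logicalZ code41)) a b) t) ∧
          ∀ t : ℝ, 0 ≤ t → Tendsto
            (fun K : ℕ => rounds
              (qecOp (codeProj code41) R)
              (blockGenerator 4 (Fin 3) qutritH qutritL ω) t K ρ)
            atTop (𝓝 (ρL t))) ∧
      -- `N = 4 n` probes prepared in the logical GHZ state reach QFI `N² t²`
      (∀ n : ℕ, 1 ≤ n →
        ∃ (ρK : ℕ → ℝ → ℝ → Op (Fin n → (Fin 4 → Fin 3) × Fin 3))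
          (ρlim : ℝ → ℝ → Op (Fin n → (Fin 4 → Fin 3) × Fin 3))
          (F : ℕ → ℝ → ℝ → ℝ),
          (∀ K t ω, ρK K t ω = rounds
            (tensorPower n
              (qecOp (codeProj code41) R))
            (arrayGenerator n 4 (Fin 3) qutritH qutritL ω) t K
            (ketbra (ghz code41 n)
              (ghz code41 n))) ∧
          ∀ t : ℝ, 0 ≤ t → ∀ ω : ℝ,
            Tendsto (fun K => ρK K t ω) atTop (𝓝 (ρlim t ω)) ∧
            IsQFI (ρlim t) ω (((4 * n : ℕ) : ℝ) ^ 2 * t ^ 2) ∧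
            (∀ K, IsQFI (ρK K t) ω (F K t ω)) ∧
            Tendsto (fun K => F K t ω) atTop (𝓝 (((4 * n : ℕ) : ℝ) ^ 2 * t ^ 2)))) ∧
    -- ancilla dimension three is the minimum for the construction
    (IsLeast {D : ℕ | ∃ (c : (Fin 4 → Fin 3) → Fin D) (Q' : Fin 2 → Op (Fin 3)),
        MultiProbeCondition qutritL qutritRho Q'
          (taggedCode c)} 3 ∧
      (∀ w w' : CodeString, conflictGraph.Adj w w' ↔
        ∃ ℓ ℓ' : Fin 4, w.1 ℓ ≠ w.1 ℓ' ∧ w'.1 = w.1 ∘ Equiv.swap ℓ ℓ') ∧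
      conflictGraph.chromaticNumber = 3) := by
  have hP := conjTranspose_codeProj code41
  have hPP := codeProj_mul_self orthonormal_code41
  refine ⟨⟨qutritH_notMem_lindbladSpan, qutritS_mem_lindbladSpan, qutritH_sub_qutritS,
    isLeast_norm_qutritH_sub, lindbladDist_qutrit, norm_qutritH_sub_qutritS⟩, ⟨?_, ?_⟩,
    ⟨orthonormal_code41, multiProbeCondition_code41⟩,
    ⟨krausMap (recoveryKraus (codeProj code41) (code41 1) fun ℓ => onProbe ℓ qutritL),
      isChannel_recovery hP codeProj_onProbe_L_conjTranspose_mul_codeProj hPP ?_,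
      sandwich_recovery hP hPP (codeProj_mulVec orthonormal_code41 1), ?_, ?_⟩,
    isLeast_ancilla_dimension, conflictGraph_adj_iff, chromaticNumber_conflictGraph⟩
  · simp [qutritRho, Matrix.trace, Fin.sum_univ_three]
  · have hd : ((2 * lindbladDist qutritH qutritL : ℝ) : ℂ) = 1 := by
      rw [lindbladDist_qutrit, norm_qutritH_sub_qutritS]
      norm_num
    intro σ
    rw [hd]
    constructor
    · rintro ⟨h1, h2, h3⟩
      exact eq_qutritRho h1 h2 h3
    · rintro rfl
      exact ⟨isDensity_qutritRho, trace_qutritRho_sub_mul_H, fun X => trace_qutritRho_sub_mul⟩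
  · simpa using orthonormal_code41 1 1
  · intro ω ρ hρ
    have h := exists_logical_evolution orthonormal_code41 codeProj_onProbe_L_codeProj
      codeProj_onProbe_L_conjTranspose_mul_codeProj codeProj_sum_onProbe_H_codeProj ω hρ
    rw [show ω * 4 / 2 = ω * 2 by ring]
    exact h
  · intro n hn
    have h := fun (t : ℝ) (ht : 0 ≤ t) (ω : ℝ) => array_limit orthonormal_code41
      codeProj_onProbe_L_codeProj codeProj_onProbe_L_conjTranspose_mul_codeProj
      codeProj_sum_onProbe_H_codeProj isHermitian_qutritH hn ht ω
    -- The inner `2` is the coefficient of `Z_L` in the projected Hamiltonian, that is `m / 2`; the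
    -- outer `2` is the gap of `Z_L`.
    have e : ∀ t : ℝ, ((4 * n : ℕ) : ℝ) ^ 2 * t ^ 2 = (2 * (n * (t * 2))) ^ 2 := fun t => by
      push_cast
      ring
    -- The Fisher informations are supplied only for `t ≥ 0`; `choose!` extends them by arbitrary
    -- values to negative times.
    choose! F hF using fun t ht ω => (h t ht ω).2.2
    refine ⟨_, fun t ω => phaseState (arrayCode code41 n) (2 * (n * (t * 2))) ω,
      fun K t ω => F t ω K, fun K t ω => rfl, fun t ht ω => ?_⟩
    rw [e]
    exact ⟨(h t ht ω).1, (h t ht ω).2.1, (hF t ht ω).1, (hF t ht ω).2⟩
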